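/- Let $d\ge 1$ and let $\mathbb{H}^d$ be the $d$-dimensional hyperbolic space of curvature $-1$, realised as the upper half-space $\{x\in\mathbb{R}^d: x_d>0\}$ with distance $d_1(x,y)=\operatorname{arcosh}\big(1+\tfrac{|x-y|^2}{2x_dy_d}\big)$ and with its $d$-dimensional Hausdorff measure (the Riemannian volume) $\mathcal{H}^d_1(\mathrm{d}x)=x_d^{-d}\,\mathrm{d}x$. Let $\partial\mathbb{H}^d=\{x_d=0\}\cup\{\infty\}$ be the set of ideal points. Fix $o\in\mathbb{H}^d$, write $B^d(o,R)$ for the open hyperbolic ball and $V_1(R)=\mathcal{H}^d_1(B^d(o,R))$. Let $\eta$ be a Poisson process on $\mathbb{H}^d$ with intensity measure $\gamma\mathcal{H}^d_1$, where $\gamma>0$, regarded as a random locally finite set. For $x\in\eta$ let $\ell(x,\eta)$ be the distance from $x$ to its radial nearest neighbour, i.e. to the nearest point among all $y\in\eta\cup\{o\}$ with $d_1(o,y)<d_1(o,x)$, and for $\alpha>0$ and $R>0$ let $$\mathcal{L}_R^{(\alpha)}=\sum_{x\in\eta\cap B^d(o,R)}\ell(x,\eta)^\alpha .$$ For an ideal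 point $e\in\partial\mathbb{H}^d$ and $y\in\mathbb{H}^d$ let ${\rm HB}_e(y)$ be the closed horoball around $e$ whose boundary passes through $y$, i.e. $\{z: B_\tau(z)\ge B_\tau(y)\}$, where $B_\tau(p)=\lim_{s\to\infty}(s-d_1(p,\tau(s)))$ is the Busemann function of a unit-speed geodesic ray $\tau$ tending to $e$ (the set does not depend on the choice of $\tau$). Let $\ell_e(y)$ be the distance from $y$ to the nearest point of $\eta\setminus\{y\}$ in ${\rm HB}_e(y)$, and for $x\in\mathbb{H}^d$ let $\ell_e^{(x)}(y)$ be the distance from $y$ to the nearest point of $(\eta\cup\{x\})\setminus\{y\}$ in ${\rm HB}_e(y)$; these are the lengths of the edges starting at $y$ in the hyperbolic directed spanning forests toward $e$ on $\eta\cup\{y\}$ and on $\eta\cup\{x,y\}$, respectively. Then for all $\alpha>0$, $\gamma>0$ and every ideal point $e\in\partial\mathbb{H}^d$, all the variances, expectations and integrals below are well defined and finite, and the limit $\lim_{R\to\infty}\operatorname{Var}[\mathcal{L}_R^{(\alpha)}]/V_1(R)$ exists and equals $$\gamma\,\mathbb{E}[\ell_e(o)^{2\alpha}]+2\gamma^2\int_{{\rm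 HB}_e(o)}\Big(\mathbb{E}\big[\ell_e^{(y)}(o)^\alpha\,\ell_e^{(o)}(y)^\alpha\big]-\mathbb{E}[\ell_e(o)^\alpha]\,\mathbb{E}[\ell_e(y)^\alpha]\Big)\,\mathcal{H}^d_1(\mathrm{d}y).$$ -/

import Mathlib

open MeasureTheory ProbabilityTheory Filter Topology
open scoped ENNReal

noncomputable section

namespace HypRST

/-- The upper half-space model of the hyperbolic space `ℍ^d` of constant curvature `-1`, in dimension
`d = n + 1`: the points of `ℝ^(n+1)` with positive last coordinate. The topology and the Borel
`σ`-field are those induced from `ℝ^(n+1)`; the Euclidean metric is *not* the hyperbolic one, which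
is `hdist` below. -/
abbrev HSpace (n : ℕ) : Type :=
  {x : EuclideanSpace ℝ (Fin (n + 1)) // 0 < x (Fin.last n)}

/-- The last coordinate of a point of the upper half-space. -/
def height {n : ℕ} (x : HSpace n) : ℝ := x.1 (Fin.last n)

/-- The hyperbolic distance. -/
def hdist {n : ℕ} (x y : HSpace n) : ℝ :=
  Real.arcosh (1 + ‖x.1 - y.1‖ ^ 2 / (2 * height x * height y))

/-- The open hyperbolic ball. -/
def hball {n : ℕ} (x : HSpace n) (r : ℝ) : Set (HSpace n) := {y | hdist x y < r}

/-- The Riemannian volume `x_d^{-d} dx` of `ℍ^d`, `d = n + 1`; it is the `d`-dimensional Hausdorff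
measure of the hyperbolic metric in its usual normalisation. -/
def hvol (n : ℕ) : Measure (HSpace n) :=
  ((volume : Measure (EuclideanSpace ℝ (Fin (n + 1)))).comap Subtype.val).withDensity
    fun x => ENNReal.ofReal (1 / height x ^ (n + 1))

/-- Geodesic rays `[0, ∞) → ℍ^d` parametrised by arc length (values at negative times are
irrelevant). -/
def IsGeodesicRay {n : ℕ} (τ : ℝ → HSpace n) : Prop :=
  ∀ s t : ℝ, 0 ≤ s → 0 ≤ t → hdist (τ s) (τ t) = |s - t|

/-- The boundary `∂ℍ^d`: the hyperplane `{x_d = 0}` together with a point at infinity. -/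
abbrev IdealPoint (n : ℕ) : Type :=
  OnePoint {x : EuclideanSpace ℝ (Fin (n + 1)) // x (Fin.last n) = 0}

/-- The curve `τ` tends to the ideal point `e`. -/
def TendsToIdeal {n : ℕ} (τ : ℝ → HSpace n) : IdealPoint n → Prop
  | none => Tendsto (fun t => ‖(τ t).1‖) atTop atTop
  | some b => Tendsto (fun t => (τ t).1) atTop (𝓝 b.1)

/-- The Busemann function `B_τ(p) = lim_{s → ∞} (s - d(p, τ(s)))` of a geodesic ray. -/
def busemann {n : ℕ} (τ : ℝ → HSpace n) (p : HSpace n) : ℝ :=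
  limUnder atTop fun s : ℝ => s - hdist p (τ s)

/-- The (closed) horoball `HB_e(y)` around the ideal point `e` whose boundary passes through `y`: the
superlevel set through `y` of the Busemann function of a geodesic ray tending to `e` (the Busemann
functions of two such rays differ by a constant). -/
def horoball {n : ℕ} (e : IdealPoint n) (y : HSpace n) : Set (HSpace n) :=
  {z | ∀ τ : ℝ → HSpace n, IsGeodesicRay τ → TendsToIdeal τ e → busemann τ y ≤ busemann τ z}

/-- The Poisson distribution with mean `m ∈ [0, ∞]`; mean `∞` means that the value is `∞`
almost surely. -/
def poissonLaw (m : ℝ≥0∞) : Measure ℕ∞ :=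
  if m = ∞ then Measure.dirac ⊤ else (poissonMeasure m.toNNReal).map (Nat.cast : ℕ → ℕ∞)

/-- `η` is a Poisson process on `ℍ^d` with intensity measure `μ`, viewed as a random locally finite
subset. -/
structure IsPoissonProcess {n : ℕ} {Ω : Type*} [MeasurableSpace Ω] (P : Measure Ω)
    (η : Ω → Set (HSpace n)) (μ : Measure (HSpace n)) : Prop where
  locallyFinite : ∀ ω x r, (η ω ∩ hball x r).Finite
  measurable_count : ∀ B, MeasurableSet B → Measurable fun ω => (η ω ∩ B).encard
  map_count : ∀ B, MeasurableSet B → P.map (fun ω => (η ω ∩ B).encard) = poissonLaw (μ B)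
  indep_count : ∀ (k : ℕ) (B : Fin k → Set (HSpace n)), (∀ i, MeasurableSet (B i)) →
    Pairwise (fun i j => Disjoint (B i) (B j)) →
    iIndepFun (fun i ω => (η ω ∩ B i).encard) P

/-- The distance from `x` to its nearest point in `S`, the minimum of `hdist x` over `S`
(which exists if `S` is non-empty and locally finite). -/
def nearestDist {n : ℕ} (x : HSpace n) (S : Set (HSpace n)) : ℝ := sInf (hdist x '' S)

/-- `ℓ(x, ξ)`: the length of the edge from `x` to its radial nearest neighbour in the radial spanning
tree on `ξ ∪ {o}` with base point `o`. -/
def radialLength {n : ℕ} (o : HSpace n) (ξ : Set (HSpace n)) (x : HSpace n) : ℝ :=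
  nearestDist x {y | y ∈ ξ ∪ {o} ∧ hdist o y < hdist o x}

/-- The edge-length functional `L_R^(α) = ∑_{x ∈ ξ ∩ B(o, R)} ℓ(x, ξ)^α`. -/
def edgeLengthFunctional {n : ℕ} (o : HSpace n) (α R : ℝ) (ξ : Set (HSpace n)) : ℝ :=
  ∑ᶠ x ∈ ξ ∩ hball o R, radialLength o ξ x ^ α

/-- The length of the edge that starts at the vertex `y` in the directed spanning forest on `ξ`
toward `e`: the distance from `y` to its nearest neighbour among the points `z ≠ y` of `ξ` in the
horoball `HB_e(y)`. -/
def directedLength {n : ℕ} (e : IdealPoint n) (ξ : Set (HSpace n)) (y : HSpace n) : ℝ :=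
  nearestDist y {z | z ∈ ξ ∧ z ≠ y ∧ z ∈ horoball e y}

/-- `ℓ_e(y)`, in the directed spanning forest on `ξ ∪ {y}`. -/
def ell {n : ℕ} (e : IdealPoint n) (ξ : Set (HSpace n)) (y : HSpace n) : ℝ :=
  directedLength e (ξ ∪ {y}) y

/-- `ℓ_e^(x)(y)`, in the directed spanning forest on `ξ ∪ {y, x}`. -/
def ellWith {n : ℕ} (e : IdealPoint n) (ξ : Set (HSpace n)) (x y : HSpace n) : ℝ :=
  directedLength e (ξ ∪ {y, x}) y

/-- The covariance term
`E[ℓ_e^(y)(o)^α ℓ_e^(o)(y)^α] - E[ℓ_e(o)^α] E[ℓ_e(y)^α]`. -/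
def covTerm {n : ℕ} {Ω : Type*} [MeasurableSpace Ω] (P : Measure Ω) (η : Ω → Set (HSpace n))
    (e : IdealPoint n) (α : ℝ) (o y : HSpace n) : ℝ :=
  (∫ ω, ellWith e (η ω) y o ^ α * ellWith e (η ω) o y ^ α ∂P)
    - (∫ ω, ell e (η ω) o ^ α ∂P) * ∫ ω, ell e (η ω) y ^ α ∂P

end HypRST

end

/-
Both tree models are governed by a level function `b`: minus the distance to the centre for the
radial tree, a Busemann function for the directed forest. The edge starting at `x` has length at
least `s` iff the upper ball `{z | b x < b z, d(x, z) < s}` contains no point, so its moments, and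
the mixed moments of two edges, are integrals of exponentials of volumes. By the Mecke formulas,
`Var L_R` is the integral over `B(o, R)` of the density `varDensity` at `x`, made up of a moment of
the edge at `x` and its covariances with the edges starting at points closer to `o`.

Upper balls contain balls of half their radius, which bounds all moments uniformly in `x`; two upper
balls meet only if one of them has radius at least half the distance of their centres, so the
covariance kernel is dominated by an integrable function of that distance. When the centre moves to
`e` along a geodesic ray, its upper balls converge to those of the Busemann function, and dominated
convergence gives the limit of the density. An isometry that exchanges the roles of `x` and `o`
turns `d(o, x) → ∞` into such a motion of the centre; finally, averages over large balls of a
bounded function converging at infinity have the same limit.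
-/

noncomputable section

namespace HypRST

variable {n : ℕ}

/-! ### The hyperbolic distance -/

/-- The Euclidean space containing the upper half-space. -/
abbrev Ambient (n : ℕ) : Type := EuclideanSpace ℝ (Fin (n + 1))

/-- The finite part `{x_d = 0}` of the ideal boundary. -/
abbrev BoundaryPlane (n : ℕ) : Type := {x : Ambient n // x (Fin.last n) = 0}

/-- The unit vector in the direction of the last coordinate. -/
def verticalUnit (n : ℕ) : Ambient n := EuclideanSpace.single (Fin.last n) 1

lemma norm_verticalUnit : ‖verticalUnit n‖ = 1 := by simp [verticalUnit]

lemma inner_verticalUnit (z : Ambient n) : inner ℝ z (verticalUnit n) = z (Fin.last n) := by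
  simp [verticalUnit, EuclideanSpace.inner_single_right]

lemma verticalUnit_last : verticalUnit n (Fin.last n) = 1 := by simp [verticalUnit]

lemma height_pos (x : HSpace n) : 0 < height x := x.2

lemma continuous_height : Continuous (height (n := n)) := by
  unfold height
  fun_prop

lemma one_le_cosh_arg (x y : HSpace n) : 1 ≤ 1 + ‖x.1 - y.1‖ ^ 2 / (2 * height x * height y) := by
  have := height_pos x
  have := height_pos y
  exact le_add_of_nonneg_right (by positivity)

lemma cosh_hdist (x y : HSpace n) :
    Real.cosh (hdist x y) = 1 + ‖x.1 - y.1‖ ^ 2 / (2 * height x * height y) :=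
  Real.cosh_arcosh (one_le_cosh_arg x y)

lemma hdist_nonneg (x y : HSpace n) : 0 ≤ hdist x y := Real.arcosh_nonneg (one_le_cosh_arg x y)

lemma hdist_comm (x y : HSpace n) : hdist x y = hdist y x := by
  unfold hdist
  rw [norm_sub_rev, mul_right_comm]

@[simp] lemma hdist_self (x : HSpace n) : hdist x x = 0 := by simp [hdist]

lemma hdist_eq_zero_iff {x y : HSpace n} : hdist x y = 0 ↔ x = y := by
  have hx := height_pos x
  have hy := height_pos y
  rw [hdist, Real.arcosh_eq_zero_iff (one_le_cosh_arg x y), add_eq_left, div_eq_zero_iff,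
    or_iff_left (by positivity), sq_eq_zero_iff, norm_sub_eq_zero_iff, Subtype.ext_iff]

lemma hdist_pos {x y : HSpace n} (h : x ≠ y) : 0 < hdist x y :=
  (hdist_nonneg x y).lt_of_ne' (hdist_eq_zero_iff.not.2 h)

lemma hdist_lt_iff {x y : HSpace n} {r : ℝ} (hr : 0 ≤ r) :
    hdist x y < r ↔ 1 + ‖x.1 - y.1‖ ^ 2 / (2 * height x * height y) < Real.cosh r := by
  rw [← cosh_hdist, Real.cosh_lt_cosh, abs_of_nonneg (hdist_nonneg x y), abs_of_nonneg hr]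

lemma continuous_hdist : Continuous fun p : HSpace n × HSpace n => hdist p.1 p.2 := by
  unfold hdist
  refine Real.continuousOn_arcosh.comp_continuous ?_ fun p => one_le_cosh_arg p.1 p.2
  have hfst : Continuous fun p : HSpace n × HSpace n => height p.1 :=
    continuous_height.comp continuous_fst
  have hsnd : Continuous fun p : HSpace n × HSpace n => height p.2 :=
    continuous_height.comp continuous_snd
  refine continuous_const.add (Continuous.div (by fun_prop) (by fun_prop) fun p => ?_)
  have := height_pos p.1
  have := height_pos p.2
  positivity

lemma measurable_hdist : Measurable fun p : HSpace n × HSpace n => hdist p.1 p.2 :=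
  continuous_hdist.measurable

lemma continuous_hdist_right (x : HSpace n) : Continuous (hdist x) :=
  continuous_hdist.comp (f := fun y => (x, y)) (by fun_prop)

lemma isOpen_hball (x : HSpace n) (r : ℝ) : IsOpen (hball x r) :=
  isOpen_lt (continuous_hdist_right x) continuous_const

lemma measurableSet_hball (x : HSpace n) (r : ℝ) : MeasurableSet (hball x r) :=
  (isOpen_hball x r).measurableSet

/-- The reflection of a point in the boundary hyperplane `{x_d = 0}`. -/
def mirror (w : HSpace n) : Ambient n := w.1 - (2 * height w) • verticalUnit n

lemma norm_sub_mirror_sq (z : Ambient n) (w : HSpace n) :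
    ‖z - mirror w‖ ^ 2 = ‖z - w.1‖ ^ 2 + 4 * z (Fin.last n) * height w := by
  have hsplit : z - mirror w = (z - w.1) + (2 * height w) • verticalUnit n := by
    unfold mirror
    abel
  have hlast : (z - w.1) (Fin.last n) = z (Fin.last n) - height w := rfl
  rw [hsplit, norm_add_sq_real, inner_smul_right, inner_verticalUnit, norm_smul, norm_verticalUnit,
    hlast, mul_one, Real.norm_eq_abs, sq_abs]
  ring

lemma dist_mirror_sq (z w : HSpace n) :
    dist z.1 (mirror w) ^ 2 = ‖z.1 - w.1‖ ^ 2 + 4 * height z * height w := by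
  rw [dist_eq_norm]
  exact norm_sub_mirror_sq z.1 w

lemma sinh_half_hdist (z w : HSpace n) :
    Real.sinh (hdist z w / 2) = dist z.1 w.1 / (2 * √(height z * height w)) := by
  have hz := height_pos z
  have hw := height_pos w
  have half_angle : Real.cosh (hdist z w) = 1 + 2 * Real.sinh (hdist z w / 2) ^ 2 := by
    rw [← mul_div_cancel₀ (hdist z w) two_ne_zero, Real.cosh_two_mul, Real.cosh_sq,
      mul_div_cancel₀ _ two_ne_zero]
    ring
  have hsq :
      Real.sinh (hdist z w / 2) ^ 2 = ‖z.1 - w.1‖ ^ 2 / (2 * height z * height w) / 2 := by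
    linarith [cosh_hdist z w]
  have hsinh : 0 ≤ Real.sinh (hdist z w / 2) :=
    Real.sinh_nonneg_iff.2 (div_nonneg (hdist_nonneg z w) zero_le_two)
  rw [← sq_eq_sq₀ hsinh (by positivity), hsq, div_pow, mul_pow, Real.sq_sqrt (by positivity),
    dist_eq_norm]
  field_simp

lemma cosh_half_hdist (z w : HSpace n) :
    Real.cosh (hdist z w / 2) = dist z.1 (mirror w) / (2 * √(height z * height w)) := by
  have hz := height_pos z
  have hw := height_pos w
  rw [← sq_eq_sq₀ (Real.cosh_pos _).le (by positivity), Real.cosh_sq', sinh_half_hdist, div_pow,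
    div_pow, mul_pow, Real.sq_sqrt (by positivity), dist_eq_norm, dist_mirror_sq]
  field_simp
  ring

lemma dist_mirror_comm (z w : HSpace n) : dist z.1 (mirror w) = dist w.1 (mirror z) := by
  rw [← sq_eq_sq₀ dist_nonneg dist_nonneg, dist_mirror_sq, dist_mirror_sq, norm_sub_rev w.1 z.1]
  ring

lemma dist_self_mirror (w : HSpace n) : dist w.1 (mirror w) = 2 * height w := by
  have := height_pos w
  rw [← sq_eq_sq₀ dist_nonneg (by positivity), dist_mirror_sq, sub_self, norm_zero]
  ring

-- By the half-angle formulas this is Ptolemy's inequality for `a`, `b`, `c` and `mirror b`.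
lemma hdist_triangle (a b c : HSpace n) : hdist a c ≤ hdist a b + hdist b c := by
  have ha := Real.sqrt_pos.2 (height_pos a)
  have hb := Real.sqrt_pos.2 (height_pos b)
  have hc := Real.sqrt_pos.2 (height_pos c)
  have ptolemy := EuclideanGeometry.mul_dist_le_mul_dist_add_mul_dist a.1 b.1 c.1 (mirror b)
  rw [dist_self_mirror, ← Real.sq_sqrt (height_pos b).le] at ptolemy
  suffices h : Real.sinh (hdist a c / 2) ≤ Real.sinh (hdist a b / 2 + hdist b c / 2) by
    linarith [Real.sinh_le_sinh.1 h]
  rw [Real.sinh_add, sinh_half_hdist, sinh_half_hdist, sinh_half_hdist, cosh_half_hdist,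
    cosh_half_hdist, dist_mirror_comm b c, Real.sqrt_mul (height_pos a).le,
    Real.sqrt_mul (height_pos a).le, Real.sqrt_mul (height_pos b).le]
  field_simp
  linarith

lemma mem_hball {x y : HSpace n} {r : ℝ} : y ∈ hball x r ↔ hdist x y < r := Iff.rfl

lemma hball_subset_hball {x y : HSpace n} {r s : ℝ} (h : hdist y x + r ≤ s) :
    hball x r ⊆ hball y s := fun z (hz : hdist x z < r) =>
  (hdist_triangle y x z).trans_lt (by linarith)

lemma disjoint_hball {x y : HSpace n} {r s : ℝ} (h : r + s ≤ hdist x y) :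
    Disjoint (hball x r) (hball y s) :=
  Set.disjoint_left.2 fun z (hxz : hdist x z < r) (hyz : hdist y z < s) => by
    linarith [hdist_triangle x z y, hdist_comm z y]

/-- The vertical geodesic with foot `b` through the points `b + exp t • e_d`, parametrised by arc
length and directed upwards. -/
def verticalLine (b : BoundaryPlane n) (t : ℝ) : HSpace n :=
  ⟨b.1 + Real.exp t • verticalUnit n, by simp [b.2, verticalUnit_last, Real.exp_pos]⟩

lemma height_verticalLine (b : BoundaryPlane n) (t : ℝ) :
    height (verticalLine b t) = Real.exp t := by
  simp [height, verticalLine, b.2, verticalUnit_last]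

lemma hdist_verticalLine (b : BoundaryPlane n) (s t : ℝ) :
    hdist (verticalLine b s) (verticalLine b t) = |s - t| := by
  have hsub : (verticalLine b s).1 - (verticalLine b t).1 =
      (Real.exp s - Real.exp t) • verticalUnit n := by
    simp [verticalLine, sub_smul]
  refine Real.cosh_injOn (hdist_nonneg _ _) (Set.mem_Ici.2 (abs_nonneg _)) ?_
  rw [cosh_hdist, height_verticalLine, height_verticalLine, hsub, norm_smul, norm_verticalUnit,
    mul_one, Real.norm_eq_abs, sq_abs, Real.cosh_abs, Real.cosh_eq, neg_sub, Real.exp_sub,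
    Real.exp_sub]
  field_simp
  ring

/-! ### Volume-preserving isometries -/

lemma measurableSet_upperHalf : MeasurableSet {x : Ambient n | 0 < x (Fin.last n)} :=
  measurableSet_lt measurable_const (by fun_prop)

lemma hvol_apply {B : Set (HSpace n)} (hB : MeasurableSet B) :
    hvol n B = ∫⁻ x in Subtype.val '' B, ENNReal.ofReal (1 / x (Fin.last n) ^ (n + 1)) := by
  rw [hvol, withDensity_apply _ hB]
  exact setLIntegral_subtype measurableSet_upperHalf B
    fun x => ENNReal.ofReal (1 / x (Fin.last n) ^ (n + 1))

/-- Isometries of the hyperbolic space, required to preserve the volume as well. -/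
structure IsHypIsometry (φ : HSpace n ≃ᵐ HSpace n) : Prop where
  measurePreserving : MeasurePreserving φ (hvol n) (hvol n)
  hdist_map : ∀ x y, hdist (φ x) (φ y) = hdist x y

lemma IsHypIsometry.trans {φ ψ : HSpace n ≃ᵐ HSpace n} (hφ : IsHypIsometry φ)
    (hψ : IsHypIsometry ψ) : IsHypIsometry (φ.trans ψ) where
  measurePreserving := hψ.measurePreserving.comp hφ.measurePreserving
  hdist_map x y := by
    simp only [MeasurableEquiv.trans_apply, hψ.hdist_map, hφ.hdist_map]

/-- Involutions of the upper half-space, given in Euclidean coordinates with their derivative `F'`,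
that are conformal with the factor `F(x)_d / x_d` by which the hyperbolic metric is preserved. -/
structure IsConformalInvolution (F : Ambient n → Ambient n)
    (F' : Ambient n → Ambient n →L[ℝ] Ambient n) : Prop where
  last_pos : ∀ x, 0 < x (Fin.last n) → 0 < F x (Fin.last n)
  involutive : ∀ x, 0 < x (Fin.last n) → F (F x) = x
  hasFDerivAt : ∀ x, 0 < x (Fin.last n) → HasFDerivAt F (F' x) x
  abs_det : ∀ x, 0 < x (Fin.last n) →
    |(F' x).det| = (F x (Fin.last n) / x (Fin.last n)) ^ (n + 1)
  norm_sub_sq_div : ∀ x y, 0 < x (Fin.last n) → 0 < y (Fin.last n) →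
    ‖F x - F y‖ ^ 2 / (F x (Fin.last n) * F y (Fin.last n)) =
      ‖x - y‖ ^ 2 / (x (Fin.last n) * y (Fin.last n))

namespace IsConformalInvolution

variable {F : Ambient n → Ambient n} {F' : Ambient n → Ambient n →L[ℝ] Ambient n}

/-- A conformal involution as a measurable bijection of the hyperbolic space. -/
def toMeasurableEquiv (hF : IsConformalInvolution F F') : HSpace n ≃ᵐ HSpace n :=
  MeasurableEquiv.ofInvolutive (fun x => ⟨F x.1, hF.last_pos x.1 x.2⟩)
    (fun x => Subtype.ext (hF.involutive x.1 x.2))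
    (Continuous.subtype_mk (continuous_iff_continuousAt.2 fun x =>
      (hF.hasFDerivAt x.1 x.2).continuousAt.comp continuous_subtype_val.continuousAt) _).measurable

lemma coe_toMeasurableEquiv (hF : IsConformalInvolution F F') (x : HSpace n) :
    (hF.toMeasurableEquiv x).1 = F x.1 := rfl

lemma val_image_preimage (hF : IsConformalInvolution F F') (B : Set (HSpace n)) :
    Subtype.val '' (hF.toMeasurableEquiv ⁻¹' B) = F '' (Subtype.val '' B) := by
  have hsymm : hF.toMeasurableEquiv ⁻¹' B = hF.toMeasurableEquiv '' B :=
    (hF.toMeasurableEquiv.image_eq_preimage_symm B).symm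
  rw [hsymm, Set.image_image, Set.image_image]
  rfl

lemma hvol_preimage (hF : IsConformalInvolution F F') {B : Set (HSpace n)} (hB : MeasurableSet B) :
    hvol n (hF.toMeasurableEquiv ⁻¹' B) = hvol n B := by
  have hpos : ∀ x ∈ (Subtype.val '' B : Set (Ambient n)), 0 < x (Fin.last n) := by
    rintro _ ⟨x, -, rfl⟩
    exact x.2
  have hmeas : MeasurableSet (Subtype.val '' B : Set (Ambient n)) :=
    (MeasurableEmbedding.subtype_coe measurableSet_upperHalf).measurableSet_image.2 hB
  have hinj : Set.InjOn F (Subtype.val '' B) := fun x hx y hy hxy => by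
    rw [← hF.involutive x (hpos x hx), hxy, hF.involutive y (hpos y hy)]
  rw [hvol_apply (hF.toMeasurableEquiv.measurable hB), hF.val_image_preimage, hvol_apply hB,
    lintegral_image_eq_lintegral_abs_det_fderiv_mul volume hmeas
      (fun x hx => (hF.hasFDerivAt x (hpos x hx)).hasFDerivWithinAt) hinj]
  refine setLIntegral_congr_fun hmeas fun x hx => ?_
  have hx_pos := hpos x hx
  have hFx_pos := hF.last_pos x hx_pos
  rw [hF.abs_det x hx_pos, ← ENNReal.ofReal_mul (by positivity), div_pow]
  congr 1
  field_simp

lemma isHypIsometry (hF : IsConformalInvolution F F') : IsHypIsometry hF.toMeasurableEquiv where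
  measurePreserving := ⟨hF.toMeasurableEquiv.measurable, Measure.ext fun B hB => by
    rw [Measure.map_apply hF.toMeasurableEquiv.measurable hB, hF.hvol_preimage hB]⟩
  hdist_map x y := by
    have halve : ∀ a b c : ℝ, a / (2 * b * c) = a / (b * c) / 2 := fun a b c => by
      rw [div_div, mul_comm (b * c), mul_assoc]
    unfold hdist height
    rw [halve, halve, coe_toMeasurableEquiv, coe_toMeasurableEquiv,
      hF.norm_sub_sq_div x.1 y.1 x.2 y.2]

end IsConformalInvolution

lemma abs_det_smul_reflection {E : Type*} [NormedAddCommGroup E] [InnerProductSpace ℝ E]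
    [FiniteDimensional ℝ E] (a : ℝ) (v : E) :
    |(a • ((ℝ ∙ v)ᗮ.reflection : E →L[ℝ] E)).det| = |a| ^ Module.finrank ℝ E := by
  have hcoe : LinearMap.det (((ℝ ∙ v)ᗮ.reflection : E →L[ℝ] E) : E →ₗ[ℝ] E) =
      LinearMap.det (ℝ ∙ v)ᗮ.reflection.toLinearMap := rfl
  rw [ContinuousLinearMap.det, ContinuousLinearMap.toLinearMap_smul, LinearMap.det_smul, abs_mul,
    hcoe, Submodule.det_reflection, abs_pow, abs_pow, abs_neg, abs_one, one_pow, mul_one]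

lemma abs_det_reflection {E : Type*} [NormedAddCommGroup E] [InnerProductSpace ℝ E]
    [FiniteDimensional ℝ E] (v : E) : |((ℝ ∙ v)ᗮ.reflection : E →L[ℝ] E).det| = 1 := by
  simpa using abs_det_smul_reflection 1 v

lemma isConformalInvolution_inversion (c : BoundaryPlane n) {ρ : ℝ} (hρ : 0 < ρ) :
    IsConformalInvolution (EuclideanGeometry.inversion c.1 ρ)
      (fun x => (ρ / dist x c.1) ^ 2 •
        ((ℝ ∙ (x - c.1))ᗮ.reflection : Ambient n →L[ℝ] Ambient n)) := by
  have hne : ∀ x : Ambient n, 0 < x (Fin.last n) → x ≠ c.1 := by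
    rintro x hx rfl
    exact hx.ne' c.2
  have hdist : ∀ x : Ambient n, 0 < x (Fin.last n) → 0 < dist x c.1 :=
    fun x hx => dist_pos.2 (hne x hx)
  have hlast : ∀ x : Ambient n, EuclideanGeometry.inversion c.1 ρ x (Fin.last n) =
      (ρ / dist x c.1) ^ 2 * x (Fin.last n) := fun x => by
    simp [EuclideanGeometry.inversion, c.2]
  refine ⟨fun x hx => ?_, fun x _ => EuclideanGeometry.inversion_inversion c.1 hρ.ne' x,
    fun x hx => EuclideanGeometry.hasFDerivAt_inversion (hne x hx), fun x hx => ?_,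
    fun x y hx hy => ?_⟩
  · rw [hlast]
    have := hdist x hx
    positivity
  · rw [abs_det_smul_reflection, hlast, abs_of_nonneg (by positivity), finrank_euclideanSpace_fin,
      mul_div_cancel_right₀ _ hx.ne']
  · have hx_dist := hdist x hx
    have hy_dist := hdist y hy
    rw [← dist_eq_norm, ← dist_eq_norm,
      EuclideanGeometry.dist_inversion_inversion (hne x hx) (hne y hy), hlast, hlast]
    field_simp

lemma isConformalInvolution_reflection (m : Ambient n) (u : BoundaryPlane n) :
    IsConformalInvolution (fun x => (ℝ ∙ u.1)ᗮ.reflection (x - m) + m)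
      (fun _ => ((ℝ ∙ u.1)ᗮ.reflection : Ambient n →L[ℝ] Ambient n)) := by
  have hlast : ∀ x : Ambient n,
      ((ℝ ∙ u.1)ᗮ.reflection (x - m) + m) (Fin.last n) = x (Fin.last n) := fun x => by
    rw [Submodule.reflection_orthogonal_apply, Submodule.reflection_singleton_apply]
    simp [u.2]
  refine ⟨fun x hx => ?_, fun x _ => by simp, fun x _ => ?_, fun x hx => ?_, fun x y _ _ => ?_⟩
  · rwa [hlast]
  · have hreflection := ((ℝ ∙ u.1)ᗮ.reflection : Ambient n →L[ℝ] Ambient n).hasFDerivAt (x := x - m)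
    exact (hreflection.comp x ((hasFDerivAt_id x).sub_const m)).add_const m
  · rw [abs_det_reflection, hlast, div_self hx.ne', one_pow]
  · simp only [hlast]
    rw [add_sub_add_right_eq_sub, ← map_sub, LinearIsometryEquiv.norm_map,
      sub_sub_sub_cancel_right]

section Apollonius

variable {E : Type*} [NormedAddCommGroup E] {a b : ℝ} {p q z : E}

/-- The radius of the sphere of Apollonius `‖z - p‖² b = ‖z - q‖² a`. -/
def apolloniusRadius (a b : ℝ) (p q : E) : ℝ := |(a - b)⁻¹| * √(a * b) * ‖p - q‖

lemma apolloniusRadius_sq (ha : 0 ≤ a) (hb : 0 ≤ b) :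
    apolloniusRadius a b p q ^ 2 = (a - b)⁻¹ ^ 2 * (a * b) * ‖p - q‖ ^ 2 := by
  rw [apolloniusRadius, mul_pow, mul_pow, sq_abs, Real.sq_sqrt (mul_nonneg ha hb)]

lemma apolloniusRadius_pos (ha : 0 < a) (hb : 0 < b) (hab : a ≠ b) (hpq : p ≠ q) :
    0 < apolloniusRadius a b p q := by
  have hnorm : 0 < ‖p - q‖ := norm_pos_iff.2 (sub_ne_zero.2 hpq)
  have : 0 < |(a - b)⁻¹| := abs_pos.2 (inv_ne_zero (sub_ne_zero.2 hab))
  unfold apolloniusRadius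
  positivity

variable [NormedSpace ℝ E]

/-- The centre of the sphere of Apollonius `‖z - p‖² b = ‖z - q‖² a`. -/
def apolloniusCenter (a b : ℝ) (p q : E) : E := (a - b)⁻¹ • (a • q - b • p)

lemma sub_apolloniusCenter (hab : a ≠ b) :
    z - apolloniusCenter a b p q = (a - b)⁻¹ • (a • (z - q) - b • (z - p)) := by
  have hz : z = ((a - b)⁻¹ * (a - b)) • z := by rw [inv_mul_cancel₀ (sub_ne_zero.2 hab), one_smul]
  nth_rewrite 1 [hz]
  unfold apolloniusCenter
  module

end Apollonius

section Apollonius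

variable {E : Type*} [NormedAddCommGroup E] [InnerProductSpace ℝ E] {a b : ℝ} {p q z : E}

lemma inner_sub_sub_half_smul_add_eq_zero (h : ‖z - p‖ = ‖z - q‖) :
    inner ℝ (p - q) (z - (1 / 2 : ℝ) • (p + q)) = 0 := by
  have hdiff : p - q = (z - q) - (z - p) := by abel
  have hmid : z - (1 / 2 : ℝ) • (p + q) = (1 / 2 : ℝ) • ((z - q) + (z - p)) := by module
  rw [hdiff, hmid, inner_smul_right, real_inner_comm,
    (real_inner_add_sub_eq_zero_iff _ _).2 h.symm, mul_zero]

lemma inversion_apollonius (ha : 0 < a) (hb : 0 < b) (hab : a ≠ b) (hpq : p ≠ q) :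
    EuclideanGeometry.inversion (apolloniusCenter a b p q) (apolloniusRadius a b p q) p = q := by
  have hnorm : ‖p - q‖ ≠ 0 := norm_ne_zero_iff.2 (sub_ne_zero.2 hpq)
  have : (a - b)⁻¹ ≠ 0 := inv_ne_zero (sub_ne_zero.2 hab)
  have hp : p - apolloniusCenter a b p q = ((a - b)⁻¹ * a) • (p - q) := by
    rw [sub_apolloniusCenter hab, sub_self, smul_zero, sub_zero, smul_smul]
  have hq : q - apolloniusCenter a b p q = ((a - b)⁻¹ * b) • (p - q) := by
    rw [sub_apolloniusCenter hab]
    module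
  have hfactor : (a - b)⁻¹ ^ 2 * (a * b) * ‖p - q‖ ^ 2 / (((a - b)⁻¹ * a) ^ 2 * ‖p - q‖ ^ 2) *
      ((a - b)⁻¹ * a) = (a - b)⁻¹ * b := by
    field_simp
  rw [EuclideanGeometry.inversion, vsub_eq_sub, vadd_eq_add, dist_eq_norm, div_pow,
    apolloniusRadius_sq ha.le hb.le, hp, norm_smul, mul_pow, Real.norm_eq_abs, sq_abs, smul_smul,
    hfactor, ← hq, sub_add_cancel]

lemma mem_sphere_apollonius (ha : 0 ≤ a) (hb : 0 ≤ b) (hab : a ≠ b)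
    (h : ‖z - p‖ ^ 2 * b = ‖z - q‖ ^ 2 * a) :
    z ∈ Metric.sphere (apolloniusCenter a b p q) (apolloniusRadius a b p q) := by
  have hpq : ‖p - q‖ ^ 2 = ‖z - q‖ ^ 2 - 2 * inner ℝ (z - q) (z - p) + ‖z - p‖ ^ 2 := by
    rw [← norm_sub_sq_real, sub_sub_sub_cancel_left]
  have hradius : 0 ≤ apolloniusRadius a b p q := by
    unfold apolloniusRadius
    positivity
  rw [Metric.mem_sphere, dist_eq_norm, ← sq_eq_sq₀ (norm_nonneg _) hradius,
    apolloniusRadius_sq ha hb, sub_apolloniusCenter hab, norm_smul, mul_pow, Real.norm_eq_abs,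
    sq_abs, norm_sub_sq_real, real_inner_smul_left, real_inner_smul_right, norm_smul, norm_smul,
    mul_pow, mul_pow, Real.norm_eq_abs, Real.norm_eq_abs, sq_abs, sq_abs, hpq]
  linear_combination ((a - b)⁻¹ ^ 2 * (b - a)) * h

end Apollonius

lemma norm_sub_sq_mul_height_of_hdist_eq {p q z : HSpace n} (h : hdist z p = hdist z q) :
    ‖z.1 - p.1‖ ^ 2 * height q = ‖z.1 - q.1‖ ^ 2 * height p := by
  have hp := height_pos p
  have hq := height_pos q
  have hz := height_pos z
  have hcosh := congrArg Real.cosh h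
  rw [cosh_hdist, cosh_hdist] at hcosh
  field_simp at hcosh
  linarith

lemma exists_isometry_swap_of_height_eq {p q : HSpace n} (h : height p = height q) :
    ∃ φ : HSpace n ≃ᵐ HSpace n, IsHypIsometry φ ∧ φ p = q ∧
      ∀ z, hdist z p = hdist z q → φ z = z := by
  let u : BoundaryPlane n := ⟨p.1 - q.1, sub_eq_zero.2 h⟩
  have hF := isConformalInvolution_reflection ((1 / 2 : ℝ) • (p.1 + q.1)) u
  refine ⟨hF.toMeasurableEquiv, hF.isHypIsometry, Subtype.ext ?_, fun z hz => Subtype.ext ?_⟩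
  · have hmid : p.1 - (1 / 2 : ℝ) • (p.1 + q.1) = (1 / 2 : ℝ) • u.1 := by
      simp only [u]
      module
    rw [hF.coe_toMeasurableEquiv, hmid, map_smul,
      Submodule.reflection_orthogonalComplement_singleton_eq_neg]
    simp only [u]
    module
  · have hnorm : ‖z.1 - p.1‖ = ‖z.1 - q.1‖ := by
      have hsq := norm_sub_sq_mul_height_of_hdist_eq hz
      rw [h] at hsq
      exact (sq_eq_sq₀ (norm_nonneg _) (norm_nonneg _)).1
        (mul_right_cancel₀ (height_pos q).ne' hsq)
    rw [hF.coe_toMeasurableEquiv, ← eq_sub_iff_add_eq, Submodule.reflection_eq_self_iff,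
      Submodule.mem_orthogonal_singleton_iff_inner_right]
    exact inner_sub_sub_half_smul_add_eq_zero hnorm

lemma exists_isometry_swap_of_height_ne {p q : HSpace n} (h : height p ≠ height q) :
    ∃ φ : HSpace n ≃ᵐ HSpace n, IsHypIsometry φ ∧ φ p = q ∧
      ∀ z, hdist z p = hdist z q → φ z = z := by
  have hp := height_pos p
  have hq := height_pos q
  have hpq : p.1 ≠ q.1 := fun hpq => h (congrArg (· (Fin.last n)) hpq)
  have hlast : apolloniusCenter (height p) (height q) p.1 q.1 (Fin.last n) = 0 := by
    change (height p - height q)⁻¹ * (height p * height q - height q * height p) = 0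
    rw [mul_comm (height p), sub_self, mul_zero]
  have hF := isConformalInvolution_inversion ⟨_, hlast⟩ (apolloniusRadius_pos hp hq h hpq)
  exact ⟨hF.toMeasurableEquiv, hF.isHypIsometry, Subtype.ext (inversion_apollonius hp hq h hpq),
    fun z hz => Subtype.ext (EuclideanGeometry.inversion_of_mem_sphere
      (mem_sphere_apollonius hp.le hq.le h (norm_sub_sq_mul_height_of_hdist_eq hz)))⟩

-- The bisector of `p` and `q` is a Euclidean hyperplane or sphere, and `φ` is the reflection or
-- inversion in it.
lemma exists_isometry_swap (p q : HSpace n) :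
    ∃ φ : HSpace n ≃ᵐ HSpace n, IsHypIsometry φ ∧ φ p = q ∧
      ∀ z, hdist z p = hdist z q → φ z = z := by
  by_cases h : height p = height q
  · exact exists_isometry_swap_of_height_eq h
  · exact exists_isometry_swap_of_height_ne h

lemma exists_isometry_of_hdist_eq {a b a' b' : HSpace n} (h : hdist a b = hdist a' b') :
    ∃ φ : HSpace n ≃ᵐ HSpace n, IsHypIsometry φ ∧ φ a = a' ∧ φ b = b' := by
  obtain ⟨φ, hφ, hφa, -⟩ := exists_isometry_swap a a'
  obtain ⟨ψ, hψ, hψb, hfix⟩ := exists_isometry_swap (φ b) b'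
  have hψa : ψ a' = a' := hfix a' (by rw [← h, ← hφ.hdist_map a b, hφa])
  exact ⟨φ.trans ψ, hφ.trans hψ, by rw [MeasurableEquiv.trans_apply, hφa, hψa], hψb⟩

lemma exists_isometry_apply_eq (a b : HSpace n) :
    ∃ φ : HSpace n ≃ᵐ HSpace n, IsHypIsometry φ ∧ φ a = b :=
  let ⟨φ, hφ, hab, _⟩ := exists_isometry_swap a b
  ⟨φ, hφ, hab⟩

/-! ### Geodesics and volume growth -/

/-- An arbitrary base point of the hyperbolic space. -/
def basePoint (n : ℕ) : HSpace n := verticalLine ⟨0, rfl⟩ 0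

lemma exists_hdist_eq (x : HSpace n) {t : ℝ} (ht : 0 ≤ t) : ∃ m, hdist x m = t := by
  obtain ⟨φ, hφ, hx⟩ := exists_isometry_apply_eq (basePoint n) x
  refine ⟨φ (verticalLine ⟨0, rfl⟩ t), ?_⟩
  rw [← hx, hφ.hdist_map, basePoint, hdist_verticalLine, zero_sub, abs_neg, abs_of_nonneg ht]

lemma exists_between (x c : HSpace n) {s : ℝ} (hs : 0 ≤ s) (hsc : s ≤ hdist x c) :
    ∃ m, hdist x m = s ∧ hdist m c = hdist x c - s := by
  have hline : hdist (verticalLine (n := n) ⟨0, rfl⟩ 0) (verticalLine ⟨0, rfl⟩ (hdist x c)) =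
      hdist x c := by
    rw [hdist_verticalLine, zero_sub, abs_neg, abs_of_nonneg (hdist_nonneg x c)]
  obtain ⟨φ, hφ, hφx, hφc⟩ := exists_isometry_of_hdist_eq hline
  refine ⟨φ (verticalLine ⟨0, rfl⟩ s), ?_, ?_⟩
  · rw [← hφx, hφ.hdist_map, hdist_verticalLine, zero_sub, abs_neg, abs_of_nonneg hs]
  · nth_rewrite 1 [← hφc]
    rw [hφ.hdist_map, hdist_verticalLine, abs_sub_comm, abs_of_nonneg (sub_nonneg.2 hsc)]

lemma measurableSet_val_image {B : Set (HSpace n)} (hB : MeasurableSet B) :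
    MeasurableSet (Subtype.val '' B : Set (Ambient n)) :=
  (MeasurableEmbedding.subtype_coe measurableSet_upperHalf).measurableSet_image.2 hB

lemma hvol_eq_zero_iff {B : Set (HSpace n)} :
    hvol n B = 0 ↔ volume (Subtype.val '' B : Set (Ambient n)) = 0 := by
  have hsupport : {x : HSpace n | ENNReal.ofReal (1 / height x ^ (n + 1)) ≠ 0} = Set.univ :=
    Set.eq_univ_of_forall fun x =>
      (ENNReal.ofReal_pos.2 (one_div_pos.2 (pow_pos (height_pos x) _))).ne'
  have hmeas : Measurable fun x : HSpace n => ENNReal.ofReal (1 / height x ^ (n + 1)) :=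
    (measurable_const.div (continuous_height.measurable.pow_const _)).ennreal_ofReal
  rw [hvol, withDensity_apply_eq_zero hmeas, hsupport, Set.univ_inter,
    (MeasurableEmbedding.subtype_coe measurableSet_upperHalf).comap_apply]
  rfl

instance : NullSingletonClass (hvol n) := ⟨fun x => hvol_eq_zero_iff.2 (by simp)⟩

lemma abs_height_sub_le (x z : HSpace n) : |height x - height z| ≤ ‖x.1 - z.1‖ :=
  PiLp.norm_apply_le (x.1 - z.1) (Fin.last n)

lemma norm_sub_sq_lt_of_mem_hball {x z : HSpace n} {r : ℝ} (hz : z ∈ hball x r) :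
    ‖x.1 - z.1‖ ^ 2 < (Real.cosh r - 1) * (2 * height x * height z) := by
  have hx := height_pos x
  have hz_pos := height_pos z
  have hcosh := (hdist_lt_iff ((hdist_nonneg x z).trans (mem_hball.1 hz).le)).1 hz
  rw [← div_lt_iff₀ (by positivity)]
  linarith

lemma height_le_of_mem_hball {x z : HSpace n} {r : ℝ} (hz : z ∈ hball x r) :
    height x ≤ 2 * Real.cosh r * height z := by
  have hx := height_pos x
  have hsq : (height x - height z) ^ 2 ≤ ‖x.1 - z.1‖ ^ 2 :=
    sq_le_sq.2 ((abs_height_sub_le x z).trans (le_abs_self _))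
  have hnorm := norm_sub_sq_lt_of_mem_hball hz
  refine le_of_mul_le_mul_left ?_ hx
  nlinarith [sq_nonneg (height z)]

lemma val_image_hball_subset (x : HSpace n) (r : ℝ) :
    (Subtype.val '' hball x r : Set (Ambient n)) ⊆
      Metric.closedBall x.1 (2 * height x * Real.cosh r) := by
  have hx := height_pos x
  have := Real.one_le_cosh r
  rintro _ ⟨z, hz, rfl⟩
  have hnorm := norm_sub_sq_lt_of_mem_hball hz
  have hheight : height z ≤ 2 * Real.cosh r * height x :=
    height_le_of_mem_hball (x := z) (z := x) (by rwa [mem_hball, hdist_comm])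
  rw [Metric.mem_closedBall, dist_comm, dist_eq_norm]
  refine abs_le_of_sq_le_sq' ?_ (by positivity) |>.2
  calc ‖x.1 - z.1‖ ^ 2 ≤ (Real.cosh r - 1) * (2 * height x * height z) := hnorm.le
    _ ≤ Real.cosh r * (2 * height x * (2 * Real.cosh r * height x)) := by
        have := (height_pos z).le
        gcongr
        linarith
    _ = (2 * height x * Real.cosh r) ^ 2 := by ring

lemma hvol_hball_lt_top (x : HSpace n) (r : ℝ) : hvol n (hball x r) < ∞ := by
  have hx := height_pos x
  have := Real.cosh_pos r
  rw [hvol_apply (measurableSet_hball x r)]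
  calc _ ≤ ∫⁻ _ in (Subtype.val '' hball x r : Set (Ambient n)),
        ENNReal.ofReal (1 / (height x / (2 * Real.cosh r)) ^ (n + 1)) := by
        refine setLIntegral_mono' (measurableSet_val_image (measurableSet_hball x r)) ?_
        rintro _ ⟨z, hz, rfl⟩
        have hheight : height x / (2 * Real.cosh r) ≤ z.1 (Fin.last n) :=
          (div_le_iff₀' (by positivity)).2 (height_le_of_mem_hball hz)
        gcongr
    _ < ∞ := by
        rw [setLIntegral_const]
        exact ENNReal.mul_lt_top ENNReal.ofReal_lt_top
          ((measure_mono (val_image_hball_subset x r)).trans_lt measure_closedBall_lt_top)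

lemma hvol_hball_pos (x : HSpace n) {r : ℝ} (hr : 0 < r) : 0 < hvol n (hball x r) := by
  rw [pos_iff_ne_zero, Ne, hvol_eq_zero_iff]
  have hopen : IsOpen {x : Ambient n | 0 < x (Fin.last n)} :=
    isOpen_lt continuous_const (by fun_prop)
  exact ((hopen.isOpenMap_subtype_val _ (isOpen_hball x r)).measure_pos volume
    ⟨x.1, x, by rwa [mem_hball, hdist_self], rfl⟩).ne'

lemma iUnion_hball (x : HSpace n) : ⋃ k : ℕ, hball x k = Set.univ :=
  Set.eq_univ_of_forall fun z => Set.mem_iUnion.2 (exists_nat_gt (hdist x z))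

instance : SigmaFinite (hvol n) :=
  ⟨⟨{ set := fun k => hball (basePoint n) k
      set_mem := fun _ => trivial
      finite := fun _ => hvol_hball_lt_top _ _
      spanning := iUnion_hball _ }⟩⟩

lemma IsHypIsometry.preimage_hball {φ : HSpace n ≃ᵐ HSpace n} (hφ : IsHypIsometry φ)
    (x : HSpace n) (r : ℝ) : φ ⁻¹' hball (φ x) r = hball x r := by
  ext z
  simp [mem_hball, hφ.hdist_map]

lemma IsHypIsometry.hvol_preimage {φ : HSpace n ≃ᵐ HSpace n} (hφ : IsHypIsometry φ)
    (B : Set (HSpace n)) : hvol n (φ ⁻¹' B) = hvol n B :=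
  hφ.measurePreserving.measure_preimage_equiv B

/-- The volume of the hyperbolic balls of radius `r`. -/
def ballVol (n : ℕ) (r : ℝ) : ℝ := (hvol n (hball (basePoint n) r)).toReal

lemma hvol_hball (x : HSpace n) (r : ℝ) : hvol n (hball x r) = ENNReal.ofReal (ballVol n r) := by
  obtain ⟨φ, hφ, hx⟩ := exists_isometry_apply_eq x (basePoint n)
  rw [ballVol, ENNReal.ofReal_toReal (hvol_hball_lt_top _ _).ne, ← hx,
    ← hφ.hvol_preimage (hball (φ x) r), hφ.preimage_hball]

lemma ballVol_nonneg (r : ℝ) : 0 ≤ ballVol n r := ENNReal.toReal_nonneg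

lemma ballVol_mono : Monotone (ballVol n) := fun _ _ h =>
  ENNReal.toReal_mono (hvol_hball_lt_top _ _).ne
    (measure_mono (hball_subset_hball (by simpa using h)))

lemma ballVol_pos {r : ℝ} (hr : 0 < r) : 0 < ballVol n r :=
  ENNReal.toReal_pos (hvol_hball_pos _ hr).ne' (hvol_hball_lt_top _ _).ne

lemma ballVol_add_ballVol_one_le {t : ℝ} (ht : 0 ≤ t) :
    ballVol n t + ballVol n 1 ≤ ballVol n (t + 2) := by
  obtain ⟨m, hm⟩ := exists_hdist_eq (basePoint n) (t := t + 1) (by linarith)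
  have hunion : hvol n (hball (basePoint n) t) + hvol n (hball m 1) ≤
      hvol n (hball (basePoint n) (t + 2)) := by
    rw [← measure_union (disjoint_hball hm.ge) (measurableSet_hball _ _)]
    refine measure_mono (Set.union_subset (hball_subset_hball ?_) (hball_subset_hball ?_))
    · simp
    · linarith
  rwa [hvol_hball, hvol_hball, hvol_hball,
    ← ENNReal.ofReal_add (ballVol_nonneg _) (ballVol_nonneg _),
    ENNReal.ofReal_le_ofReal_iff (ballVol_nonneg _)] at hunion

lemma ballVol_linear_growth (t : ℝ) : ballVol n 1 / 2 * (t - 1) ≤ ballVol n t := by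
  have hunit := ballVol_pos (n := n) one_pos
  have odd_radius : ∀ k : ℕ, (k + 1) * ballVol n 1 ≤ ballVol n (2 * k + 1) := by
    intro k
    induction k with
    | zero => simp
    | succ k ih =>
      have hstep := ballVol_add_ballVol_one_le (n := n) (t := 2 * k + 1) (by positivity)
      have hradius : (2 : ℝ) * (k + 1 : ℕ) + 1 = 2 * k + 1 + 2 := by
        push_cast
        ring
      rw [hradius]
      push_cast
      linarith
  rcases lt_or_ge t 1 with ht | ht
  · nlinarith [ballVol_nonneg (n := n) t]
  · have hfloor := Nat.floor_le (a := (t - 1) / 2) (by linarith)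
    calc ballVol n 1 / 2 * (t - 1) = (t - 1) / 2 * ballVol n 1 := by ring
      _ ≤ (⌊(t - 1) / 2⌋₊ + 1) * ballVol n 1 := by
          gcongr
          exact (Nat.lt_floor_add_one _).le
      _ ≤ ballVol n (2 * ⌊(t - 1) / 2⌋₊ + 1) := odd_radius _
      _ ≤ ballVol n t := ballVol_mono (by linarith)

lemma tendsto_ballVol : Tendsto (ballVol n) atTop atTop := by
  have hunit := ballVol_pos (n := n) one_pos
  exact tendsto_atTop_mono ballVol_linear_growth
    ((tendsto_atTop_add_const_right _ (-1) tendsto_id).const_mul_atTop (by positivity))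

-- A unit ball around the point at distance `s - 1` on the geodesic from `p` to `z` is admissible.
lemma ballVol_one_le_hvol_inter {p z : HSpace n} {s t : ℝ} (hs : 1 ≤ s) (ht : 1 ≤ t)
    (hz : hdist p z + 2 ≤ s + t) :
    ENNReal.ofReal (ballVol n 1) ≤ hvol n (hball z t ∩ hball p s) := by
  obtain ⟨m, hpm, hzm⟩ : ∃ m, hdist p m + 1 ≤ s ∧ hdist z m + 1 ≤ t := by
    rcases le_total (s - 1) (hdist p z) with h | h
    · obtain ⟨m, hpm, hmz⟩ := exists_between p z (sub_nonneg.2 hs) h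
      exact ⟨m, by linarith, by linarith [hdist_comm z m]⟩
    · exact ⟨z, by linarith, by simpa using ht⟩
  rw [← hvol_hball m 1]
  exact measure_mono (Set.subset_inter (hball_subset_hball hzm) (hball_subset_hball hpm))

lemma ballVol_one_mul_ballVol_le {r s t : ℝ} (hs : 1 ≤ s) (ht : 1 ≤ t) (hr : r + 2 ≤ s + t) :
    ballVol n 1 * ballVol n r ≤ ballVol n s * ballVol n t := by
  let p := basePoint n
  have hclose : MeasurableSet {q : HSpace n × HSpace n | hdist q.1 q.2 < t} :=
    measurableSet_lt measurable_hdist measurable_const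
  have double_counting : ENNReal.ofReal (ballVol n 1) * hvol n (hball p r) ≤
      ENNReal.ofReal (ballVol n t) * hvol n (hball p s) := by
    calc _ = ∫⁻ _ in hball p r, ENNReal.ofReal (ballVol n 1) ∂hvol n := by
          rw [setLIntegral_const]
      _ ≤ ∫⁻ z in hball p r, (hvol n).restrict (hball p s) (hball z t) ∂hvol n := by
          refine setLIntegral_mono' (measurableSet_hball _ _) fun z hz => ?_
          rw [Measure.restrict_apply (measurableSet_hball _ _)]
          exact ballVol_one_le_hvol_inter hs ht (by linarith [mem_hball.1 hz])
      _ ≤ ∫⁻ z, (hvol n).restrict (hball p s) (hball z t) ∂hvol n :=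
          setLIntegral_le_lintegral _ _
      _ = ∫⁻ u in hball p s, hvol n {z | hdist z u < t} ∂hvol n :=
          (Measure.prod_apply hclose).symm.trans (Measure.prod_apply_symm hclose)
      _ = ∫⁻ _ in hball p s, ENNReal.ofReal (ballVol n t) ∂hvol n := by
          refine lintegral_congr fun u => ?_
          rw [← hvol_hball u t]
          simp only [hball, hdist_comm u]
      _ = _ := by rw [setLIntegral_const]
  rwa [hvol_hball, hvol_hball, ← ENNReal.ofReal_mul (ballVol_nonneg _),
    ← ENNReal.ofReal_mul (ballVol_nonneg _), ENNReal.ofReal_le_ofReal_iff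
      (mul_nonneg (ballVol_nonneg _) (ballVol_nonneg _)), mul_comm (ballVol n t)] at double_counting

lemma exists_ballVol_four_mul_le : ∃ C : ℝ, 0 ≤ C ∧
    ∀ j : ℝ, 1 ≤ j → ballVol n (4 * j + 4) ≤ C * ballVol n j ^ 4 := by
  have hunit : 0 < ballVol n 1 := ballVol_pos one_pos
  refine ⟨(ballVol n (9 / 2) / ballVol n 1) ^ 4 / ballVol n 1 ^ 3, by
    have := ballVol_nonneg (n := n) (9 / 2)
    positivity, fun j hj => ?_⟩
  have quarter : ballVol n (4 * j + 4) ≤ ballVol n (2 * j + 3) ^ 2 / ballVol n 1 := by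
    rw [le_div_iff₀' hunit, sq]
    exact ballVol_one_mul_ballVol_le (by linarith) (by linarith) (by linarith)
  have half : ballVol n (2 * j + 3) ≤ ballVol n (j + 5 / 2) ^ 2 / ballVol n 1 := by
    rw [le_div_iff₀' hunit, sq]
    exact ballVol_one_mul_ballVol_le (by linarith) (by linarith) (by linarith)
  have shift : ballVol n (j + 5 / 2) ≤ ballVol n (9 / 2) / ballVol n 1 * ballVol n j := by
    rw [div_mul_eq_mul_div, le_div_iff₀' hunit]
    exact ballVol_one_mul_ballVol_le (by norm_num) hj (by linarith)
  have := ballVol_nonneg (n := n) (2 * j + 3)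
  have := ballVol_nonneg (n := n) (j + 5 / 2)
  calc _ ≤ ballVol n (2 * j + 3) ^ 2 / ballVol n 1 := quarter
    _ ≤ (ballVol n (j + 5 / 2) ^ 2 / ballVol n 1) ^ 2 / ballVol n 1 := by gcongr
    _ ≤ ((ballVol n (9 / 2) / ballVol n 1 * ballVol n j) ^ 2 / ballVol n 1) ^ 2 /
          ballVol n 1 := by gcongr
    _ = _ := by field_simp

lemma pow_four_mul_exp_neg_le {c v : ℝ} (hc : 0 < c) (hv : 0 ≤ v) :
    v ^ 4 * Real.exp (-c * v) ≤ 24 * (2 / c) ^ 4 * Real.exp (-(c / 2) * v) := by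
  have hpow : v ^ 4 ≤ 24 * (2 / c) ^ 4 * Real.exp (c / 2 * v) := by
    calc v ^ 4 = 24 * (2 / c) ^ 4 * ((c / 2 * v) ^ 4 / (Nat.factorial 4 : ℝ)) := by
          simp only [Nat.factorial]
          field_simp
          norm_num
      _ ≤ _ := by
          gcongr
          exact Real.pow_div_factorial_le_exp (c / 2 * v) (by positivity) 4
  calc v ^ 4 * Real.exp (-c * v)
      ≤ 24 * (2 / c) ^ 4 * Real.exp (c / 2 * v) * Real.exp (-c * v) := by gcongr
    _ = 24 * (2 / c) ^ 4 * Real.exp (-(c / 2) * v) := by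
        rw [mul_assoc, ← Real.exp_add]
        ring_nf

lemma summable_ballVol_mul_exp_neg {c : ℝ} (hc : 0 < c) :
    Summable fun j : ℕ => ballVol n (4 * j + 4) * Real.exp (-c * ballVol n j) := by
  obtain ⟨C, hC, hgrowth⟩ := exists_ballVol_four_mul_le (n := n)
  have hunit : 0 < ballVol n 1 := ballVol_pos one_pos
  have hgeom : Summable fun j : ℕ => C * (24 * (2 / c) ^ 4) *
      Real.exp (j * -(c / 2 * (ballVol n 1 / 2))) :=
    (Real.summable_exp_nat_mul_iff.2 (neg_neg_of_pos (by positivity))).mul_left _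
  refine (summable_nat_add_iff 1).1 (Summable.of_nonneg_of_le
    (fun j => mul_nonneg (ballVol_nonneg _) (Real.exp_pos _).le) (fun j => ?_) hgeom)
  have hexponent : -(c / 2) * ballVol n ((j + 1 : ℕ) : ℝ) ≤ j * -(c / 2 * (ballVol n 1 / 2)) := by
    have hlinear := ballVol_linear_growth (n := n) ((j + 1 : ℕ) : ℝ)
    push_cast at hlinear ⊢
    nlinarith
  calc _ ≤ C * ballVol n ((j + 1 : ℕ) : ℝ) ^ 4 *
        Real.exp (-c * ballVol n ((j + 1 : ℕ) : ℝ)) := by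
        gcongr
        exact hgrowth _ (by simp)
    _ ≤ C * (24 * (2 / c) ^ 4 * Real.exp (-(c / 2) * ballVol n ((j + 1 : ℕ) : ℝ))) := by
        rw [mul_assoc]
        exact mul_le_mul_of_nonneg_left (pow_four_mul_exp_neg_le hc (ballVol_nonneg _)) hC
    _ ≤ _ := by
        rw [← mul_assoc]
        exact mul_le_mul_of_nonneg_left (Real.exp_le_exp.2 hexponent) (by positivity)

lemma lintegral_exp_neg_ballVol_lt_top (x : HSpace n) {c : ℝ} (hc : 0 < c) :
    ∫⁻ y, ENNReal.ofReal (Real.exp (-c * ballVol n (hdist x y / 4))) ∂hvol n < ∞ := by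
  have hterm : ∀ j : ℕ, 0 ≤ ballVol n (4 * j + 4) * Real.exp (-c * ballVol n j) :=
    fun j => mul_nonneg (ballVol_nonneg _) (Real.exp_pos _).le
  calc _ ≤ ∫⁻ y, ∑' j : ℕ, (hball x (4 * j + 4)).indicator
        (fun _ => ENNReal.ofReal (Real.exp (-c * ballVol n j))) y ∂hvol n := by
        refine lintegral_mono fun y => ?_
        have hfloor := Nat.floor_le (a := hdist x y / 4) (by linarith [hdist_nonneg x y])
        have hmem : y ∈ hball x (4 * (⌊hdist x y / 4⌋₊ : ℝ) + 4) := by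
          rw [mem_hball]
          linarith [Nat.lt_floor_add_one (hdist x y / 4)]
        refine le_trans ?_ (ENNReal.le_tsum ⌊hdist x y / 4⌋₊)
        rw [Set.indicator_of_mem hmem]
        refine ENNReal.ofReal_le_ofReal (Real.exp_le_exp.2 ?_)
        exact mul_le_mul_of_nonpos_left (ballVol_mono hfloor) (neg_nonpos.2 hc.le)
    _ = ∑' j : ℕ, ENNReal.ofReal (ballVol n (4 * j + 4) * Real.exp (-c * ballVol n j)) := by
        rw [lintegral_tsum fun j =>
          (measurable_const.indicator (measurableSet_hball _ _)).aemeasurable]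
        refine tsum_congr fun j => ?_
        rw [lintegral_indicator (measurableSet_hball _ _), setLIntegral_const, hvol_hball,
          ← ENNReal.ofReal_mul (Real.exp_pos _).le, mul_comm]
    _ < ∞ := by
        rw [← ENNReal.ofReal_tsum_of_nonneg hterm (summable_ballVol_mul_exp_neg hc)]
        exact ENNReal.ofReal_lt_top

-- The lens contains the ball of radius `s / 2` around the point at distance `s / 2` from `x` on
-- the geodesic from `x` to `c`.
lemma ballVol_half_le_hvol_lens {c x : HSpace n} {s : ℝ} (hs : 0 ≤ s) (hsc : s ≤ hdist c x) :
    ENNReal.ofReal (ballVol n (s / 2)) ≤ hvol n {z | hdist c z < hdist c x ∧ hdist x z < s} := by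
  obtain ⟨m, hxm, hmc⟩ := exists_between x c (s := s / 2) (by linarith)
    (by linarith [hdist_comm x c])
  rw [← hvol_hball m]
  exact measure_mono (Set.subset_inter
    (hball_subset_hball (by linarith [hdist_comm c m, hdist_comm x c]))
    (hball_subset_hball (by linarith)))

/-! ### Null sets -/

-- In Euclidean terms this is a sphere around a point above or below `a`.
lemma hvol_norm_sub_sq_eq_zero (a : Ambient n) (c : ℝ) :
    hvol n {z | ‖z.1 - a‖ ^ 2 = c * height z} = 0 := by
  rw [hvol_eq_zero_iff]
  let a' : Ambient n := a + (c / 2) • verticalUnit n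
  refine measure_mono_null ?_ (Measure.addHaar_sphere volume a' √(‖a'‖ ^ 2 - ‖a‖ ^ 2))
  rintro _ ⟨z, hz, rfl⟩
  have hz_sq : ‖z.1 - a‖ ^ 2 = c * height z := hz
  have hinner : inner ℝ z.1 a' = inner ℝ z.1 a + c / 2 * height z := by
    simp only [a', inner_add_right, inner_smul_right, inner_verticalUnit, height]
  have hradius : ‖a'‖ ^ 2 - ‖a‖ ^ 2 = ‖z.1 - a'‖ ^ 2 := by
    rw [norm_sub_sq_real] at hz_sq ⊢
    linarith
  rw [Metric.mem_sphere, dist_eq_norm, hradius, Real.sqrt_sq (norm_nonneg _)]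

lemma hvol_height_eq_zero (c : ℝ) : hvol n {z | height z = c} = 0 := by
  let H : AffineSubspace ℝ (Ambient n) :=
    AffineSubspace.mk' (c • verticalUnit n) (ℝ ∙ verticalUnit n)ᗮ
  have mem_H : ∀ x : Ambient n, x ∈ H ↔ x (Fin.last n) = c := fun x => by
    rw [AffineSubspace.mem_mk', Submodule.mem_orthogonal_singleton_iff_inner_left,
      inner_verticalUnit]
    simp [verticalUnit_last, sub_eq_zero]
  have H_ne_top : H ≠ ⊤ := fun htop => by
    have hmem : (c + 1) • verticalUnit n ∈ H := htop ▸ AffineSubspace.mem_top ℝ _ _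
    simp [mem_H, verticalUnit_last] at hmem
  rw [hvol_eq_zero_iff]
  refine measure_mono_null ?_ (Measure.addHaar_affineSubspace volume H H_ne_top)
  rintro _ ⟨z, hz, rfl⟩
  exact (mem_H z.1).2 hz

lemma hvol_hdist_eq_zero (o : HSpace n) (r : ℝ) : hvol n {z | hdist o z = r} = 0 := by
  have ho := height_pos o
  refine measure_mono_null (fun z hz => ?_)
    (hvol_norm_sub_sq_eq_zero o.1 ((Real.cosh r - 1) * (2 * height o)))
  have hz_pos := height_pos z
  change ‖z.1 - o.1‖ ^ 2 = _
  rw [norm_sub_rev, ← show hdist o z = r from hz, cosh_hdist]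
  field_simp
  ring

/-! ### Busemann functions and horoballs -/

/-- The Busemann function of the ideal point `e`, up to an additive constant. -/
def horoLevel : IdealPoint n → HSpace n → ℝ
  | none => fun z => Real.log (height z)
  | some b => fun z => Real.log (height z) - Real.log (‖z.1 - b.1‖ ^ 2)

lemma norm_sub_ideal_pos (z : HSpace n) (b : BoundaryPlane n) : 0 < ‖z.1 - b.1‖ := by
  rw [norm_pos_iff, sub_ne_zero]
  exact fun h => (height_pos z).ne' ((congrArg (· (Fin.last n)) h).trans b.2)

lemma measurable_horoLevel (e : IdealPoint n) : Measurable (horoLevel e) := by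
  have hlog : Measurable fun z : HSpace n => Real.log (height z) :=
    Real.measurable_log.comp continuous_height.measurable
  cases e with
  | none => exact hlog
  | some b => exact hlog.sub (Real.measurable_log.comp (by fun_prop))

lemma hvol_horoLevel_eq_zero (e : IdealPoint n) (c : ℝ) : hvol n {z | horoLevel e z = c} = 0 := by
  cases e with
  | none =>
    refine measure_mono_null (fun z hz => ?_) (hvol_height_eq_zero (Real.exp c))
    have hz_log : Real.log (height z) = c := hz
    change height z = Real.exp c
    rw [← hz_log, Real.exp_log (height_pos z)]
  | some b =>
    refine measure_mono_null (fun z hz => ?_) (hvol_norm_sub_sq_eq_zero b.1 (Real.exp (-c)))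
    have hz_log : Real.log (height z) - Real.log (‖z.1 - b.1‖ ^ 2) = c := hz
    have hnorm := norm_sub_ideal_pos z b
    have hheight := height_pos z
    change ‖z.1 - b.1‖ ^ 2 = Real.exp (-c) * height z
    rw [← hz_log, neg_sub, Real.exp_sub, Real.exp_log (by positivity), Real.exp_log hheight]
    field_simp

lemma dist_mirror_pos (p q : HSpace n) : 0 < dist q.1 (mirror p) := by
  have := height_pos p
  have := height_pos q
  have hsq : 0 < dist q.1 (mirror p) ^ 2 := by
    rw [dist_mirror_sq]
    positivity
  exact dist_nonneg.lt_of_ne' (pow_ne_zero_iff two_ne_zero |>.1 hsq.ne')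

lemma hdist_eq_log (p q : HSpace n) :
    hdist p q = 2 * Real.log (dist q.1 (mirror p)) - Real.log (height p) - Real.log (height q)
      - 2 * Real.log (1 + Real.exp (-hdist p q)) := by
  have hp := height_pos p
  have hq := height_pos q
  have hcosh : Real.exp (hdist p q / 2) * (1 + Real.exp (-hdist p q)) =
      dist q.1 (mirror p) / √(height p * height q) := by
    calc Real.exp (hdist p q / 2) * (1 + Real.exp (-hdist p q))
        = 2 * Real.cosh (hdist p q / 2) := by
          rw [Real.cosh_eq, mul_one_add, ← Real.exp_add]
          ring_nf
      _ = dist q.1 (mirror p) / √(height p * height q) := by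
          rw [cosh_half_hdist, dist_mirror_comm]
          field_simp
  have hlog := congrArg Real.log hcosh
  rw [Real.log_mul (Real.exp_pos _).ne' (by positivity), Real.log_exp,
    Real.log_div (dist_mirror_pos p q).ne' (by positivity), Real.log_sqrt (by positivity),
    Real.log_mul hp.ne' hq.ne'] at hlog
  linarith

lemma tendsto_norm_sub_div_norm_sub {ι E : Type*} [NormedAddCommGroup E] {l : Filter ι}
    {u : ι → E} (hu : Tendsto (fun t => ‖u t‖) l atTop) (a b : E) :
    Tendsto (fun t => ‖u t - a‖ / ‖u t - b‖) l (𝓝 1) := by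
  have hb : Tendsto (fun t => ‖u t - b‖) l atTop :=
    tendsto_atTop_mono (fun t => norm_sub_norm_le (u t) b)
      (tendsto_atTop_add_const_right _ (-‖b‖) hu)
  rw [tendsto_iff_norm_sub_tendsto_zero]
  refine squeeze_zero' (Eventually.of_forall fun t => norm_nonneg _) ?_
    (hb.const_div_atTop ‖b - a‖)
  filter_upwards [hb.eventually_gt_atTop 0] with t ht
  rw [div_sub_one ht.ne', norm_div, norm_norm]
  gcongr
  simpa using abs_norm_sub_norm_le (u t - a) (u t - b)

lemma tendsto_log_dist_mirror_sub {e : IdealPoint n} {τ : ℝ → HSpace n}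
    (hτ : TendsToIdeal τ e) (p q : HSpace n) :
    Tendsto (fun t => 2 * Real.log (dist (τ t).1 (mirror p)) -
        2 * Real.log (dist (τ t).1 (mirror q))) atTop
      (𝓝 (horoLevel e q - horoLevel e p + Real.log (height p) - Real.log (height q))) := by
  cases e with
  | none =>
    have hratio := (tendsto_norm_sub_div_norm_sub hτ (mirror p) (mirror q)).log one_ne_zero
    rw [Real.log_one] at hratio
    have hlimit : horoLevel (none : IdealPoint n) q - horoLevel (none : IdealPoint n) p +
        Real.log (height p) - Real.log (height q) = 2 * 0 := by
      simp only [horoLevel]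
      ring
    rw [hlimit]
    refine (hratio.const_mul 2).congr fun t => ?_
    rw [← dist_eq_norm, ← dist_eq_norm, Real.log_div (dist_mirror_pos _ _).ne'
      (dist_mirror_pos _ _).ne', mul_sub]
  | some b =>
    have hdist : ∀ w : HSpace n, dist b.1 (mirror w) = ‖w.1 - b.1‖ := fun w => by
      rw [dist_eq_norm, ← sq_eq_sq₀ (norm_nonneg _) (norm_nonneg _), norm_sub_mirror_sq, b.2,
        norm_sub_rev]
      ring
    have hterm : ∀ w : HSpace n, Tendsto (fun t => 2 * Real.log (dist (τ t).1 (mirror w))) atTop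
        (𝓝 (2 * Real.log ‖w.1 - b.1‖)) := fun w => by
      rw [← hdist w]
      refine ((Tendsto.dist hτ tendsto_const_nhds).log ?_).const_mul 2
      exact hdist w ▸ (norm_sub_ideal_pos w b).ne'
    convert (hterm p).sub (hterm q) using 2
    simp only [horoLevel, Real.log_pow]
    push_cast
    ring

lemma tendsto_hdist_sub {e : IdealPoint n} {τ : ℝ → HSpace n} (hτ : TendsToIdeal τ e)
    (hescape : ∀ p, Tendsto (fun t => hdist p (τ t)) atTop atTop) (p q : HSpace n) :
    Tendsto (fun t => hdist p (τ t) - hdist q (τ t)) atTop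
      (𝓝 (horoLevel e q - horoLevel e p)) := by
  have hcorrection : ∀ p, Tendsto (fun t => Real.log (1 + Real.exp (-hdist p (τ t)))) atTop
      (𝓝 0) := fun p => by
    have hexp : Tendsto (fun t => 1 + Real.exp (-hdist p (τ t))) atTop (𝓝 (1 + 0)) :=
      tendsto_const_nhds.add
        (Real.tendsto_exp_atBot.comp (tendsto_neg_atTop_atBot.comp (hescape p)))
    simpa using hexp.log (by norm_num)
  have hlim := ((tendsto_log_dist_mirror_sub hτ p q).sub_const
    (Real.log (height p) - Real.log (height q))).sub
      (((hcorrection p).sub (hcorrection q)).const_mul 2)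
  convert hlim using 2 with t
  · linarith [hdist_eq_log p (τ t), hdist_eq_log q (τ t)]
  · ring

lemma IsGeodesicRay.hdist_zero {τ : ℝ → HSpace n} (hτ : IsGeodesicRay τ) {t : ℝ} (ht : 0 ≤ t) :
    hdist (τ 0) (τ t) = t := by
  rw [hτ 0 t le_rfl ht, zero_sub, abs_neg, abs_of_nonneg ht]

lemma IsGeodesicRay.tendsto_hdist {τ : ℝ → HSpace n} (hτ : IsGeodesicRay τ) (p : HSpace n) :
    Tendsto (fun t => hdist p (τ t)) atTop atTop := by
  refine tendsto_atTop_mono' _ ?_ (tendsto_atTop_add_const_right _ (-hdist (τ 0) p) tendsto_id)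
  filter_upwards [eventually_ge_atTop 0] with t ht
  have htriangle := hdist_triangle (τ 0) p (τ t)
  rw [hτ.hdist_zero ht] at htriangle
  simp only [id]
  linarith

lemma IsGeodesicRay.tendsto_busemann {τ : ℝ → HSpace n} (hτ : IsGeodesicRay τ) (p : HSpace n) :
    Tendsto (fun s => s - hdist p (τ s)) atTop (𝓝 (busemann τ p)) := by
  refine tendsto_nhds_limUnder ?_
  let g : ℝ → ℝ := fun s => max s 0 - hdist p (τ (max s 0))
  have hmono : Monotone g := fun s t hst => by
    have hmax : max s 0 ≤ max t 0 := max_le_max_right 0 hst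
    have htriangle := hdist_triangle p (τ (max s 0)) (τ (max t 0))
    rw [hτ _ _ (le_max_right _ _) (le_max_right _ _), abs_sub_comm,
      abs_of_nonneg (sub_nonneg.2 hmax)] at htriangle
    simp only [g]
    linarith
  have hbdd : BddAbove (Set.range g) := by
    refine ⟨hdist (τ 0) p, ?_⟩
    rintro _ ⟨s, rfl⟩
    have htriangle := hdist_triangle (τ 0) p (τ (max s 0))
    rw [hτ.hdist_zero (le_max_right _ _)] at htriangle
    exact sub_le_iff_le_add.2 htriangle
  refine ⟨_, (tendsto_atTop_ciSup hmono hbdd).congr' ?_⟩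
  filter_upwards [eventually_ge_atTop 0] with s hs
  simp only [g, max_eq_left hs]

lemma busemann_sub {e : IdealPoint n} {τ : ℝ → HSpace n} (hτ : IsGeodesicRay τ)
    (hτe : TendsToIdeal τ e) (p q : HSpace n) :
    busemann τ q - busemann τ p = horoLevel e q - horoLevel e p :=
  tendsto_nhds_unique ((hτ.tendsto_busemann q).sub (hτ.tendsto_busemann p))
    ((tendsto_hdist_sub hτe hτ.tendsto_hdist p q).congr fun t => by ring)

/-- A vertical geodesic ray tending to `e`. -/
def idealRay : IdealPoint n → ℝ → HSpace n
  | none => fun t => verticalLine ⟨0, rfl⟩ t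
  | some b => fun t => verticalLine b (-t)

lemma isGeodesicRay_idealRay (e : IdealPoint n) : IsGeodesicRay (idealRay e) := by
  intro s t _ _
  cases e with
  | none => exact hdist_verticalLine _ _ _
  | some b => exact (hdist_verticalLine _ _ _).trans (by rw [neg_sub_neg, abs_sub_comm])

lemma tendsToIdeal_idealRay (e : IdealPoint n) : TendsToIdeal (idealRay e) e := by
  cases e with
  | none =>
    refine Real.tendsto_exp_atTop.congr fun t => ?_
    change Real.exp t = ‖(0 : Ambient n) + Real.exp t • verticalUnit n‖
    rw [zero_add, norm_smul, norm_verticalUnit, mul_one, Real.norm_eq_abs, Real.abs_exp]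
  | some b =>
    change Tendsto (fun t => b.1 + Real.exp (-t) • verticalUnit n) atTop (𝓝 b.1)
    have hexp : Tendsto (fun t : ℝ => Real.exp (-t)) atTop (𝓝 0) :=
      Real.tendsto_exp_atBot.comp tendsto_neg_atTop_atBot
    simpa using tendsto_const_nhds.add (hexp.smul_const (verticalUnit n))

lemma horoball_eq (e : IdealPoint n) (y : HSpace n) :
    horoball e y = {z | horoLevel e y ≤ horoLevel e z} := by
  ext z
  constructor
  · intro hz
    have hbusemann := hz _ (isGeodesicRay_idealRay e) (tendsToIdeal_idealRay e)
    rwa [← sub_nonneg, busemann_sub (isGeodesicRay_idealRay e) (tendsToIdeal_idealRay e),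
      sub_nonneg] at hbusemann
  · intro hz τ hτ hτe
    rwa [← sub_nonneg, busemann_sub hτ hτe, sub_nonneg]

lemma measurableSet_horoball (e : IdealPoint n) (y : HSpace n) :
    MeasurableSet (horoball e y) := by
  rw [horoball_eq]
  exact measurableSet_le measurable_const (measurable_horoLevel e)

lemma eventually_hdist_idealRay_lt_iff (e : IdealPoint n) {p q : HSpace n}
    (h : horoLevel e p ≠ horoLevel e q) :
    ∀ᶠ t in atTop, (-hdist (idealRay e t) p < -hdist (idealRay e t) q ↔
      horoLevel e p < horoLevel e q) := by
  have hlim := tendsto_hdist_sub (tendsToIdeal_idealRay e)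
    (isGeodesicRay_idealRay e).tendsto_hdist p q
  rcases h.lt_or_gt with h | h
  · filter_upwards [hlim.eventually_const_lt (sub_pos.2 h)] with t ht
    rw [hdist_comm _ p, hdist_comm _ q]
    exact iff_of_true (by linarith) h
  · filter_upwards [hlim.eventually_lt_const (sub_neg.2 h)] with t ht
    rw [hdist_comm _ p, hdist_comm _ q]
    exact iff_of_false (by linarith) h.not_gt

/-! ### Configurations -/

/-- The space of subsets of `ℍ^d`, the state space of a point process; its `σ`-field is generated by
the void events. -/
def Config (n : ℕ) : Type := Set (HSpace n)

/-- The void event of `B`: no point of the configuration lies in `B`. -/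
def voidEvent (B : Set (HSpace n)) : Set (Config n) := {ξ : Set (HSpace n) | Disjoint ξ B}

/-- The `π`-system of void events of measurable sets. -/
def voidEvents (n : ℕ) : Set (Set (Config n)) := {S | ∃ B, MeasurableSet B ∧ S = voidEvent B}

instance : MeasurableSpace (Config n) := MeasurableSpace.generateFrom (voidEvents n)

lemma voidEvent_inter (B C : Set (HSpace n)) : voidEvent B ∩ voidEvent C = voidEvent (B ∪ C) := by
  ext ξ
  exact Set.disjoint_union_right.symm

lemma voidEvent_empty : voidEvent (∅ : Set (HSpace n)) = Set.univ :=
  Set.eq_univ_of_forall fun _ => Set.disjoint_empty _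

lemma measurableSet_voidEvent {B : Set (HSpace n)} (hB : MeasurableSet B) :
    MeasurableSet (voidEvent B) :=
  MeasurableSpace.measurableSet_generateFrom ⟨B, hB, rfl⟩

lemma isPiSystem_voidEvents : IsPiSystem (voidEvents n) := by
  rintro _ ⟨B, hB, rfl⟩ _ ⟨C, hC, rfl⟩ -
  exact ⟨B ∪ C, hB.union hC, voidEvent_inter B C⟩

lemma univ_mem_voidEvents : Set.univ ∈ voidEvents n :=
  ⟨∅, MeasurableSet.empty, voidEvent_empty.symm⟩

lemma isCountablySpanning_of_univ_mem {β : Type*} {C : Set (Set β)} (hC : Set.univ ∈ C) :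
    IsCountablySpanning C :=
  ⟨fun _ => Set.univ, fun _ => hC, Set.iUnion_const _⟩

/-- The `π`-system of rectangles `A ×ˢ voidEvent B`, which generates the product `σ`-field. -/
def voidRects (n : ℕ) : Set (Set (HSpace n × Config n)) :=
  Set.image2 (· ×ˢ ·) {A | MeasurableSet A} (voidEvents n)

/-- The `π`-system of rectangles `A₁ ×ˢ A₂ ×ˢ voidEvent B`. -/
def pairVoidRects (n : ℕ) : Set (Set (HSpace n × HSpace n × Config n)) :=
  Set.image2 (· ×ˢ ·) {A | MeasurableSet A} (voidRects n)

lemma univ_mem_measurableSets {β : Type*} [MeasurableSpace β] :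
    Set.univ ∈ {A : Set β | MeasurableSet A} :=
  MeasurableSet.univ

lemma univ_mem_voidRects : Set.univ ∈ voidRects n :=
  ⟨Set.univ, univ_mem_measurableSets, _, univ_mem_voidEvents, Set.univ_prod_univ⟩

lemma univ_mem_pairVoidRects : Set.univ ∈ pairVoidRects n :=
  ⟨Set.univ, univ_mem_measurableSets, _, univ_mem_voidRects, Set.univ_prod_univ⟩

lemma isPiSystem_voidRects : IsPiSystem (voidRects n) :=
  MeasurableSpace.isPiSystem_measurableSet.prod isPiSystem_voidEvents

lemma isPiSystem_pairVoidRects : IsPiSystem (pairVoidRects n) :=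
  MeasurableSpace.isPiSystem_measurableSet.prod isPiSystem_voidRects

lemma generateFrom_voidRects :
    (inferInstance : MeasurableSpace (HSpace n × Config n)) =
      MeasurableSpace.generateFrom (voidRects n) := by
  rw [voidRects, ← generateFrom_prod_eq (isCountablySpanning_of_univ_mem univ_mem_measurableSets)
    (isCountablySpanning_of_univ_mem univ_mem_voidEvents),
    MeasurableSpace.generateFrom_measurableSet]

lemma generateFrom_pairVoidRects :
    (inferInstance : MeasurableSpace (HSpace n × HSpace n × Config n)) =
      MeasurableSpace.generateFrom (pairVoidRects n) := by
  rw [pairVoidRects, ← generateFrom_prod_eq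
    (isCountablySpanning_of_univ_mem univ_mem_measurableSets)
    (isCountablySpanning_of_univ_mem univ_mem_voidRects),
    MeasurableSpace.generateFrom_measurableSet, ← generateFrom_voidRects]

/-- The configuration `ξ ∪ {x}`. -/
def addPoint (x : HSpace n) (ξ : Config n) : Config n := (insert x ξ : Set (HSpace n))

lemma addPoint_mem_voidEvent {x : HSpace n} {ξ : Config n} {B : Set (HSpace n)} :
    addPoint x ξ ∈ voidEvent B ↔ x ∉ B ∧ ξ ∈ voidEvent B :=
  Set.disjoint_insert_left

lemma measurable_config {β : Type*} [MeasurableSpace β] {f : β → Config n}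
    (hf : ∀ B, MeasurableSet B → MeasurableSet (f ⁻¹' voidEvent B)) : Measurable f := by
  refine measurable_generateFrom ?_
  rintro _ ⟨B, hB, rfl⟩
  exact hf B hB

lemma measurable_addPoint : Measurable fun p : HSpace n × Config n => addPoint p.1 p.2 := by
  refine measurable_config fun B hB => ?_
  have hpreimage : (fun p : HSpace n × Config n => addPoint p.1 p.2) ⁻¹' voidEvent B =
      Bᶜ ×ˢ voidEvent B := by
    ext p
    exact addPoint_mem_voidEvent
  rw [hpreimage]
  exact hB.compl.prod (measurableSet_voidEvent hB)

/-! ### Moments of Poisson counts -/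

lemma poissonLaw_top : poissonLaw ∞ = Measure.dirac ⊤ := if_pos rfl

lemma lintegral_poissonLaw {m : ℝ≥0∞} (hm : m ≠ ∞) (g : ℕ∞ → ℝ≥0∞) :
    ∫⁻ k, g k ∂poissonLaw m = ∑' k : ℕ,
      ENNReal.ofReal (Real.exp (-m.toNNReal) * m.toNNReal ^ k / (k.factorial : ℝ)) * g k := by
  rw [poissonLaw, if_neg hm, lintegral_map (measurable_of_countable _) (measurable_of_countable _),
    poissonMeasure, lintegral_sum_measure]
  simp [lintegral_smul_measure]

instance (m : ℝ≥0∞) : IsProbabilityMeasure (poissonLaw m) := by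
  unfold poissonLaw
  split_ifs
  · infer_instance
  · exact Measure.isProbabilityMeasure_map (measurable_of_countable _).aemeasurable

lemma ofReal_poisson_succ_mul (r : NNReal) (k : ℕ) :
    ENNReal.ofReal (Real.exp (-r) * r ^ (k + 1) / ((k + 1).factorial : ℝ)) * (k + 1 : ℕ) =
      r * ENNReal.ofReal (Real.exp (-r) * r ^ k / (k.factorial : ℝ)) := by
  rw [← ENNReal.ofReal_natCast, ← ENNReal.ofReal_mul (by positivity),
    ← ENNReal.ofReal_coe_nnreal, ← ENNReal.ofReal_mul (by positivity), Nat.factorial_succ]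
  congr 1
  push_cast
  field_simp
  rw [pow_succ']

lemma lintegral_poissonLaw_self_mul (m : ℝ≥0∞) (g : ℕ∞ → ℝ≥0∞) :
    ∫⁻ k, (k : ℝ≥0∞) * g k ∂poissonLaw m = m * ∫⁻ k, g (k + 1) ∂poissonLaw m := by
  rcases eq_or_ne m ∞ with rfl | hm
  · simp [poissonLaw_top]
  lift m to NNReal using hm
  rw [lintegral_poissonLaw ENNReal.coe_ne_top, lintegral_poissonLaw ENNReal.coe_ne_top,
    tsum_eq_zero_add' ENNReal.summable, ← ENNReal.tsum_mul_left]
  simp only [Nat.cast_zero, ENat.toENNReal_zero, zero_mul, mul_zero, zero_add,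
    ENNReal.toNNReal_coe]
  refine tsum_congr fun k => ?_
  rw [← mul_assoc, ENat.toENNReal_coe, ofReal_poisson_succ_mul, mul_assoc, Nat.cast_succ]

lemma lintegral_poissonLaw_self (m : ℝ≥0∞) : ∫⁻ k, (k : ℝ≥0∞) ∂poissonLaw m = m := by
  simpa using lintegral_poissonLaw_self_mul m 1

lemma lintegral_poissonLaw_self_mul_self (m : ℝ≥0∞) :
    ∫⁻ k, (k : ℝ≥0∞) * k ∂poissonLaw m = m + m * m := by
  rw [lintegral_poissonLaw_self_mul]
  simp only [ENat.toENNReal_add, ENat.toENNReal_one]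
  rw [lintegral_add_right _ measurable_const, lintegral_poissonLaw_self, lintegral_const,
    measure_univ]
  ring

lemma poissonLaw_zero {m : ℝ≥0∞} (hm : m ≠ ∞) :
    poissonLaw m {0} = ENNReal.ofReal (Real.exp (-m.toReal)) := by
  rw [poissonLaw, if_neg hm, Measure.map_apply (measurable_of_countable _) (by measurability)]
  have hpreimage : (Nat.cast : ℕ → ℕ∞) ⁻¹' {0} = {0} := by
    ext k
    simp
  rw [hpreimage, poissonMeasure_singleton]
  simp [ENNReal.coe_toNNReal_eq_toReal]

lemma poissonLaw_top_zero : poissonLaw ∞ {0} = 0 := by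
  simp [poissonLaw_top]

/-! ### The Mecke formulas -/

section Mecke

variable {Ω : Type*} [MeasurableSpace Ω] {P : Measure Ω}
  {η : Ω → Set (HSpace n)} {μ : Measure (HSpace n)} {A A' B : Set (HSpace n)}

/-- A random set, as a map into the measurable space of configurations. -/
def toConfig (η : Ω → Set (HSpace n)) (ω : Ω) : Config n := η ω

omit [MeasurableSpace Ω] in
lemma indicator_void_eq (ω : Ω) :
    {ω | Disjoint (η ω) B}.indicator (1 : Ω → ℝ≥0∞) ω =
      ({0} : Set ℕ∞).indicator 1 (η ω ∩ B).encard := by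
  simp [Set.indicator_apply, Set.disjoint_iff_inter_eq_empty]

lemma encard_inter_sdiff_of_disjoint {S : Set (HSpace n)} (hSB : Disjoint S B) :
    (S ∩ (A \ B)).encard = (S ∩ A).encard := by
  rw [← Set.inter_sdiff_assoc, (hSB.mono_left Set.inter_subset_left).sdiff_eq_left]

lemma encard_inter_inter_add_encard_inter_sdiff (S A A' : Set (HSpace n)) :
    ((S ∩ (A ∩ A')).encard : ℝ≥0∞) + (S ∩ (A \ A')).encard = (S ∩ A).encard := by
  rw [← ENat.toENNReal_add, ← Set.inter_assoc, ← Set.inter_sdiff_assoc, add_comm,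
    Set.encard_sdiff_add_encard_inter]

namespace IsPoissonProcess

lemma measurableSet_void (hη : IsPoissonProcess P η μ) (hB : MeasurableSet B) :
    MeasurableSet {ω | Disjoint (η ω) B} := by
  simp_rw [Set.disjoint_iff_inter_eq_empty, ← Set.encard_eq_zero]
  exact hη.measurable_count B hB (measurableSet_singleton 0)

lemma measurable_toConfig (hη : IsPoissonProcess P η μ) : Measurable (toConfig η) :=
  measurable_config fun _ hB => hη.measurableSet_void hB

lemma measure_void (hη : IsPoissonProcess P η μ) (hB : MeasurableSet B) :
    P {ω | Disjoint (η ω) B} = poissonLaw (μ B) {0} := by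
  rw [← hη.map_count B hB,
    Measure.map_apply (hη.measurable_count B hB) (measurableSet_singleton 0)]
  simp [Set.preimage, Set.disjoint_iff_inter_eq_empty]

lemma measurable_encard (hη : IsPoissonProcess P η μ) (hA : MeasurableSet A) :
    Measurable fun ω => ((η ω ∩ A).encard : ℝ≥0∞) :=
  (measurable_of_countable fun k : ℕ∞ => (k : ℝ≥0∞)).comp (hη.measurable_count A hA)

lemma lintegral_encard (hη : IsPoissonProcess P η μ) (hA : MeasurableSet A) :
    ∫⁻ ω, ((η ω ∩ A).encard : ℝ≥0∞) ∂P = μ A := by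
  rw [← lintegral_poissonLaw_self (μ A), ← hη.map_count A hA,
    lintegral_map (measurable_of_countable _) (hη.measurable_count A hA)]

lemma lintegral_encard_mul_self (hη : IsPoissonProcess P η μ) (hA : MeasurableSet A) :
    ∫⁻ ω, ((η ω ∩ A).encard : ℝ≥0∞) * (η ω ∩ A).encard ∂P = μ A + μ A * μ A := by
  rw [← lintegral_poissonLaw_self_mul_self (μ A), ← hη.map_count A hA,
    lintegral_map (measurable_of_countable _) (hη.measurable_count A hA)]

lemma lintegral_prod_count (hη : IsPoissonProcess P η μ) {k : ℕ} (C : Fin k → Set (HSpace n))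
    (hC : ∀ i, MeasurableSet (C i)) (hdisj : Pairwise fun i j => Disjoint (C i) (C j))
    (f : Fin k → ℕ∞ → ℝ≥0∞) :
    ∫⁻ ω, ∏ i, f i (η ω ∩ C i).encard ∂P = ∏ i, ∫⁻ ω, f i (η ω ∩ C i).encard ∂P :=
  lintegral_prod_eq_prod_lintegral_of_indepFun Finset.univ _
    ((hη.indep_count k C hC hdisj).comp f fun _ => measurable_of_countable _)
    fun i => (measurable_of_countable (f i)).comp (hη.measurable_count _ (hC i))

lemma lintegral_mul_mul_void (hη : IsPoissonProcess P η μ) (hA : MeasurableSet A)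
    (hA' : MeasurableSet A') (hB : MeasurableSet B) (hdisj : Disjoint A A')
    (f f' : ℕ∞ → ℝ≥0∞) :
    ∫⁻ ω, f (η ω ∩ A).encard * f' (η ω ∩ A').encard *
        {ω | Disjoint (η ω) B}.indicator 1 ω ∂P =
      (∫⁻ ω, f (η ω ∩ (A \ B)).encard ∂P) * (∫⁻ ω, f' (η ω ∩ (A' \ B)).encard ∂P) *
        P {ω | Disjoint (η ω) B} := by
  have hdisj' : Disjoint (A \ B) (A' \ B) := hdisj.mono Set.sdiff_subset Set.sdiff_subset
  have hindep := hη.lintegral_prod_count ![A \ B, A' \ B, B]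
    (by intro i; fin_cases i; exacts [hA.diff hB, hA'.diff hB, hB])
    (by
      intro i j hij
      fin_cases i <;> fin_cases j <;> first
        | exact absurd rfl hij
        | exact Set.disjoint_sdiff_left
        | exact Set.disjoint_sdiff_right
        | exact hdisj'
        | exact hdisj'.symm)
    ![f, f', ({0} : Set ℕ∞).indicator 1]
  simp only [Fin.prod_univ_three, Matrix.cons_val_zero, Matrix.cons_val_one, Matrix.cons_val,
    ← indicator_void_eq, lintegral_indicator_one (hη.measurableSet_void hB)] at hindep
  rw [← hindep]
  refine lintegral_congr fun ω => ?_
  by_cases hω : Disjoint (η ω) B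
  · rw [encard_inter_sdiff_of_disjoint hω, encard_inter_sdiff_of_disjoint hω]
  · simp [hω]

variable [IsProbabilityMeasure P]

lemma lintegral_mul_void (hη : IsPoissonProcess P η μ) (hA : MeasurableSet A)
    (hB : MeasurableSet B) (f : ℕ∞ → ℝ≥0∞) :
    ∫⁻ ω, f (η ω ∩ A).encard * {ω | Disjoint (η ω) B}.indicator 1 ω ∂P =
      (∫⁻ ω, f (η ω ∩ (A \ B)).encard ∂P) * P {ω | Disjoint (η ω) B} := by
  simpa using hη.lintegral_mul_mul_void hA MeasurableSet.empty hB (Set.disjoint_empty A) f 1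

lemma lintegral_encard_mul_void (hη : IsPoissonProcess P η μ) (hA : MeasurableSet A)
    (hB : MeasurableSet B) :
    ∫⁻ ω, ((η ω ∩ A).encard : ℝ≥0∞) * {ω | Disjoint (η ω) B}.indicator 1 ω ∂P =
      μ (A \ B) * P {ω | Disjoint (η ω) B} := by
  rw [hη.lintegral_mul_void hA hB (fun k => k), hη.lintegral_encard (hA.diff hB)]

lemma lintegral_encard_mul_encard_mul_void (hη : IsPoissonProcess P η μ) (hA : MeasurableSet A)
    (hA' : MeasurableSet A') (hB : MeasurableSet B) :
    ∫⁻ ω, ((η ω ∩ A).encard : ℝ≥0∞) * (η ω ∩ A').encard *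
        {ω | Disjoint (η ω) B}.indicator 1 ω ∂P =
      (μ (A \ B) * μ (A' \ B) + μ ((A ∩ A') \ B)) * P {ω | Disjoint (η ω) B} := by
  have hI := hA.inter hA'
  have hD := hA.diff hA'
  have hD' := hA'.diff hA
  have hID : Disjoint (A ∩ A') (A \ A') := disjoint_inf_sdiff
  have hID' : Disjoint (A ∩ A') (A' \ A) := Set.disjoint_sdiff_right.mono_left Set.inter_subset_left
  have hDD' : Disjoint (A \ A') (A' \ A) := disjoint_sdiff_sdiff
  have hμ : μ (A \ B) = μ ((A ∩ A') \ B) + μ ((A \ A') \ B) := by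
    rw [Set.inter_sdiff_right_comm, sdiff_right_comm, measure_inter_add_sdiff _ hA']
  have hμ' : μ (A' \ B) = μ ((A ∩ A') \ B) + μ ((A' \ A) \ B) := by
    rw [Set.inter_comm A, Set.inter_sdiff_right_comm, sdiff_right_comm,
      measure_inter_add_sdiff _ hA]
  have hmeas := fun {C : Set (HSpace n)} (hC : MeasurableSet C) => hη.measurable_encard hC
  have hvoid : Measurable ({ω | Disjoint (η ω) B}.indicator (1 : Ω → ℝ≥0∞)) :=
    measurable_one.indicator (hη.measurableSet_void hB)
  simp_rw [← encard_inter_inter_add_encard_inter_sdiff _ A A',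
    ← encard_inter_inter_add_encard_inter_sdiff _ A' A, Set.inter_comm A' A, add_mul, mul_add,
    add_mul]
  rw [lintegral_add_left (by measurability), lintegral_add_left (by measurability),
    lintegral_add_left (by measurability),
    hη.lintegral_mul_void hI hB fun k => (k : ℝ≥0∞) * k,
    hη.lintegral_mul_mul_void hI hD' hB hID' (fun k => k) fun k => k,
    hη.lintegral_mul_mul_void hD hI hB hID.symm (fun k => k) fun k => k,
    hη.lintegral_mul_mul_void hD hD' hB hDD' (fun k => k) fun k => k,
    hη.lintegral_encard_mul_self (hI.diff hB), hη.lintegral_encard (hI.diff hB),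
    hη.lintegral_encard (hD.diff hB), hη.lintegral_encard (hD'.diff hB), hμ, hμ']
  ring

end IsPoissonProcess

variable {o : HSpace n} {R : ℝ}

/-- The points of the process in `B(o, R)`. -/
def IsPoissonProcess.pointsIn (hη : IsPoissonProcess P η μ) (o : HSpace n) (R : ℝ) (ω : Ω) :
    Finset (HSpace n) :=
  (hη.locallyFinite ω o R).toFinset

/-- The sum of the Dirac masses at `(x, η)` over the points `x` of `η` in `B(o, R)`. -/
def IsPoissonProcess.empiricalMeasure (hη : IsPoissonProcess P η μ) (o : HSpace n) (R : ℝ)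
    (ω : Ω) : Measure (HSpace n × Config n) :=
  ∑ x ∈ hη.pointsIn o R ω, Measure.dirac (x, toConfig η ω)

/-- The sum of the Dirac masses at `(x, y, η)` over the pairs of points of `η` in `B(o, R)`,
including the pairs on the diagonal. -/
def IsPoissonProcess.pairEmpiricalMeasure (hη : IsPoissonProcess P η μ) (o : HSpace n) (R : ℝ)
    (ω : Ω) : Measure (HSpace n × HSpace n × Config n) :=
  ∑ x ∈ hη.pointsIn o R ω, ∑ y ∈ hη.pointsIn o R ω, Measure.dirac (x, y, toConfig η ω)

/-- The map `(x, ω) ↦ (x, η ∪ {x})`. -/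
def withPoint (η : Ω → Set (HSpace n)) (p : HSpace n × Ω) : HSpace n × Config n :=
  (p.1, addPoint p.1 (toConfig η p.2))

/-- The map `(x, y, ω) ↦ (x, y, η ∪ {x, y})`. -/
def withPair (η : Ω → Set (HSpace n)) (p : HSpace n × HSpace n × Ω) :
    HSpace n × HSpace n × Config n :=
  (p.1, p.2.1, addPoint p.1 (addPoint p.2.1 (toConfig η p.2.2)))

omit [MeasurableSpace Ω] in
lemma withPoint_preimage_prod_voidEvent :
    withPoint η ⁻¹' (A ×ˢ voidEvent B) = (A \ B) ×ˢ {ω | Disjoint (η ω) B} := by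
  ext p
  simp only [Set.mem_preimage, withPoint, Set.mem_prod, addPoint_mem_voidEvent, ← and_assoc]
  rfl

omit [MeasurableSpace Ω] in
lemma withPair_preimage_prod_voidEvent :
    withPair η ⁻¹' (A ×ˢ A' ×ˢ voidEvent B) =
      (A \ B) ×ˢ (A' \ B) ×ˢ {ω | Disjoint (η ω) B} := by
  ext p
  have hvoid : toConfig η p.2.2 ∈ voidEvent B ↔ p.2.2 ∈ {ω | Disjoint (η ω) B} := Iff.rfl
  simp only [Set.mem_preimage, withPair, Set.mem_prod, addPoint_mem_voidEvent, hvoid,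
    Set.mem_sdiff]
  tauto

omit [MeasurableSpace Ω] in
lemma withPoint_diag_preimage_prod_voidEvent :
    (fun p => (p.1, withPoint η p)) ⁻¹' (A ×ˢ A' ×ˢ voidEvent B) =
      ((A ∩ A') \ B) ×ˢ {ω | Disjoint (η ω) B} := by
  rw [← withPoint_preimage_prod_voidEvent]
  ext p
  exact and_assoc.symm

lemma restrict_sdiff_apply (hK : MeasurableSet A') :
    μ.restrict A' (A \ B) = μ ((A' ∩ A) \ B) := by
  rw [Measure.restrict_apply' hK, Set.inter_comm A', Set.inter_sdiff_right_comm]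

namespace IsPoissonProcess

instance (hη : IsPoissonProcess P η μ) (ω : Ω) : IsFiniteMeasure (hη.empiricalMeasure o R ω) := by
  unfold empiricalMeasure
  infer_instance

instance (hη : IsPoissonProcess P η μ) (ω : Ω) :
    IsFiniteMeasure (hη.pairEmpiricalMeasure o R ω) := by
  unfold pairEmpiricalMeasure
  infer_instance

lemma sum_pointsIn_indicator (hη : IsPoissonProcess P η μ) (A : Set (HSpace n)) (ω : Ω) :
    ∑ x ∈ hη.pointsIn o R ω, A.indicator (1 : HSpace n → ℝ≥0∞) x =
      ((η ω ∩ (hball o R ∩ A)).encard : ℝ≥0∞) := by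
  classical
  have hcoe : η ω ∩ (hball o R ∩ A) = ((hη.pointsIn o R ω).filter (· ∈ A) : Set (HSpace n)) := by
    rw [Finset.coe_filter, ← Set.inter_assoc]
    simp only [pointsIn, Set.Finite.mem_toFinset]
    rfl
  rw [hcoe, Set.encard_coe_eq_coe_finsetCard, ENat.toENNReal_coe, Finset.card_filter,
    Nat.cast_sum]
  simp [Set.indicator_apply]

lemma empiricalMeasure_prod_voidEvent (hη : IsPoissonProcess P η μ) (hA : MeasurableSet A)
    (hB : MeasurableSet B) (ω : Ω) :
    hη.empiricalMeasure o R ω (A ×ˢ voidEvent B) =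
      ((η ω ∩ (hball o R ∩ A)).encard : ℝ≥0∞) * {ω | Disjoint (η ω) B}.indicator 1 ω := by
  rw [empiricalMeasure, Measure.finsetSum_apply, ← hη.sum_pointsIn_indicator, Finset.sum_mul]
  refine Finset.sum_congr rfl fun x _ => ?_
  rw [Measure.dirac_apply' _ (hA.prod (measurableSet_voidEvent hB)), ← Set.indicator_prod_one]
  rfl

lemma pairEmpiricalMeasure_prod_voidEvent (hη : IsPoissonProcess P η μ) (hA : MeasurableSet A)
    (hA' : MeasurableSet A') (hB : MeasurableSet B) (ω : Ω) :
    hη.pairEmpiricalMeasure o R ω (A ×ˢ A' ×ˢ voidEvent B) =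
      ((η ω ∩ (hball o R ∩ A)).encard : ℝ≥0∞) * (η ω ∩ (hball o R ∩ A')).encard *
        {ω | Disjoint (η ω) B}.indicator 1 ω := by
  rw [pairEmpiricalMeasure, Measure.finsetSum_apply, ← hη.sum_pointsIn_indicator,
    ← hη.sum_pointsIn_indicator, Finset.sum_mul_sum, Finset.sum_mul]
  refine Finset.sum_congr rfl fun x _ => ?_
  rw [Measure.finsetSum_apply, Finset.sum_mul]
  refine Finset.sum_congr rfl fun y _ => ?_
  rw [Measure.dirac_apply' _ (hA.prod (hA'.prod (measurableSet_voidEvent hB))),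
    mul_assoc, ← Set.indicator_prod_one, ← Set.indicator_prod_one]
  rfl

lemma measurable_empiricalMeasure (hη : IsPoissonProcess P η μ) :
    Measurable (hη.empiricalMeasure o R) := by
  have hrect : ∀ S ∈ voidRects n, Measurable fun ω => hη.empiricalMeasure o R ω S := by
    rintro _ ⟨A, hA, _, ⟨B, hB, rfl⟩, rfl⟩
    simp_rw [hη.empiricalMeasure_prod_voidEvent hA hB]
    exact (hη.measurable_encard ((measurableSet_hball o R).inter hA)).mul
      (measurable_one.indicator (hη.measurableSet_void hB))
  exact Measurable.measure_of_isPiSystem generateFrom_voidRects isPiSystem_voidRects hrect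
    (hrect _ univ_mem_voidRects)

lemma measurable_pairEmpiricalMeasure (hη : IsPoissonProcess P η μ) :
    Measurable (hη.pairEmpiricalMeasure o R) := by
  have hball_meas := measurableSet_hball o R
  have hrect : ∀ S ∈ pairVoidRects n, Measurable fun ω => hη.pairEmpiricalMeasure o R ω S := by
    rintro _ ⟨A, hA, _, ⟨A', hA', _, ⟨B, hB, rfl⟩, rfl⟩, rfl⟩
    simp_rw [hη.pairEmpiricalMeasure_prod_voidEvent hA hA' hB]
    exact ((hη.measurable_encard (hball_meas.inter hA)).mul
      (hη.measurable_encard (hball_meas.inter hA'))).mul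
      (measurable_one.indicator (hη.measurableSet_void hB))
  exact Measurable.measure_of_isPiSystem generateFrom_pairVoidRects isPiSystem_pairVoidRects hrect
    (hrect _ univ_mem_pairVoidRects)

lemma lintegral_empiricalMeasure (hη : IsPoissonProcess P η μ) {g : HSpace n × Config n → ℝ≥0∞}
    (hg : Measurable g) (ω : Ω) :
    ∫⁻ p, g p ∂hη.empiricalMeasure o R ω = ∑ x ∈ hη.pointsIn o R ω, g (x, toConfig η ω) := by
  rw [empiricalMeasure, lintegral_finsetSum_measure]
  exact Finset.sum_congr rfl fun x _ => lintegral_dirac' _ hg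

lemma lintegral_pairEmpiricalMeasure (hη : IsPoissonProcess P η μ)
    {g : HSpace n × HSpace n × Config n → ℝ≥0∞} (hg : Measurable g) (ω : Ω) :
    ∫⁻ p, g p ∂hη.pairEmpiricalMeasure o R ω =
      ∑ x ∈ hη.pointsIn o R ω, ∑ y ∈ hη.pointsIn o R ω, g (x, y, toConfig η ω) := by
  rw [pairEmpiricalMeasure, lintegral_finsetSum_measure]
  refine Finset.sum_congr rfl fun x _ => ?_
  rw [lintegral_finsetSum_measure]
  exact Finset.sum_congr rfl fun y _ => lintegral_dirac' _ hg

lemma measurable_withPoint (hη : IsPoissonProcess P η μ) : Measurable (withPoint η) :=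
  measurable_fst.prodMk (measurable_addPoint.comp
    (measurable_fst.prodMk (hη.measurable_toConfig.comp measurable_snd)))

lemma measurable_withPair (hη : IsPoissonProcess P η μ) : Measurable (withPair η) :=
  measurable_fst.prodMk ((measurable_fst.comp measurable_snd).prodMk
    (measurable_addPoint.comp (measurable_fst.prodMk
      (measurable_snd.comp (hη.measurable_withPoint.comp measurable_snd)))))

variable [IsProbabilityMeasure P]

lemma bind_empiricalMeasure (hη : IsPoissonProcess P η μ) (hfin : μ (hball o R) ≠ ∞) :
    P.bind (hη.empiricalMeasure o R) =
      ((μ.restrict (hball o R)).prod P).map (withPoint η) := by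
  have hK := measurableSet_hball o R
  have hrect : ∀ S ∈ voidRects n, ((μ.restrict (hball o R)).prod P).map (withPoint η) S =
      P.bind (hη.empiricalMeasure o R) S := by
    rintro _ ⟨A, hA, _, ⟨B, hB, rfl⟩, rfl⟩
    have hS : MeasurableSet (A ×ˢ voidEvent B) :=
      MeasurableSet.prod hA (measurableSet_voidEvent hB)
    rw [Measure.bind_apply hS hη.measurable_empiricalMeasure.aemeasurable,
      Measure.map_apply hη.measurable_withPoint hS, withPoint_preimage_prod_voidEvent,
      Measure.prod_prod, restrict_sdiff_apply hK,
      ← hη.lintegral_encard_mul_void (hK.inter hA) hB]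
    exact lintegral_congr fun ω => (hη.empiricalMeasure_prod_voidEvent hA hB ω).symm
  have := isFiniteMeasure_restrict.2 hfin
  exact (ext_of_generate_finite _ generateFrom_voidRects isPiSystem_voidRects hrect
    (hrect _ univ_mem_voidRects)).symm

lemma bind_pairEmpiricalMeasure (hη : IsPoissonProcess P η μ) (hfin : μ (hball o R) ≠ ∞) :
    P.bind (hη.pairEmpiricalMeasure o R) =
      ((μ.restrict (hball o R)).prod ((μ.restrict (hball o R)).prod P)).map (withPair η) +
        ((μ.restrict (hball o R)).prod P).map fun p => (p.1, withPoint η p) := by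
  set ν := μ.restrict (hball o R)
  have hK := measurableSet_hball o R
  have : IsFiniteMeasure ν := isFiniteMeasure_restrict.2 hfin
  have hdiag := measurable_fst.prodMk hη.measurable_withPoint
  have hrect : ∀ S ∈ pairVoidRects n, ((ν.prod (ν.prod P)).map (withPair η) +
      (ν.prod P).map fun p => (p.1, withPoint η p)) S =
        P.bind (hη.pairEmpiricalMeasure o R) S := by
    rintro _ ⟨A, hA, _, ⟨A', hA', _, ⟨B, hB, rfl⟩, rfl⟩, rfl⟩
    have hS : MeasurableSet (A ×ˢ A' ×ˢ voidEvent B) :=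
      MeasurableSet.prod hA (MeasurableSet.prod hA' (measurableSet_voidEvent hB))
    rw [Measure.bind_apply hS hη.measurable_pairEmpiricalMeasure.aemeasurable, Measure.add_apply,
      Measure.map_apply hη.measurable_withPair hS, Measure.map_apply hdiag hS,
      withPair_preimage_prod_voidEvent, withPoint_diag_preimage_prod_voidEvent,
      Measure.prod_prod, Measure.prod_prod, Measure.prod_prod, restrict_sdiff_apply hK,
      restrict_sdiff_apply hK, restrict_sdiff_apply hK, ← mul_assoc, ← add_mul,
      Set.inter_inter_distrib_left,
      ← hη.lintegral_encard_mul_encard_mul_void (hK.inter hA) (hK.inter hA') hB]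
    exact lintegral_congr fun ω => (hη.pairEmpiricalMeasure_prod_voidEvent hA hA' hB ω).symm
  exact (ext_of_generate_finite _ generateFrom_pairVoidRects isPiSystem_pairVoidRects hrect
    (hrect _ univ_mem_pairVoidRects)).symm

theorem mecke (hη : IsPoissonProcess P η μ) (hfin : μ (hball o R) ≠ ∞)
    {g : HSpace n × Config n → ℝ≥0∞} (hg : Measurable g) :
    ∫⁻ ω, ∑ x ∈ hη.pointsIn o R ω, g (x, toConfig η ω) ∂P =
      ∫⁻ x in hball o R, ∫⁻ ω, g (x, addPoint x (toConfig η ω)) ∂P ∂μ := by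
  simp_rw [← hη.lintegral_empiricalMeasure hg]
  rw [← Measure.lintegral_bind hη.measurable_empiricalMeasure.aemeasurable hg.aemeasurable,
    hη.bind_empiricalMeasure hfin, lintegral_map hg hη.measurable_withPoint]
  exact lintegral_prod _ (hg.comp hη.measurable_withPoint).aemeasurable

theorem mecke_pair (hη : IsPoissonProcess P η μ) (hfin : μ (hball o R) ≠ ∞)
    {g : HSpace n × HSpace n × Config n → ℝ≥0∞} (hg : Measurable g) :
    ∫⁻ ω, ∑ x ∈ hη.pointsIn o R ω, ∑ y ∈ hη.pointsIn o R ω, g (x, y, toConfig η ω) ∂P =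
      (∫⁻ x in hball o R, ∫⁻ y in hball o R,
        ∫⁻ ω, g (x, y, addPoint x (addPoint y (toConfig η ω))) ∂P ∂μ ∂μ) +
      ∫⁻ x in hball o R, ∫⁻ ω, g (x, x, addPoint x (toConfig η ω)) ∂P ∂μ := by
  have : IsFiniteMeasure (μ.restrict (hball o R)) := isFiniteMeasure_restrict.2 hfin
  have hpair := hg.comp hη.measurable_withPair
  have hdiag := measurable_fst.prodMk hη.measurable_withPoint
  simp_rw [← hη.lintegral_pairEmpiricalMeasure hg]
  rw [← Measure.lintegral_bind hη.measurable_pairEmpiricalMeasure.aemeasurable hg.aemeasurable,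
    hη.bind_pairEmpiricalMeasure hfin, lintegral_add_measure,
    lintegral_map hg hη.measurable_withPair, lintegral_map hg hdiag]
  congr 1
  · refine (lintegral_prod _ hpair.aemeasurable).trans (lintegral_congr fun x => ?_)
    exact lintegral_prod _ (hpair.comp measurable_prodMk_left).aemeasurable
  · exact lintegral_prod _ (hg.comp hdiag).aemeasurable

end IsPoissonProcess
end Mecke

/-! ### Moments as integrals of void probabilities -/

/-- The measure `β s ^ (β - 1) ds` on `(0, ∞)`, whose distribution function is `s ^ β`; moments of
order `β` are integrals of tail probabilities against it. -/
def powerMeasure (β : ℝ) : Measure ℝ :=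
  (volume.restrict (Set.Ioi 0)).withDensity fun s => ENNReal.ofReal (β * s ^ (β - 1))

section PowerMeasure

variable {α β : ℝ}

instance : SFinite (powerMeasure β) := by unfold powerMeasure; infer_instance

lemma ae_powerMeasure_pos (β : ℝ) : ∀ᵐ s ∂powerMeasure β, 0 < s :=
  (withDensity_absolutelyContinuous _ _).ae_le (ae_restrict_mem measurableSet_Ioi)

lemma ae_powerMeasure_prod_pos (β : ℝ) :
    ∀ᵐ p ∂(powerMeasure β).prod (powerMeasure β), 0 < p.1 ∧ 0 < p.2 :=
  (Measure.quasiMeasurePreserving_fst.ae (ae_powerMeasure_pos β)).and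
    (Measure.quasiMeasurePreserving_snd.ae (ae_powerMeasure_pos β))

lemma powerMeasure_Iic {a : ℝ} (hβ : 0 < β) (ha : 0 ≤ a) :
    powerMeasure β (Set.Iic a) = ENNReal.ofReal (a ^ β) := by
  have hint : IntervalIntegrable (fun s : ℝ => β * s ^ (β - 1)) volume 0 a :=
    (intervalIntegral.intervalIntegrable_rpow' (by linarith)).const_mul β
  have hnonneg : ∀ᵐ s ∂volume.restrict (Set.Ioc 0 a), 0 ≤ β * s ^ (β - 1) :=
    (ae_restrict_mem measurableSet_Ioc).mono fun s hs =>
      mul_nonneg hβ.le (Real.rpow_nonneg hs.1.le _)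
  have hval : ∫ s in (0 : ℝ)..a, β * s ^ (β - 1) = a ^ β := by
    rw [intervalIntegral.integral_const_mul, integral_rpow (Or.inl (by linarith)), sub_add_cancel,
      Real.zero_rpow hβ.ne', sub_zero]
    field_simp
  rw [powerMeasure, withDensity_apply _ measurableSet_Iic,
    Measure.restrict_restrict measurableSet_Iic, Set.Iic_inter_Ioi,
    ← ofReal_integral_eq_lintegral_ofReal
      ((intervalIntegrable_iff_integrableOn_Ioc_of_le ha).1 hint) hnonneg,
    ← intervalIntegral.integral_of_le ha, hval]

variable {Ω : Type*} [MeasurableSpace Ω] {P : Measure Ω} [SFinite P] {f g : Ω → ℝ}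

lemma lintegral_rpow_eq_lintegral_tail (hf : Measurable f) (hf0 : ∀ ω, 0 ≤ f ω) (hβ : 0 < β) :
    ∫⁻ ω, ENNReal.ofReal (f ω ^ β) ∂P = ∫⁻ s, P {ω | s ≤ f ω} ∂powerMeasure β := by
  have hS : MeasurableSet {p : Ω × ℝ | p.2 ≤ f p.1} :=
    measurableSet_le measurable_snd (hf.comp measurable_fst)
  calc ∫⁻ ω, ENNReal.ofReal (f ω ^ β) ∂P
      = ∫⁻ ω, powerMeasure β (Prod.mk ω ⁻¹' {p : Ω × ℝ | p.2 ≤ f p.1}) ∂P :=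
        lintegral_congr fun ω => (powerMeasure_Iic hβ (hf0 ω)).symm
    _ = ∫⁻ s, P {ω | s ≤ f ω} ∂powerMeasure β := by
        rw [← Measure.prod_apply hS, Measure.prod_apply_symm hS]; rfl

lemma lintegral_rpow_mul_rpow_eq_lintegral_tail (hf : Measurable f) (hf0 : ∀ ω, 0 ≤ f ω)
    (hg : Measurable g) (hg0 : ∀ ω, 0 ≤ g ω) (hβ : 0 < β) :
    ∫⁻ ω, ENNReal.ofReal (f ω ^ β) * ENNReal.ofReal (g ω ^ β) ∂P =
      ∫⁻ p, P {ω | p.1 ≤ f ω ∧ p.2 ≤ g ω} ∂(powerMeasure β).prod (powerMeasure β) := by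
  have hS : MeasurableSet {q : Ω × ℝ × ℝ | q.2.1 ≤ f q.1 ∧ q.2.2 ≤ g q.1} :=
    (measurableSet_le (measurable_fst.comp measurable_snd) (hf.comp measurable_fst)).inter
      (measurableSet_le (measurable_snd.comp measurable_snd) (hg.comp measurable_fst))
  calc ∫⁻ ω, ENNReal.ofReal (f ω ^ β) * ENNReal.ofReal (g ω ^ β) ∂P
      = ∫⁻ ω, (powerMeasure β).prod (powerMeasure β)
        (Prod.mk ω ⁻¹' {q : Ω × ℝ × ℝ | q.2.1 ≤ f q.1 ∧ q.2.2 ≤ g q.1}) ∂P := by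
        refine lintegral_congr fun ω => ?_
        rw [← powerMeasure_Iic hβ (hf0 ω), ← powerMeasure_Iic hβ (hg0 ω), ← Measure.prod_prod]
        rfl
    _ = ∫⁻ p, P {ω | p.1 ≤ f ω ∧ p.2 ≤ g ω} ∂(powerMeasure β).prod (powerMeasure β) := by
        rw [← Measure.prod_apply hS, Measure.prod_apply_symm hS]; rfl

end PowerMeasure

/-- The points at distance less than `s` from `x` at a strictly higher level of `b`. The edge
starting at `x`, in the radial tree (`b` minus the distance to the centre) as in the directed
forest (`b` a Busemann function), is at least `s` long iff this set contains no point. -/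
def upperBall (b : HSpace n → ℝ) (x : HSpace n) (s : ℝ) : Set (HSpace n) :=
  {z | b x < b z ∧ hdist x z < s}

/-- The probability that neither the deterministic set `F` nor a Poisson process of intensity `γ`
has a point in `A`. -/
def voidProb (γ : ℝ) (F A : Set (HSpace n)) : ℝ≥0∞ :=
  open Classical in
  if Disjoint F A then ENNReal.ofReal (Real.exp (-γ * (hvol n A).toReal)) else 0

/-- The moment of order `β` of the length of the edge starting at `x`, for the Poisson process
together with `F`. -/
def edgeMoment (γ β : ℝ) (b : HSpace n → ℝ) (F : Set (HSpace n)) (x : HSpace n) : ℝ≥0∞ :=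
  ∫⁻ s, voidProb γ F (upperBall b x s) ∂powerMeasure β

/-- The expected product of the `α`-th powers of the lengths of the edges starting at `x` and `y`,
for the Poisson process together with `F ∪ {x, y}`. -/
def edgeMixedMoment (γ α : ℝ) (b : HSpace n → ℝ) (F : Set (HSpace n)) (x y : HSpace n) : ℝ≥0∞ :=
  ∫⁻ p, voidProb γ (F ∪ {x, y}) (upperBall b x p.1 ∪ upperBall b y p.2)
    ∂(powerMeasure α).prod (powerMeasure α)

/-- The kernel whose integral over `y` gives the contribution of pairs of points to the
variance. -/
def edgeCov (γ α : ℝ) (b : HSpace n → ℝ) (F : Set (HSpace n)) (x y : HSpace n) : ℝ :=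
  (edgeMixedMoment γ α b F x y).toReal -
    (edgeMoment γ α b F x).toReal * (edgeMoment γ α b F y).toReal

/-- The tail bound satisfied by the length of the edge starting at `x` when every upper ball at `x`
contains a ball of half its radius. -/
def HasTailBound (γ : ℝ) (b : HSpace n → ℝ) (F : Set (HSpace n)) (x : HSpace n) : Prop :=
  ∀ s, 0 < s → voidProb γ F (upperBall b x s) ≤ ENNReal.ofReal (Real.exp (-γ * ballVol n (s / 2)))

/-- The bound on tail probabilities that is left after half of the exponent in `HasTailBound` has
been spent on the factor `covDecay`. -/
def edgeTail (n : ℕ) (γ s : ℝ) : ℝ≥0∞ := ENNReal.ofReal (Real.exp (-(γ / 4) * ballVol n (s / 2)))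

/-- The bound on moments of order `β` obtained from `edgeTail`. -/
def edgeTailMoment (n : ℕ) (γ β : ℝ) : ℝ≥0∞ := ∫⁻ s, edgeTail n γ s ∂powerMeasure β

/-- The factor by which the covariance of two edge lengths decays with the distance `d` of their
starting points. -/
def covDecay (n : ℕ) (γ d : ℝ) : ℝ := Real.exp (-(γ / 2) * ballVol n (d / 4))

section UpperBall

variable (b : HSpace n → ℝ) (x y : HSpace n) (s t : ℝ)

lemma upperBall_subset_hball : upperBall b x s ⊆ hball x s := fun _ hz => hz.2

lemma notMem_upperBall_self : x ∉ upperBall b x s := fun h => lt_irrefl _ h.1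

lemma hvol_upperBall_lt_top : hvol n (upperBall b x s) < ∞ :=
  (measure_mono (upperBall_subset_hball b x s)).trans_lt (hvol_hball_lt_top x s)

lemma hvol_upperBall_union_lt_top : hvol n (upperBall b x s ∪ upperBall b y t) < ∞ :=
  measure_union_lt_top (hvol_upperBall_lt_top b x s) (hvol_upperBall_lt_top b y t)

variable {b}

lemma measurableSet_upperBall (hb : Measurable b) : MeasurableSet (upperBall b x s) :=
  (measurableSet_lt measurable_const hb).inter (measurableSet_hball x s)

end UpperBall

lemma measurable_ballVol : Measurable (ballVol n) := ballVol_mono.measurable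

lemma measurable_edgeTail (γ : ℝ) : Measurable (edgeTail n γ) := by
  have : Measurable fun s : ℝ => ballVol n (s / 2) :=
    measurable_ballVol.comp (measurable_id.div_const 2)
  unfold edgeTail
  fun_prop

lemma covDecay_nonneg (γ d : ℝ) : 0 ≤ covDecay n γ d := (Real.exp_pos _).le

lemma covDecay_le_one {γ : ℝ} (hγ : 0 ≤ γ) (d : ℝ) : covDecay n γ d ≤ 1 := by
  refine Real.exp_le_one_iff.2 ?_
  have := ballVol_nonneg (n := n) (d / 4)
  nlinarith

lemma measurable_covDecay (γ : ℝ) : Measurable (covDecay n γ) := by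
  have : Measurable fun s : ℝ => ballVol n (s / 4) :=
    measurable_ballVol.comp (measurable_id.div_const 4)
  unfold covDecay
  fun_prop

section VoidProb

variable {γ : ℝ} {b : HSpace n → ℝ} {F F' A A' : Set (HSpace n)} {x y : HSpace n} {d s t : ℝ}

lemma voidProb_le_one (hγ : 0 < γ) (F A : Set (HSpace n)) : voidProb γ F A ≤ 1 := by
  unfold voidProb
  split_ifs
  · refine ENNReal.ofReal_le_one.2 (Real.exp_le_one_iff.2 ?_)
    have : 0 ≤ (hvol n A).toReal := ENNReal.toReal_nonneg
    nlinarith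
  · exact zero_le_one

lemma voidProb_anti (hγ : 0 < γ) (hF : F ⊆ F') (hA : A ⊆ A') (hfin : hvol n A' < ∞) :
    voidProb γ F' A' ≤ voidProb γ F A := by
  unfold voidProb
  by_cases hdisj : Disjoint F' A'
  · rw [if_pos hdisj, if_pos (hdisj.mono hF hA)]
    refine ENNReal.ofReal_le_ofReal (Real.exp_le_exp.2 ?_)
    have := ENNReal.toReal_mono hfin.ne (measure_mono hA)
    nlinarith
  · rw [if_neg hdisj]
    exact zero_le

lemma disjoint_pair_upperBall_union (hs : 0 < s) (ht : 0 < t) (hst : s + t ≤ hdist x y) :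
    Disjoint {x, y} (upperBall b x s ∪ upperBall b y t) := by
  have hy : y ∉ upperBall b x s := fun h => by linarith [h.2]
  have hx : x ∉ upperBall b y t := fun h => by linarith [h.2, hdist_comm x y]
  simp [Set.disjoint_insert_left, hx, hy, notMem_upperBall_self]

lemma toReal_hvol_upperBall_union (hb : Measurable b) (hst : s + t ≤ hdist x y) :
    (hvol n (upperBall b x s ∪ upperBall b y t)).toReal =
      (hvol n (upperBall b x s)).toReal + (hvol n (upperBall b y t)).toReal := by
  rw [measure_union ((disjoint_hball hst).mono (upperBall_subset_hball _ _ _)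
    (upperBall_subset_hball _ _ _)) (measurableSet_upperBall y t hb),
    ENNReal.toReal_add (hvol_upperBall_lt_top _ _ _).ne (hvol_upperBall_lt_top _ _ _).ne]

lemma voidProb_pair_eq (hb : Measurable b) (F : Set (HSpace n)) (hs : 0 < s) (ht : 0 < t)
    (hst : s + t ≤ hdist x y) :
    voidProb γ (F ∪ {x, y}) (upperBall b x s ∪ upperBall b y t) =
      voidProb γ F (upperBall b x s) * voidProb γ F (upperBall b y t) := by
  have hdisj : Disjoint (F ∪ {x, y}) (upperBall b x s ∪ upperBall b y t) ↔
      Disjoint F (upperBall b x s) ∧ Disjoint F (upperBall b y t) := by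
    rw [Set.disjoint_union_left, Set.disjoint_union_right,
      and_iff_left (disjoint_pair_upperBall_union hs ht hst)]
  unfold voidProb
  by_cases hFx : Disjoint F (upperBall b x s)
  · by_cases hFy : Disjoint F (upperBall b y t)
    · rw [if_pos (hdisj.2 ⟨hFx, hFy⟩), if_pos hFx, if_pos hFy, toReal_hvol_upperBall_union hb hst,
        mul_add, Real.exp_add, ENNReal.ofReal_mul (Real.exp_pos _).le]
    · rw [if_neg fun h => hFy (hdisj.1 h).2, if_neg hFy, mul_zero]
  · rw [if_neg fun h => hFx (hdisj.1 h).1, if_neg hFx, zero_mul]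

lemma le_covDecay_mul_edgeTail (hγ : 0 < γ) (hd : d < s + t) {v : ℝ≥0∞}
    (hvs : v ≤ ENNReal.ofReal (Real.exp (-γ * ballVol n (s / 2))))
    (hvt : v ≤ ENNReal.ofReal (Real.exp (-γ * ballVol n (t / 2)))) :
    v ≤ ENNReal.ofReal (covDecay n γ d) * (edgeTail n γ s * edgeTail n γ t) := by
  have hmax : v ≤ ENNReal.ofReal (Real.exp (-γ * ballVol n (max s t / 2))) := by
    rcases max_choice s t with h | h <;> rw [h] <;> assumption
  refine hmax.trans ?_
  unfold covDecay edgeTail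
  rw [← ENNReal.ofReal_mul (Real.exp_pos _).le, ← ENNReal.ofReal_mul (Real.exp_pos _).le,
    ← Real.exp_add, ← Real.exp_add]
  refine ENNReal.ofReal_le_ofReal (Real.exp_le_exp.2 ?_)
  have hs_le := le_max_left s t
  have ht_le := le_max_right s t
  have hvol_s : ballVol n (s / 2) ≤ ballVol n (max s t / 2) := ballVol_mono (by linarith)
  have hvol_t : ballVol n (t / 2) ≤ ballVol n (max s t / 2) := ballVol_mono (by linarith)
  have hvol_d : ballVol n (d / 4) ≤ ballVol n (max s t / 2) := ballVol_mono (by linarith)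
  nlinarith

lemma exp_neg_ballVol_le_exp_neg_linear (hγ : 0 < γ) (s : ℝ) :
    Real.exp (-(γ / 4) * ballVol n (s / 2)) ≤
      Real.exp (γ / 4 * (ballVol n 1 / 2)) * Real.exp (-(γ / 4 * (ballVol n 1 / 4)) * s) := by
  rw [← Real.exp_add]
  refine Real.exp_le_exp.2 ?_
  have := ballVol_linear_growth (n := n) (s / 2)
  nlinarith

lemma edgeTailMoment_lt_top {β : ℝ} (hγ : 0 < γ) (hβ : 0 < β) : edgeTailMoment n γ β < ∞ := by
  set C := Real.exp (γ / 4 * (ballVol n 1 / 2))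
  set k := γ / 4 * (ballVol n 1 / 4)
  have hk : 0 < k := by
    have := ballVol_pos (n := n) one_pos
    positivity
  have hexp : IntegrableOn (fun s : ℝ => s ^ (β - 1) * Real.exp (-k * s)) (Set.Ioi 0) := by
    simpa only [Real.rpow_one] using
      integrableOn_rpow_mul_exp_neg_mul_rpow (p := 1) (s := β - 1) (by linarith) one_pos hk
  have hint : IntegrableOn (fun s : ℝ => β * C * (s ^ (β - 1) * Real.exp (-k * s))) (Set.Ioi 0) :=
    hexp.const_mul (β * C)
  unfold edgeTailMoment powerMeasure
  rw [lintegral_withDensity_eq_lintegral_mul _ (by fun_prop) (measurable_edgeTail γ)]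
  refine lt_of_le_of_lt (setLIntegral_mono' measurableSet_Ioi fun s (hs : 0 < s) => ?_)
    hint.setLIntegral_lt_top
  simp only [Pi.mul_apply, edgeTail]
  rw [← ENNReal.ofReal_mul (by positivity)]
  refine ENNReal.ofReal_le_ofReal ?_
  calc β * s ^ (β - 1) * Real.exp (-(γ / 4) * ballVol n (s / 2))
      ≤ β * s ^ (β - 1) * (C * Real.exp (-k * s)) := by
        gcongr
        exact exp_neg_ballVol_le_exp_neg_linear hγ s
    _ = β * C * (s ^ (β - 1) * Real.exp (-k * s)) := by ring

namespace HasTailBound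

lemma le_edgeTail (h : HasTailBound γ b F x) (hγ : 0 < γ) (hs : 0 < s) :
    voidProb γ F (upperBall b x s) ≤ edgeTail n γ s := by
  refine (h s hs).trans (ENNReal.ofReal_le_ofReal (Real.exp_le_exp.2 ?_))
  have := ballVol_nonneg (n := n) (s / 2)
  nlinarith

lemma edgeMoment_le (h : HasTailBound γ b F x) (hγ : 0 < γ) (β : ℝ) :
    edgeMoment γ β b F x ≤ edgeTailMoment n γ β :=
  lintegral_mono_ae ((ae_powerMeasure_pos β).mono fun _ hs => h.le_edgeTail hγ hs)

lemma edgeMoment_lt_top {β : ℝ} (h : HasTailBound γ b F x) (hγ : 0 < γ) (hβ : 0 < β) :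
    edgeMoment γ β b F x < ∞ :=
  (h.edgeMoment_le hγ β).trans_lt (edgeTailMoment_lt_top hγ hβ)

lemma voidProb_pair_le_covDecay (hx : HasTailBound γ b F x) (hy : HasTailBound γ b F y)
    (hγ : 0 < γ) (hs : 0 < s) (ht : 0 < t) (hd : d < s + t) :
    voidProb γ (F ∪ {x, y}) (upperBall b x s ∪ upperBall b y t) ≤
      ENNReal.ofReal (covDecay n γ d) * (edgeTail n γ s * edgeTail n γ t) :=
  have hfin := hvol_upperBall_union_lt_top b x y s t
  le_covDecay_mul_edgeTail hγ hd
    ((voidProb_anti hγ Set.subset_union_left Set.subset_union_left hfin).trans (hx s hs))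
    ((voidProb_anti hγ Set.subset_union_left Set.subset_union_right hfin).trans (hy t ht))

lemma voidProb_pair_le_edgeTail (hx : HasTailBound γ b F x) (hy : HasTailBound γ b F y)
    (hγ : 0 < γ) (hs : 0 < s) (ht : 0 < t) :
    voidProb γ (F ∪ {x, y}) (upperBall b x s ∪ upperBall b y t) ≤ edgeTail n γ s * edgeTail n γ t :=
  (hx.voidProb_pair_le_covDecay hy hγ hs ht (add_pos hs ht)).trans
    (mul_le_of_le_one_left zero_le (ENNReal.ofReal_le_one.2 (covDecay_le_one hγ.le 0)))

lemma voidProb_pair_le (hx : HasTailBound γ b F x) (hy : HasTailBound γ b F y) (hγ : 0 < γ)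
    (hb : Measurable b) (hs : 0 < s) (ht : 0 < t) :
    voidProb γ (F ∪ {x, y}) (upperBall b x s ∪ upperBall b y t) ≤
      voidProb γ F (upperBall b x s) * voidProb γ F (upperBall b y t) +
        ENNReal.ofReal (covDecay n γ (hdist x y)) * (edgeTail n γ s * edgeTail n γ t) := by
  rcases le_or_gt (s + t) (hdist x y) with hfar | hnear
  · rw [voidProb_pair_eq hb F hs ht hfar]
    exact le_self_add
  · exact (hx.voidProb_pair_le_covDecay hy hγ hs ht hnear).trans le_add_self

lemma voidProb_mul_le (hx : HasTailBound γ b F x) (hy : HasTailBound γ b F y) (hγ : 0 < γ)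
    (hb : Measurable b) (hs : 0 < s) (ht : 0 < t) :
    voidProb γ F (upperBall b x s) * voidProb γ F (upperBall b y t) ≤
      voidProb γ (F ∪ {x, y}) (upperBall b x s ∪ upperBall b y t) +
        ENNReal.ofReal (covDecay n γ (hdist x y)) * (edgeTail n γ s * edgeTail n γ t) := by
  rcases le_or_gt (s + t) (hdist x y) with hfar | hnear
  · rw [voidProb_pair_eq hb F hs ht hfar]
    exact le_self_add
  · refine (le_covDecay_mul_edgeTail hγ hnear ?_ ?_).trans le_add_self
    · exact (mul_le_of_le_one_right zero_le (voidProb_le_one hγ _ _)).trans (hx s hs)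
    · exact (mul_le_of_le_one_left zero_le (voidProb_le_one hγ _ _)).trans (hy t ht)

end HasTailBound
end VoidProb

section VoidProbMeasurability

variable {T : Type*} [MeasurableSpace T] {b : HSpace n → ℝ} {F : Set (HSpace n)}

lemma measurable_voidProb (γ : ℝ) {G A : T → Set (HSpace n)}
    (hA : MeasurableSet {p : T × HSpace n | p.2 ∈ A p.1})
    (hG : MeasurableSet {t | Disjoint (G t) (A t)}) :
    Measurable fun t => voidProb γ (G t) (A t) := by
  have hvol_meas : Measurable fun t => (hvol n (A t)).toReal :=
    (measurable_measure_prodMk_left hA).ennreal_toReal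
  unfold voidProb
  exact Measurable.ite hG (by fun_prop) measurable_const

lemma measurableSet_disjoint_left (hF : F.Countable) {A : T → Set (HSpace n)}
    (hA : ∀ z, MeasurableSet {t | z ∈ A t}) : MeasurableSet {t | Disjoint F (A t)} := by
  have heq : {t | Disjoint F (A t)} = ⋂ z ∈ F, {t | z ∈ A t}ᶜ := by
    ext t
    simp [Set.disjoint_left]
  rw [heq]
  exact MeasurableSet.biInter hF fun z _ => (hA z).compl

lemma measurableSet_mem_upperBall (hb : Measurable b) {x z : T → HSpace n} {s : T → ℝ}
    (hx : Measurable x) (hz : Measurable z) (hs : Measurable s) :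
    MeasurableSet {p | z p ∈ upperBall b (x p) (s p)} :=
  (measurableSet_lt (hb.comp hx) (hb.comp hz)).inter
    (measurableSet_lt (measurable_hdist.comp (hx.prodMk hz)) hs)

lemma measurable_voidProb_upperBall (γ : ℝ) (hb : Measurable b) (hF : F.Countable) :
    Measurable fun q : HSpace n × ℝ => voidProb γ F (upperBall b q.1 q.2) :=
  measurable_voidProb γ (G := fun _ => F)
    (measurableSet_mem_upperBall hb (by fun_prop) (by fun_prop) (by fun_prop))
    (measurableSet_disjoint_left hF fun _ =>
      measurableSet_mem_upperBall hb measurable_fst measurable_const measurable_snd)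

lemma measurable_voidProb_pair (γ : ℝ) (hb : Measurable b) (hF : F.Countable) :
    Measurable fun q : (HSpace n × HSpace n) × ℝ × ℝ =>
      voidProb γ (F ∪ {q.1.1, q.1.2}) (upperBall b q.1.1 q.2.1 ∪ upperBall b q.1.2 q.2.2) := by
  have hmem : ∀ z : (HSpace n × HSpace n) × ℝ × ℝ → HSpace n, Measurable z →
      MeasurableSet {q : (HSpace n × HSpace n) × ℝ × ℝ |
        z q ∈ upperBall b q.1.1 q.2.1 ∪ upperBall b q.1.2 q.2.2} := fun z hz =>
    (measurableSet_mem_upperBall hb (by fun_prop) hz (by fun_prop)).union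
      (measurableSet_mem_upperBall hb (by fun_prop) hz (by fun_prop))
  refine measurable_voidProb γ (G := fun q : (HSpace n × HSpace n) × ℝ × ℝ => F ∪ {q.1.1, q.1.2})
    ?_ ?_
  · exact (measurableSet_mem_upperBall hb (by fun_prop) measurable_snd (by fun_prop)).union
      (measurableSet_mem_upperBall hb (by fun_prop) measurable_snd (by fun_prop))
  · simp only [Set.disjoint_union_left, Set.disjoint_insert_left, Set.disjoint_singleton_left]
    exact (measurableSet_disjoint_left hF fun z => hmem _ measurable_const).inter
      ((hmem _ (by fun_prop)).compl.inter (hmem _ (by fun_prop)).compl)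

lemma measurable_voidProb_upperBall_right (γ : ℝ) (hb : Measurable b) (hF : F.Countable)
    (x : HSpace n) : Measurable fun s => voidProb γ F (upperBall b x s) :=
  (measurable_voidProb_upperBall γ hb hF).comp measurable_prodMk_left

lemma measurable_voidProb_pair_right (γ : ℝ) (hb : Measurable b) (hF : F.Countable)
    (x y : HSpace n) :
    Measurable fun p : ℝ × ℝ =>
      voidProb γ (F ∪ {x, y}) (upperBall b x p.1 ∪ upperBall b y p.2) :=
  (measurable_voidProb_pair γ hb hF).comp (measurable_prodMk_left (x := (x, y)))

lemma measurable_edgeMoment (γ β : ℝ) (hb : Measurable b) (hF : F.Countable) :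
    Measurable (edgeMoment γ β b F) :=
  (measurable_voidProb_upperBall γ hb hF).lintegral_prod_right'

lemma measurable_edgeMixedMoment (γ α : ℝ) (hb : Measurable b) (hF : F.Countable) :
    Measurable fun q : HSpace n × HSpace n => edgeMixedMoment γ α b F q.1 q.2 :=
  (measurable_voidProb_pair γ hb hF).lintegral_prod_right'

lemma measurable_edgeCov (γ α : ℝ) (hb : Measurable b) (hF : F.Countable) :
    Measurable fun q : HSpace n × HSpace n => edgeCov γ α b F q.1 q.2 := by
  have hmoment := (measurable_edgeMoment γ α hb hF).ennreal_toReal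
  exact (measurable_edgeMixedMoment γ α hb hF).ennreal_toReal.sub
    ((hmoment.comp measurable_fst).mul (hmoment.comp measurable_snd))

end VoidProbMeasurability

/-! ### Decay of the covariance -/

section EdgeCov

variable {γ α : ℝ} {b : HSpace n → ℝ} {F : Set (HSpace n)}

lemma edgeMixedMoment_comm (γ α : ℝ) (hb : Measurable b) (hF : F.Countable) (x y : HSpace n) :
    edgeMixedMoment γ α b F x y = edgeMixedMoment γ α b F y x := by
  have hswap := lintegral_map (μ := (powerMeasure α).prod (powerMeasure α))
    (measurable_voidProb_pair_right γ hb hF x y) measurable_swap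
  rw [Measure.prod_swap] at hswap
  unfold edgeMixedMoment
  rw [hswap]
  refine lintegral_congr fun p => ?_
  rw [Set.pair_comm, Set.union_comm (upperBall b x _)]
  rfl

lemma edgeCov_comm (γ α : ℝ) (hb : Measurable b) (hF : F.Countable) (x y : HSpace n) :
    edgeCov γ α b F x y = edgeCov γ α b F y x := by
  unfold edgeCov
  rw [edgeMixedMoment_comm γ α hb hF, mul_comm]

lemma edgeMoment_mul_edgeMoment (γ α : ℝ) (hb : Measurable b) (hF : F.Countable)
    (x y : HSpace n) :
    edgeMoment γ α b F x * edgeMoment γ α b F y =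
      ∫⁻ p, voidProb γ F (upperBall b x p.1) * voidProb γ F (upperBall b y p.2)
        ∂(powerMeasure α).prod (powerMeasure α) :=
  (lintegral_prod_mul (measurable_voidProb_upperBall_right γ hb hF x).aemeasurable
    (measurable_voidProb_upperBall_right γ hb hF y).aemeasurable).symm

lemma lintegral_add_mul_edgeTail (γ α : ℝ) (c : ℝ≥0∞) (f : ℝ × ℝ → ℝ≥0∞) :
    ∫⁻ p, (f p + c * (edgeTail n γ p.1 * edgeTail n γ p.2))
        ∂(powerMeasure α).prod (powerMeasure α) =
      ∫⁻ p, f p ∂(powerMeasure α).prod (powerMeasure α) +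
        c * (edgeTailMoment n γ α * edgeTailMoment n γ α) := by
  have htail := measurable_edgeTail (n := n) γ
  have hprod : Measurable fun p : ℝ × ℝ => edgeTail n γ p.1 * edgeTail n γ p.2 :=
    (htail.comp measurable_fst).mul (htail.comp measurable_snd)
  rw [lintegral_add_right _ (hprod.const_mul _), lintegral_const_mul _ hprod,
    lintegral_prod_mul htail.aemeasurable htail.aemeasurable, edgeTailMoment]

namespace HasTailBound

variable {x y : HSpace n}

lemma edgeMixedMoment_le (hx : HasTailBound γ b F x) (hy : HasTailBound γ b F y) (hγ : 0 < γ)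
    (hb : Measurable b) (hF : F.Countable) :
    edgeMixedMoment γ α b F x y ≤ edgeMoment γ α b F x * edgeMoment γ α b F y +
      ENNReal.ofReal (covDecay n γ (hdist x y)) *
        (edgeTailMoment n γ α * edgeTailMoment n γ α) := by
  rw [edgeMoment_mul_edgeMoment γ α hb hF, ← lintegral_add_mul_edgeTail]
  exact lintegral_mono_ae ((ae_powerMeasure_prod_pos α).mono fun p hp =>
    hx.voidProb_pair_le hy hγ hb hp.1 hp.2)

lemma edgeMoment_mul_le (hx : HasTailBound γ b F x) (hy : HasTailBound γ b F y) (hγ : 0 < γ)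
    (hb : Measurable b) (hF : F.Countable) :
    edgeMoment γ α b F x * edgeMoment γ α b F y ≤ edgeMixedMoment γ α b F x y +
      ENNReal.ofReal (covDecay n γ (hdist x y)) *
        (edgeTailMoment n γ α * edgeTailMoment n γ α) := by
  rw [edgeMoment_mul_edgeMoment γ α hb hF, edgeMixedMoment, ← lintegral_add_mul_edgeTail]
  exact lintegral_mono_ae ((ae_powerMeasure_prod_pos α).mono fun p hp =>
    hx.voidProb_mul_le hy hγ hb hp.1 hp.2)

lemma edgeMixedMoment_lt_top (hx : HasTailBound γ b F x) (hy : HasTailBound γ b F y)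
    (hγ : 0 < γ) (hα : 0 < α) (hb : Measurable b) (hF : F.Countable) :
    edgeMixedMoment γ α b F x y < ∞ := by
  have htail := edgeTailMoment_lt_top (n := n) hγ hα
  exact (hx.edgeMixedMoment_le hy hγ hb hF).trans_lt (ENNReal.add_lt_top.2
    ⟨ENNReal.mul_lt_top (hx.edgeMoment_lt_top hγ hα) (hy.edgeMoment_lt_top hγ hα),
      ENNReal.mul_lt_top ENNReal.ofReal_lt_top (ENNReal.mul_lt_top htail htail)⟩)

lemma abs_edgeCov_le (hx : HasTailBound γ b F x) (hy : HasTailBound γ b F y) (hγ : 0 < γ)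
    (hα : 0 < α) (hb : Measurable b) (hF : F.Countable) :
    |edgeCov γ α b F x y| ≤ (edgeTailMoment n γ α).toReal ^ 2 * covDecay n γ (hdist x y) := by
  have htail := (edgeTailMoment_lt_top (n := n) hγ hα).ne
  have hmixed := (hx.edgeMixedMoment_lt_top hy hγ hα hb hF).ne
  have hprod := ENNReal.mul_ne_top (hx.edgeMoment_lt_top hγ hα).ne (hy.edgeMoment_lt_top hγ hα).ne
  have herr : ENNReal.ofReal (covDecay n γ (hdist x y)) *
      (edgeTailMoment n γ α * edgeTailMoment n γ α) ≠ ∞ :=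
    ENNReal.mul_ne_top ENNReal.ofReal_ne_top (ENNReal.mul_ne_top htail htail)
  have hupper := ENNReal.toReal_mono (ENNReal.add_ne_top.2 ⟨hprod, herr⟩)
    (hx.edgeMixedMoment_le hy hγ hb hF)
  have hlower := ENNReal.toReal_mono (ENNReal.add_ne_top.2 ⟨hmixed, herr⟩)
    (hx.edgeMoment_mul_le hy hγ hb hF)
  rw [ENNReal.toReal_add hprod herr] at hupper
  rw [ENNReal.toReal_add hmixed herr] at hlower
  simp only [ENNReal.toReal_mul, ENNReal.toReal_ofReal (covDecay_nonneg γ _)] at hupper hlower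
  unfold edgeCov
  rw [abs_le]
  constructor <;> nlinarith

end HasTailBound

lemma integrable_covDecay (hγ : 0 < γ) (x : HSpace n) :
    Integrable (fun y => covDecay n γ (hdist x y)) (hvol n) := by
  refine ⟨((measurable_covDecay γ).comp
    (continuous_hdist_right x).measurable).aestronglyMeasurable, ?_⟩
  rw [hasFiniteIntegral_iff_ofReal
    (Eventually.of_forall fun y => covDecay_nonneg γ (hdist x y))]
  exact lintegral_exp_neg_ballVol_lt_top x (half_pos hγ)

end EdgeCov

/-- The level function of the radial spanning tree with centre `c`. -/
def radialLevel (c : HSpace n) (z : HSpace n) : ℝ := -hdist c z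

lemma measurable_radialLevel (c : HSpace n) : Measurable (radialLevel c) :=
  (continuous_hdist_right c).measurable.neg

lemma radialLevel_lt {c x y : HSpace n} :
    radialLevel c x < radialLevel c y ↔ hdist c y < hdist c x :=
  neg_lt_neg_iff

/-- The integral of the covariance kernel at `x` over the points at higher levels. Pairs are
counted once, which is where the factor `2` in the variance comes from. -/
def edgeCovIntegral (γ α : ℝ) (b : HSpace n → ℝ) (F : Set (HSpace n)) (x : HSpace n) : ℝ :=
  ∫ y in {y | b x < b y}, edgeCov γ α b F x y ∂hvol n

namespace IsHypIsometry

variable {φ : HSpace n ≃ᵐ HSpace n}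

lemma preimage_upperBall (hφ : IsHypIsometry φ) (c x : HSpace n) (s : ℝ) :
    φ ⁻¹' upperBall (radialLevel (φ c)) (φ x) s = upperBall (radialLevel c) x s := by
  ext z
  simp [upperBall, radialLevel, hφ.hdist_map]

lemma voidProb_image (hφ : IsHypIsometry φ) (γ : ℝ) (F A : Set (HSpace n)) :
    voidProb γ (φ '' F) A = voidProb γ F (φ ⁻¹' A) := by
  unfold voidProb
  rw [hφ.hvol_preimage, Set.disjoint_image_left]

lemma edgeMoment_radialLevel (hφ : IsHypIsometry φ) (γ β : ℝ) (c x : HSpace n) :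
    edgeMoment γ β (radialLevel (φ c)) {φ c} (φ x) = edgeMoment γ β (radialLevel c) {c} x := by
  unfold edgeMoment
  simp_rw [← Set.image_singleton, hφ.voidProb_image, hφ.preimage_upperBall]

lemma edgeMixedMoment_radialLevel (hφ : IsHypIsometry φ) (γ α : ℝ) (c x y : HSpace n) :
    edgeMixedMoment γ α (radialLevel (φ c)) {φ c} (φ x) (φ y) =
      edgeMixedMoment γ α (radialLevel c) {c} x y := by
  have himage : ({φ c} ∪ {φ x, φ y} : Set (HSpace n)) = φ '' ({c} ∪ {x, y}) := by
    simp [Set.image_insert_eq]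
  unfold edgeMixedMoment
  simp_rw [himage, hφ.voidProb_image, Set.preimage_union, hφ.preimage_upperBall]

lemma edgeCov_radialLevel (hφ : IsHypIsometry φ) (γ α : ℝ) (c x y : HSpace n) :
    edgeCov γ α (radialLevel (φ c)) {φ c} (φ x) (φ y) =
      edgeCov γ α (radialLevel c) {c} x y := by
  unfold edgeCov
  rw [hφ.edgeMixedMoment_radialLevel, hφ.edgeMoment_radialLevel, hφ.edgeMoment_radialLevel]

lemma edgeCovIntegral_radialLevel (hφ : IsHypIsometry φ) (γ α : ℝ) (c x : HSpace n) :
    edgeCovIntegral γ α (radialLevel (φ c)) {φ c} (φ x) =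
      edgeCovIntegral γ α (radialLevel c) {c} x := by
  unfold edgeCovIntegral
  rw [← hφ.measurePreserving.setIntegral_preimage_emb φ.measurableEmbedding]
  simp_rw [hφ.edgeCov_radialLevel]
  congr 2
  ext z
  simp [radialLevel, hφ.hdist_map]

end IsHypIsometry

/-! ### From the radial tree to the directed forest -/

lemma hasTailBound_radialLevel {γ : ℝ} (hγ : 0 < γ) {c x : HSpace n} (hx : x ≠ c) :
    HasTailBound γ (radialLevel c) {c} x := by
  intro s hs
  unfold voidProb
  split_ifs with hdisj
  · have hsc : s ≤ hdist c x := by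
      by_contra! hlt
      refine Set.disjoint_singleton_left.1 hdisj ⟨?_, by rwa [hdist_comm]⟩
      rw [radialLevel_lt, hdist_self]
      exact hdist_pos hx.symm
    have hlens : ENNReal.ofReal (ballVol n (s / 2)) ≤ hvol n (upperBall (radialLevel c) x s) :=
      (ballVol_half_le_hvol_lens hs.le hsc).trans
        (measure_mono fun z hz => ⟨radialLevel_lt.2 hz.1, hz.2⟩)
    rw [ENNReal.ofReal_le_iff_le_toReal (hvol_upperBall_lt_top _ _ _).ne] at hlens
    refine ENNReal.ofReal_le_ofReal (Real.exp_le_exp.2 ?_)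
    nlinarith
  · exact zero_le

lemma ae_ne (o : HSpace n) : ∀ᵐ x ∂hvol n, x ≠ o := compl_mem_ae_iff.2 (measure_singleton o)

section Limit

variable (e : IdealPoint n)

lemma ae_horoLevel_ne (x : HSpace n) : ∀ᵐ z ∂hvol n, horoLevel e x ≠ horoLevel e z := by
  rw [ae_iff]
  refine measure_mono_null (fun z hz => ?_) (hvol_horoLevel_eq_zero e (horoLevel e x))
  simpa using (not_not.1 hz).symm

lemma continuous_idealRay : Continuous (idealRay e) := by
  cases e with
  | none => exact (continuous_const.add (Real.continuous_exp.smul continuous_const)).subtype_mk _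
  | some b =>
    exact (continuous_const.add
      ((Real.continuous_exp.comp continuous_neg).smul continuous_const)).subtype_mk _

lemma tendsto_hdist_idealRay (x : HSpace n) :
    Tendsto (fun t => hdist x (idealRay e t)) atTop atTop :=
  (isGeodesicRay_idealRay e).tendsto_hdist x

lemma eventually_idealRay_ne (x : HSpace n) : ∀ᶠ t in atTop, x ≠ idealRay e t := by
  filter_upwards [(tendsto_hdist_idealRay e x).eventually_gt_atTop 0] with t ht heq
  rw [← heq, hdist_self] at ht
  exact lt_irrefl _ ht

lemma eventually_idealRay_notMem_upperBall (x : HSpace n) (s : ℝ) :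
    ∀ᶠ t in atTop, idealRay e t ∉ upperBall (radialLevel (idealRay e t)) x s := by
  filter_upwards [(tendsto_hdist_idealRay e x).eventually_ge_atTop s] with t ht hmem
  exact ht.not_gt hmem.2

variable {e} in
lemma eventually_mem_upperBall_iff {x z : HSpace n} (h : horoLevel e x ≠ horoLevel e z) (s : ℝ) :
    ∀ᶠ t in atTop,
      (z ∈ upperBall (radialLevel (idealRay e t)) x s ↔ z ∈ upperBall (horoLevel e) x s) := by
  filter_upwards [eventually_hdist_idealRay_lt_iff e h] with t ht
  exact and_congr_left' ht

lemma tendsto_hvol_upperBall_union (x y : HSpace n) (s t : ℝ) :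
    Tendsto (fun r => hvol n (upperBall (radialLevel (idealRay e r)) x s ∪
        upperBall (radialLevel (idealRay e r)) y t)) atTop
      (𝓝 (hvol n (upperBall (horoLevel e) x s ∪ upperBall (horoLevel e) y t))) := by
  refine tendsto_measure_of_ae_tendsto_indicator atTop
    ((measurableSet_upperBall x s (measurable_horoLevel e)).union
      (measurableSet_upperBall y t (measurable_horoLevel e)))
    (fun r => (measurableSet_upperBall x s (measurable_radialLevel _)).union
      (measurableSet_upperBall y t (measurable_radialLevel _)))
    ((measurableSet_hball x s).union (measurableSet_hball y t))
    (measure_union_lt_top (hvol_hball_lt_top x s) (hvol_hball_lt_top y t)).ne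
    (Eventually.of_forall fun r => Set.union_subset_union (upperBall_subset_hball _ _ _)
      (upperBall_subset_hball _ _ _)) ?_
  filter_upwards [ae_horoLevel_ne e x, ae_horoLevel_ne e y] with z hx hy
  filter_upwards [eventually_mem_upperBall_iff hx s, eventually_mem_upperBall_iff hy t]
    with r hxr hyr using or_congr hxr hyr

lemma tendsto_hvol_upperBall (x : HSpace n) (s : ℝ) :
    Tendsto (fun r => hvol n (upperBall (radialLevel (idealRay e r)) x s)) atTop
      (𝓝 (hvol n (upperBall (horoLevel e) x s))) := by
  simpa only [Set.union_self] using tendsto_hvol_upperBall_union e x x s s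

lemma tendsto_voidProb {ι : Type*} {l : Filter ι} {γ : ℝ} {G A : ι → Set (HSpace n)}
    {G' A' : Set (HSpace n)} (hfin : hvol n A' < ∞)
    (hA : Tendsto (fun r => hvol n (A r)) l (𝓝 (hvol n A')))
    (hG : ∀ᶠ r in l, (Disjoint (G r) (A r) ↔ Disjoint G' A')) :
    Tendsto (fun r => voidProb γ (G r) (A r)) l (𝓝 (voidProb γ G' A')) := by
  unfold voidProb
  by_cases hdisj : Disjoint G' A'
  · rw [if_pos hdisj]
    have hvol_lim := (ENNReal.tendsto_toReal hfin.ne).comp hA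
    refine (ENNReal.tendsto_ofReal
      ((Real.continuous_exp.tendsto _).comp (hvol_lim.const_mul (-γ)))).congr' ?_
    filter_upwards [hG] with r hr
    rw [if_pos (hr.2 hdisj)]
    rfl
  · rw [if_neg hdisj]
    refine tendsto_const_nhds.congr' ?_
    filter_upwards [hG] with r hr
    rw [if_neg fun h => hdisj (hr.1 h)]

lemma tendsto_voidProb_upperBall (γ : ℝ) (x : HSpace n) (s : ℝ) :
    Tendsto (fun r => voidProb γ {idealRay e r} (upperBall (radialLevel (idealRay e r)) x s)) atTop
      (𝓝 (voidProb γ ∅ (upperBall (horoLevel e) x s))) := by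
  refine tendsto_voidProb (hvol_upperBall_lt_top _ _ _) (tendsto_hvol_upperBall e x s) ?_
  filter_upwards [eventually_idealRay_notMem_upperBall e x s] with r hr
  simp [hr]

variable {e} in
lemma tendsto_voidProb_pair (γ : ℝ) {x y : HSpace n} (hxy : horoLevel e x ≠ horoLevel e y)
    (s t : ℝ) :
    Tendsto (fun r => voidProb γ ({idealRay e r} ∪ {x, y})
        (upperBall (radialLevel (idealRay e r)) x s ∪ upperBall (radialLevel (idealRay e r)) y t))
      atTop (𝓝 (voidProb γ (∅ ∪ {x, y})
        (upperBall (horoLevel e) x s ∪ upperBall (horoLevel e) y t))) := by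
  refine tendsto_voidProb (hvol_upperBall_union_lt_top _ _ _ _ _)
    (tendsto_hvol_upperBall_union e x y s t) ?_
  filter_upwards [eventually_idealRay_notMem_upperBall e x s,
    eventually_idealRay_notMem_upperBall e y t, eventually_mem_upperBall_iff hxy s,
    eventually_mem_upperBall_iff hxy.symm t] with r hrx hry hxy_iff hyx_iff
  simp [Set.disjoint_insert_left, hrx, hry, hxy_iff, hyx_iff, notMem_upperBall_self]

lemma hasTailBound_horoLevel {γ : ℝ} (hγ : 0 < γ) (x : HSpace n) :
    HasTailBound γ (horoLevel e) ∅ x := by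
  intro s hs
  refine le_of_tendsto (tendsto_voidProb_upperBall e γ x s) ?_
  filter_upwards [eventually_idealRay_ne e x] with r hr
  exact hasTailBound_radialLevel hγ hr s hs

lemma ballVol_half_le_hvol_upperBall_horoLevel (x : HSpace n) {s : ℝ} (hs : 0 < s) :
    ENNReal.ofReal (ballVol n (s / 2)) ≤ hvol n (upperBall (horoLevel e) x s) := by
  have htail := hasTailBound_horoLevel e one_pos x s hs
  unfold voidProb at htail
  rw [if_pos (Set.empty_disjoint _), ENNReal.ofReal_le_ofReal_iff (Real.exp_pos _).le,
    Real.exp_le_exp] at htail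
  rw [ENNReal.ofReal_le_iff_le_toReal (hvol_upperBall_lt_top _ _ _).ne]
  linarith

lemma hvol_setOf_horoLevel_lt (x : HSpace n) :
    hvol n {z | horoLevel e x < horoLevel e z} = ∞ := by
  have hlim : Tendsto (fun s : ℝ => ENNReal.ofReal (ballVol n (s / 2))) atTop (𝓝 ∞) :=
    ENNReal.tendsto_ofReal_nhds_top.2
      (tendsto_ballVol.comp (tendsto_id.atTop_div_const (by norm_num)))
  refine top_le_iff.1 (le_of_tendsto hlim ?_)
  filter_upwards [eventually_gt_atTop 0] with s hs
  exact (ballVol_half_le_hvol_upperBall_horoLevel e x hs).trans (measure_mono fun z hz => hz.1)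

section EdgeMoments

variable {γ α : ℝ} {x y : HSpace n}

lemma tendsto_edgeMoment (hγ : 0 < γ) (hα : 0 < α) (x : HSpace n) :
    Tendsto (fun r => edgeMoment γ α (radialLevel (idealRay e r)) {idealRay e r} x) atTop
      (𝓝 (edgeMoment γ α (horoLevel e) ∅ x)) := by
  refine tendsto_lintegral_filter_of_dominated_convergence (edgeTail n γ)
    (Eventually.of_forall fun r => measurable_voidProb_upperBall_right γ
      (measurable_radialLevel (idealRay e r)) (Set.countable_singleton _) x) ?_
    (edgeTailMoment_lt_top hγ hα).ne
    (Eventually.of_forall fun s => tendsto_voidProb_upperBall e γ x s)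
  filter_upwards [eventually_idealRay_ne e x] with r hr
  filter_upwards [ae_powerMeasure_pos α] with s hs
  exact (hasTailBound_radialLevel hγ hr).le_edgeTail hγ hs

variable {e}

lemma tendsto_edgeMixedMoment (hγ : 0 < γ) (hα : 0 < α) (hxy : horoLevel e x ≠ horoLevel e y) :
    Tendsto (fun r => edgeMixedMoment γ α (radialLevel (idealRay e r)) {idealRay e r} x y) atTop
      (𝓝 (edgeMixedMoment γ α (horoLevel e) ∅ x y)) := by
  have htail := measurable_edgeTail (n := n) γ
  refine tendsto_lintegral_filter_of_dominated_convergence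
    (fun p : ℝ × ℝ => edgeTail n γ p.1 * edgeTail n γ p.2)
    (Eventually.of_forall fun r => measurable_voidProb_pair_right γ
      (measurable_radialLevel (idealRay e r)) (Set.countable_singleton _) x y) ?_ ?_
    (Eventually.of_forall fun p => tendsto_voidProb_pair γ hxy p.1 p.2)
  · filter_upwards [eventually_idealRay_ne e x, eventually_idealRay_ne e y] with r hx hy
    filter_upwards [ae_powerMeasure_prod_pos α] with p hp
    exact (hasTailBound_radialLevel hγ hx).voidProb_pair_le_edgeTail
      (hasTailBound_radialLevel hγ hy) hγ hp.1 hp.2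
  · rw [lintegral_prod_mul htail.aemeasurable htail.aemeasurable]
    exact (ENNReal.mul_lt_top (edgeTailMoment_lt_top hγ hα) (edgeTailMoment_lt_top hγ hα)).ne

lemma tendsto_edgeCov (hγ : 0 < γ) (hα : 0 < α) (hxy : horoLevel e x ≠ horoLevel e y) :
    Tendsto (fun r => edgeCov γ α (radialLevel (idealRay e r)) {idealRay e r} x y) atTop
      (𝓝 (edgeCov γ α (horoLevel e) ∅ x y)) := by
  have hx := hasTailBound_horoLevel e hγ x
  have hy := hasTailBound_horoLevel e hγ y
  have hmixed := hx.edgeMixedMoment_lt_top hy hγ hα (measurable_horoLevel e) Set.countable_empty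
  exact ((ENNReal.tendsto_toReal hmixed.ne).comp (tendsto_edgeMixedMoment hγ hα hxy)).sub
    (((ENNReal.tendsto_toReal (hx.edgeMoment_lt_top hγ hα).ne).comp
      (tendsto_edgeMoment e hγ hα x)).mul
    ((ENNReal.tendsto_toReal (hy.edgeMoment_lt_top hγ hα).ne).comp
      (tendsto_edgeMoment e hγ hα y)))

lemma tendsto_indicator_edgeCov (hγ : 0 < γ) (hα : 0 < α)
    (hxy : horoLevel e x ≠ horoLevel e y) :
    Tendsto (fun r => Set.indicator
        {y | radialLevel (idealRay e r) x < radialLevel (idealRay e r) y}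
        (edgeCov γ α (radialLevel (idealRay e r)) {idealRay e r} x) y) atTop
      (𝓝 (Set.indicator {y | horoLevel e x < horoLevel e y}
        (edgeCov γ α (horoLevel e) ∅ x) y)) := by
  have hiff := eventually_hdist_idealRay_lt_iff e hxy
  by_cases hlt : horoLevel e x < horoLevel e y
  · rw [Set.indicator_of_mem (s := {y | horoLevel e x < horoLevel e y}) hlt]
    refine (tendsto_edgeCov hγ hα hxy).congr' ?_
    filter_upwards [hiff] with r hr using (Set.indicator_of_mem
      (s := {y | radialLevel (idealRay e r) x < radialLevel (idealRay e r) y}) (hr.2 hlt) _).symm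
  · rw [Set.indicator_of_notMem (s := {y | horoLevel e x < horoLevel e y}) hlt]
    refine tendsto_const_nhds.congr' ?_
    filter_upwards [hiff] with r hr using (Set.indicator_of_notMem
      (s := {y | radialLevel (idealRay e r) x < radialLevel (idealRay e r) y})
      (fun h => hlt (hr.1 h)) _).symm

variable (e) in
lemma tendsto_edgeCovIntegral (hγ : 0 < γ) (hα : 0 < α) (x : HSpace n) :
    Tendsto (fun r => edgeCovIntegral γ α (radialLevel (idealRay e r)) {idealRay e r} x) atTop
      (𝓝 (edgeCovIntegral γ α (horoLevel e) ∅ x)) := by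
  have hradial : ∀ r,
      MeasurableSet {y | radialLevel (idealRay e r) x < radialLevel (idealRay e r) y} :=
    fun r => measurableSet_lt measurable_const (measurable_radialLevel _)
  have hhoro : MeasurableSet {y | horoLevel e x < horoLevel e y} :=
    measurableSet_lt measurable_const (measurable_horoLevel e)
  unfold edgeCovIntegral
  simp_rw [← integral_indicator (hradial _), ← integral_indicator hhoro]
  refine tendsto_integral_filter_of_dominated_convergence
    (fun y => (edgeTailMoment n γ α).toReal ^ 2 * covDecay n γ (hdist x y))
    (Eventually.of_forall fun r => ?_) ?_ ((integrable_covDecay hγ x).const_mul _)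
    ((ae_horoLevel_ne e x).mono fun y hy => tendsto_indicator_edgeCov hγ hα hy)
  · exact (((measurable_edgeCov γ α (measurable_radialLevel _) (Set.countable_singleton _)).comp
      measurable_prodMk_left).indicator (hradial r)).aestronglyMeasurable
  · filter_upwards [eventually_idealRay_ne e x] with r hr
    filter_upwards [ae_ne (idealRay e r)] with y hy
    exact (norm_indicator_le_norm_self _ _).trans
      ((hasTailBound_radialLevel hγ hr).abs_edgeCov_le (hasTailBound_radialLevel hγ hy) hγ hα
        (measurable_radialLevel _) (Set.countable_singleton _))

end EdgeMoments

lemma eventually_exists_hdist_idealRay_eq (o : HSpace n) (T : ℝ) :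
    ∀ᶠ r in atTop, ∃ t, T ≤ t ∧ hdist o (idealRay e t) = r := by
  have hcont : Continuous fun t => hdist o (idealRay e t) :=
    (continuous_hdist_right o).comp (continuous_idealRay e)
  filter_upwards [eventually_ge_atTop (hdist o (idealRay e T))] with r hr
  obtain ⟨t₁, hrt₁, hTt₁⟩ := (((tendsto_hdist_idealRay e o).eventually_ge_atTop r).and
    (eventually_ge_atTop T)).exists
  obtain ⟨t, ht, htr⟩ := intermediate_value_Icc hTt₁ hcont.continuousOn ⟨hr, hrt₁⟩
  exact ⟨t, ht.1, htr⟩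

variable {e} in
/-- An isometry carries `(o, x)` to `(τ t, o)` for the time `t` at which the ray `τ` toward `e` is
at distance `hdist o x` from `o`, so `x` far from `o` may be replaced by a centre far out on `τ`. -/
lemma tendsto_of_isometry_invariant {Φ : HSpace n → HSpace n → ℝ}
    (hinv : ∀ φ : HSpace n ≃ᵐ HSpace n, IsHypIsometry φ → ∀ c x, Φ (φ c) (φ x) = Φ c x)
    (o : HSpace n) {L : ℝ} (hlim : Tendsto (fun r => Φ (idealRay e r) o) atTop (𝓝 L)) :
    Tendsto (Φ o) (comap (hdist o) atTop) (𝓝 L) := by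
  rw [Metric.tendsto_nhds] at hlim ⊢
  intro ε hε
  obtain ⟨T, hT⟩ := eventually_atTop.1 (hlim ε hε)
  rw [eventually_comap]
  filter_upwards [eventually_exists_hdist_idealRay_eq e o T] with r hr x hx
  obtain ⟨t, hTt, htr⟩ := hr
  obtain ⟨φ, hφ, hφo, hφx⟩ := exists_isometry_of_hdist_eq (a := o) (b := x) (a' := idealRay e t)
    (b' := o) (by rw [hx, hdist_comm, htr])
  rw [← hinv φ hφ, hφo, hφx]
  exact hT t hTt

end Limit

/-! ### Nearest points -/

lemma bddBelow_image_hdist (x : HSpace n) (S : Set (HSpace n)) : BddBelow (hdist x '' S) :=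
  ⟨0, Set.forall_mem_image.2 fun z _ => hdist_nonneg x z⟩

lemma nearestDist_nonneg (x : HSpace n) (S : Set (HSpace n)) : 0 ≤ nearestDist x S :=
  Real.sInf_nonneg (Set.forall_mem_image.2 fun z _ => hdist_nonneg x z)

lemma le_nearestDist_iff {x : HSpace n} {S : Set (HSpace n)} {s : ℝ} (hs : 0 < s) :
    s ≤ nearestDist x S ↔ S.Nonempty ∧ Disjoint S (hball x s) := by
  unfold nearestDist
  rcases S.eq_empty_or_nonempty with rfl | hS
  · simp [hs]
  · rw [le_csInf_iff (bddBelow_image_hdist x S) (hS.image _), Set.disjoint_left]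
    simp only [hS, true_and, Set.forall_mem_image, mem_hball, not_lt]

lemma nearestDist_anti {x : HSpace n} {S S' : Set (HSpace n)} (h : S ⊆ S') (hS : S.Nonempty) :
    nearestDist x S' ≤ nearestDist x S :=
  csInf_le_csInf (bddBelow_image_hdist x S') (hS.image _) (Set.image_mono h)

lemma radialLength_nonneg (o : HSpace n) (ξ : Set (HSpace n)) (x : HSpace n) :
    0 ≤ radialLength o ξ x :=
  nearestDist_nonneg _ _

lemma radialLength_self (o : HSpace n) (ξ : Set (HSpace n)) : radialLength o ξ o = 0 := by
  have hempty : {y | y ∈ ξ ∪ {o} ∧ hdist o y < hdist o o} = ∅ := by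
    ext y
    simp [(hdist_nonneg o y).not_gt]
  rw [radialLength, hempty]
  simp [nearestDist]

lemma le_radialLength_iff {o x : HSpace n} (hx : x ≠ o) {s : ℝ} (hs : 0 < s)
    (ξ : Set (HSpace n)) :
    s ≤ radialLength o ξ x ↔ Disjoint (ξ ∪ {o}) (upperBall (radialLevel o) x s) := by
  have hne : {y | y ∈ ξ ∪ {o} ∧ hdist o y < hdist o x}.Nonempty :=
    ⟨o, Or.inr rfl, by rw [hdist_self]; exact hdist_pos hx.symm⟩
  rw [radialLength, le_nearestDist_iff hs, and_iff_right hne]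
  simp only [Set.disjoint_left, mem_hball, upperBall, radialLevel_lt, Set.mem_ofPred_eq, not_and,
    and_imp]

lemma le_radialLength_iff_hdist (o x : HSpace n) {s : ℝ} (hs : 0 < s) (ξ : Set (HSpace n)) :
    s ≤ radialLength o ξ x ↔ s ≤ hdist o x ∧ Disjoint ξ (upperBall (radialLevel o) x s) := by
  rcases eq_or_ne x o with rfl | hx
  · simp [radialLength_self, hdist_self, hs.not_ge]
  · rw [le_radialLength_iff hx hs, Set.disjoint_union_left, and_comm,
      Set.disjoint_singleton_left]
    refine and_congr_left' ?_
    simp only [upperBall, radialLevel_lt, Set.mem_ofPred_eq, hdist_self, not_and, not_lt,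
      hdist_comm x o, hdist_pos hx.symm, forall_const]

/-! ### Measurability of the radial edge lengths -/

lemma setOf_mem_voidEvent_eq_iInter {U : Set (HSpace n × HSpace n)} (hU : IsOpen U)
    {𝓑 : Set (Set (HSpace n))} (h𝓑 : TopologicalSpace.IsTopologicalBasis 𝓑) :
    {p : HSpace n × Config n | p.2 ∈ voidEvent {z | (p.1, z) ∈ U}} =
      ⋂ q ∈ {q | q ∈ 𝓑 ×ˢ 𝓑 ∧ q.1 ×ˢ q.2 ⊆ U}, (q.1 ×ˢ (voidEvent q.2)ᶜ)ᶜ := by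
  ext ⟨x, ξ⟩
  simp only [Set.mem_iInter]
  constructor
  · rintro hvoid ⟨A, B⟩ ⟨-, hAB⟩ ⟨hx, hξ⟩
    exact hξ (Set.disjoint_left.2 fun z hz hzB => Set.disjoint_left.1 hvoid hz (hAB ⟨hx, hzB⟩))
  · intro hboxes
    refine Set.disjoint_left.2 fun z hz hzU => ?_
    obtain ⟨_, ⟨u, hu, v, hv, rfl⟩, ⟨hxu, hzv⟩, huv⟩ :=
      (h𝓑.prod h𝓑).exists_subset_of_mem_open hzU hU
    exact hboxes (u, v) ⟨⟨hu, hv⟩, huv⟩ ⟨hxu, fun hvoid => Set.disjoint_left.1 hvoid hz hzv⟩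

lemma measurableSet_setOf_mem_voidEvent {U : Set (HSpace n × HSpace n)} (hU : IsOpen U) :
    MeasurableSet {p : HSpace n × Config n | p.2 ∈ voidEvent {z | (p.1, z) ∈ U}} := by
  have h𝓑 := TopologicalSpace.isBasis_countableBasis (HSpace n)
  have hcount := TopologicalSpace.countable_countableBasis (HSpace n)
  rw [setOf_mem_voidEvent_eq_iInter hU h𝓑]
  refine MeasurableSet.biInter ((hcount.prod hcount).mono fun q hq => hq.1) fun q hq => ?_
  have hq₁ : MeasurableSet q.1 := (h𝓑.isOpen hq.1.1).measurableSet
  have hq₂ : MeasurableSet q.2 := (h𝓑.isOpen hq.1.2).measurableSet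
  exact (hq₁.prod (measurableSet_voidEvent hq₂).compl).compl

lemma measurable_radialLength (o : HSpace n) :
    Measurable fun p : HSpace n × Config n => radialLength o p.2 p.1 := by
  refine measurable_of_Ici fun s => ?_
  rcases le_or_gt s 0 with hs | hs
  · convert MeasurableSet.univ
    exact Set.eq_univ_of_forall fun p => hs.trans (radialLength_nonneg _ _ _)
  · set U : Set (HSpace n × HSpace n) :=
      {q | radialLevel o q.1 < radialLevel o q.2 ∧ hdist q.1 q.2 < s}
    have hU : IsOpen U := by
      have hlevel : Continuous (radialLevel o) := (continuous_hdist_right o).neg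
      exact (isOpen_lt (hlevel.comp continuous_fst) (hlevel.comp continuous_snd)).inter
        (isOpen_lt continuous_hdist continuous_const)
    have hpreimage : (fun p : HSpace n × Config n => radialLength o p.2 p.1) ⁻¹' Set.Ici s =
        {p | s ≤ hdist o p.1} ∩ {p | p.2 ∈ voidEvent {z | (p.1, z) ∈ U}} := by
      ext ⟨x, ξ⟩
      exact le_radialLength_iff_hdist o x hs ξ
    rw [hpreimage]
    exact (measurableSet_le measurable_const
      ((continuous_hdist_right o).measurable.comp measurable_fst)).inter
      (measurableSet_setOf_mem_voidEvent hU)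

/-! ### Moments of the edge lengths -/

namespace IsPoissonProcess

variable {Ω : Type*} [MeasurableSpace Ω] {P : Measure Ω} {γ : ℝ} {η : Ω → Set (HSpace n)}
  {o x y : HSpace n}

lemma measure_disjoint_union (hη : IsPoissonProcess P η (ENNReal.ofReal γ • hvol n)) (hγ : 0 < γ)
    (F : Set (HSpace n)) {A : Set (HSpace n)} (hA : MeasurableSet A) (hfin : hvol n A < ∞) :
    P {ω | Disjoint (η ω ∪ F) A} = voidProb γ F A := by
  unfold voidProb
  by_cases hFA : Disjoint F A
  · simp only [Set.disjoint_union_left, hFA, and_true, if_true]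
    rw [hη.measure_void hA, Measure.smul_apply, smul_eq_mul,
      poissonLaw_zero (ENNReal.mul_ne_top ENNReal.ofReal_ne_top hfin.ne),
      ENNReal.toReal_mul, ENNReal.toReal_ofReal hγ.le, neg_mul]
  · simp [Set.disjoint_union_left, hFA]

lemma measurable_radialLength_insert {μ : Measure (HSpace n)} (hη : IsPoissonProcess P η μ)
    (o x : HSpace n) : Measurable fun ω => radialLength o (insert x (η ω)) x := by
  have hpair : Measurable fun ω => (x, addPoint x (toConfig η ω)) :=
    hη.measurable_withPoint.comp measurable_prodMk_left
  have h := (measurable_radialLength o).comp hpair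
  exact h

lemma measurable_radialLength_insert_insert {μ : Measure (HSpace n)}
    (hη : IsPoissonProcess P η μ) (o x y z : HSpace n) :
    Measurable fun ω => radialLength o (insert x (insert y (η ω))) z := by
  have hconfig : Measurable fun ω => addPoint x (addPoint y (toConfig η ω)) :=
    measurable_snd.comp (measurable_snd.comp
      (hη.measurable_withPair.comp (measurable_prodMk_left.comp measurable_prodMk_left)))
  have h := (measurable_radialLength o).comp (measurable_const.prodMk hconfig : Measurable fun ω =>
    (z, addPoint x (addPoint y (toConfig η ω))))
  exact h

variable [IsProbabilityMeasure P]

lemma lintegral_radialLength_rpow (hη : IsPoissonProcess P η (ENNReal.ofReal γ • hvol n))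
    (hγ : 0 < γ) {β : ℝ} (hβ : 0 < β) (hx : x ≠ o) :
    ∫⁻ ω, ENNReal.ofReal (radialLength o (insert x (η ω)) x ^ β) ∂P =
      edgeMoment γ β (radialLevel o) {o} x := by
  rw [lintegral_rpow_eq_lintegral_tail (hη.measurable_radialLength_insert o x)
    (fun ω => radialLength_nonneg _ _ _) hβ]
  refine lintegral_congr_ae ((ae_powerMeasure_pos β).mono fun s (hs : 0 < s) => ?_)
  simp only
  rw [← hη.measure_disjoint_union hγ {o} (measurableSet_upperBall x s (measurable_radialLevel o))
    (hvol_upperBall_lt_top _ _ _)]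
  congr 1
  ext ω
  rw [Set.mem_ofPred_eq, le_radialLength_iff hx hs, Set.insert_union, Set.disjoint_insert_left]
  exact and_iff_right (notMem_upperBall_self _ _ _)

lemma lintegral_radialLength_mul (hη : IsPoissonProcess P η (ENNReal.ofReal γ • hvol n))
    (hγ : 0 < γ) {α : ℝ} (hα : 0 < α) (hx : x ≠ o) (hy : y ≠ o) :
    ∫⁻ ω, ENNReal.ofReal (radialLength o (insert x (insert y (η ω))) x ^ α) *
        ENNReal.ofReal (radialLength o (insert x (insert y (η ω))) y ^ α) ∂P =
      edgeMixedMoment γ α (radialLevel o) {o} x y := by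
  rw [lintegral_rpow_mul_rpow_eq_lintegral_tail
    (hη.measurable_radialLength_insert_insert o x y x) (fun ω => radialLength_nonneg _ _ _)
    (hη.measurable_radialLength_insert_insert o x y y) (fun ω => radialLength_nonneg _ _ _) hα]
  refine lintegral_congr_ae ((ae_powerMeasure_prod_pos α).mono fun p hp => ?_)
  simp only
  have hmeas := fun z s => measurableSet_upperBall z s (measurable_radialLevel o)
  rw [← hη.measure_disjoint_union hγ _ ((hmeas x p.1).union (hmeas y p.2))
    (hvol_upperBall_union_lt_top _ _ _ _ _)]
  congr 1
  ext ω
  have hunion : insert x (insert y (η ω)) ∪ {o} = η ω ∪ ({o} ∪ {x, y}) := by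
    ext z
    simp only [Set.mem_union, Set.mem_insert_iff, Set.mem_singleton_iff]
    tauto
  rw [Set.mem_ofPred_eq, Set.mem_ofPred_eq, le_radialLength_iff hx hp.1,
    le_radialLength_iff hy hp.2, ← Set.disjoint_union_right, hunion]

end IsPoissonProcess

/-- The points at which the edge that starts at `y` in a directed spanning forest toward `e` may
end. -/
def directedTargets (e : IdealPoint n) (y : HSpace n) : Set (HSpace n) :=
  {z | z ≠ y ∧ z ∈ horoball e y}

/-- The possible ends at distance less than `s` from the start `y`; up to a null set this is the
upper ball of `horoLevel e`. -/
def directedBall (e : IdealPoint n) (y : HSpace n) (s : ℝ) : Set (HSpace n) :=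
  directedTargets e y ∩ hball y s

section DirectedBall

variable (e : IdealPoint n) (y : HSpace n) (s : ℝ)

lemma measurableSet_directedTargets : MeasurableSet (directedTargets e y) :=
  (measurableSet_singleton y).compl.inter (measurableSet_horoball e y)

lemma measurableSet_directedBall : MeasurableSet (directedBall e y s) :=
  (measurableSet_directedTargets e y).inter (measurableSet_hball y s)

lemma notMem_directedBall_self : y ∉ directedBall e y s := fun hy => hy.1.1 rfl

lemma directedLength_eq (ξ : Set (HSpace n)) :
    directedLength e ξ y = nearestDist y (ξ ∩ directedTargets e y) := rfl

variable {e y} in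
lemma mem_directedBall_iff {z : HSpace n} (hyz : horoLevel e y ≠ horoLevel e z) :
    z ∈ directedBall e y s ↔ z ∈ upperBall (horoLevel e) y s := by
  rw [directedBall, directedTargets, horoball_eq]
  constructor
  · rintro ⟨⟨-, hle⟩, hdist⟩
    exact ⟨lt_of_le_of_ne hle hyz, hdist⟩
  · rintro ⟨hlt, hdist⟩
    exact ⟨⟨fun hzy => hyz (by rw [hzy]), hlt.le⟩, hdist⟩

lemma directedBall_ae_eq : directedBall e y s =ᵐ[hvol n] upperBall (horoLevel e) y s := by
  filter_upwards [ae_horoLevel_ne e y] with z hz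
  exact propext (mem_directedBall_iff s hz)

lemma hvol_directedBall_lt_top : hvol n (directedBall e y s) < ∞ := by
  rw [measure_congr (directedBall_ae_eq e y s)]
  exact hvol_upperBall_lt_top _ _ _

lemma hvol_directedTargets : hvol n (directedTargets e y) = ∞ := by
  refine measure_mono_top (fun z (hz : horoLevel e y < horoLevel e z) => ?_)
    (hvol_setOf_horoLevel_lt e y)
  refine ⟨?_, ?_⟩
  · rintro rfl
    exact hz.false
  · rw [horoball_eq]
    exact hz.le

lemma voidProb_directedBall (γ : ℝ) :
    voidProb γ {y} (directedBall e y s) = voidProb γ ∅ (upperBall (horoLevel e) y s) := by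
  unfold voidProb
  rw [if_pos (Set.disjoint_singleton_left.2 (notMem_directedBall_self e y s)),
    if_pos (Set.empty_disjoint _), measure_congr (directedBall_ae_eq e y s)]

end DirectedBall

section DirectedBallUnion

variable {e : IdealPoint n} {x y : HSpace n}

lemma disjoint_directedBall_union_iff (hxy : horoLevel e x ≠ horoLevel e y) (s t : ℝ) :
    Disjoint {x, y} (directedBall e x s ∪ directedBall e y t) ↔
      Disjoint {x, y} (upperBall (horoLevel e) x s ∪ upperBall (horoLevel e) y t) := by
  simp only [Set.disjoint_insert_left, Set.disjoint_singleton_left, Set.mem_union,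
    mem_directedBall_iff s hxy, mem_directedBall_iff t hxy.symm, notMem_directedBall_self,
    notMem_upperBall_self]

lemma voidProb_directedBall_union (γ : ℝ) (hxy : horoLevel e x ≠ horoLevel e y) (s t : ℝ) :
    voidProb γ {x, y} (directedBall e x s ∪ directedBall e y t) =
      voidProb γ {x, y} (upperBall (horoLevel e) x s ∪ upperBall (horoLevel e) y t) := by
  unfold voidProb
  rw [measure_congr ((directedBall_ae_eq e x s).union (directedBall_ae_eq e y t))]
  by_cases hdisj : Disjoint {x, y} (directedBall e x s ∪ directedBall e y t)
  · rw [if_pos hdisj, if_pos ((disjoint_directedBall_union_iff hxy s t).1 hdisj)]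
  · rw [if_neg hdisj, if_neg (mt (disjoint_directedBall_union_iff hxy s t).2 hdisj)]

end DirectedBallUnion

lemma ell_nonneg (e : IdealPoint n) (ξ : Set (HSpace n)) (y : HSpace n) : 0 ≤ ell e ξ y :=
  nearestDist_nonneg _ _

lemma ellWith_nonneg (e : IdealPoint n) (ξ : Set (HSpace n)) (x y : HSpace n) :
    0 ≤ ellWith e ξ x y :=
  nearestDist_nonneg _ _

lemma ellWith_rpow_mul_nonneg (e : IdealPoint n) (ξ : Set (HSpace n)) (x y : HSpace n) (α : ℝ) :
    0 ≤ ellWith e ξ y x ^ α * ellWith e ξ x y ^ α :=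
  mul_nonneg (Real.rpow_nonneg (ellWith_nonneg e ξ y x) α)
    (Real.rpow_nonneg (ellWith_nonneg e ξ x y) α)

lemma rpow_mul_rpow_le_add_rpow_two_mul {a b α : ℝ} (ha : 0 ≤ a) (hb : 0 ≤ b) :
    a ^ α * b ^ α ≤ a ^ (2 * α) + b ^ (2 * α) := by
  rw [mul_comm 2 α, Real.rpow_mul ha, Real.rpow_mul hb, Real.rpow_two, Real.rpow_two]
  nlinarith [sq_nonneg (a ^ α - b ^ α), sq_nonneg (a ^ α), sq_nonneg (b ^ α)]

namespace IsPoissonProcess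

variable {Ω : Type*} [MeasurableSpace Ω] {P : Measure Ω} {γ : ℝ} {η : Ω → Set (HSpace n)}

lemma measurableSet_disjoint_union {μ : Measure (HSpace n)} (hη : IsPoissonProcess P η μ)
    (F : Set (HSpace n)) {A : Set (HSpace n)} (hA : MeasurableSet A) :
    MeasurableSet {ω | Disjoint (η ω ∪ F) A} := by
  by_cases hFA : Disjoint F A
  · simpa only [Set.disjoint_union_left, hFA, and_true] using hη.measurableSet_void hA
  · simp [Set.disjoint_union_left, hFA]

lemma measurable_nearestDist {μ : Measure (HSpace n)} (hη : IsPoissonProcess P η μ)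
    (F : Set (HSpace n)) {D : Set (HSpace n)} (hD : MeasurableSet D) (x : HSpace n) :
    Measurable fun ω => nearestDist x ((η ω ∪ F) ∩ D) := by
  refine measurable_of_Ici fun s => ?_
  rcases le_or_gt s 0 with hs | hs
  · convert MeasurableSet.univ
    exact Set.eq_univ_of_forall fun ω => hs.trans (nearestDist_nonneg _ _)
  · have hpreimage : (fun ω => nearestDist x ((η ω ∪ F) ∩ D)) ⁻¹' Set.Ici s =
        {ω | Disjoint (η ω ∪ F) D}ᶜ ∩ {ω | Disjoint (η ω ∪ F) (D ∩ hball x s)} := by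
      ext ω
      simp only [Set.mem_preimage, Set.mem_Ici, Set.mem_inter_iff, Set.mem_compl_iff,
        Set.mem_ofPred_eq]
      rw [le_nearestDist_iff hs, Set.not_disjoint_iff_nonempty_inter,
        Set.disjoint_iff_inter_eq_empty, Set.disjoint_iff_inter_eq_empty, Set.inter_assoc]
    rw [hpreimage]
    exact (hη.measurableSet_disjoint_union F hD).compl.inter
      (hη.measurableSet_disjoint_union F (hD.inter (measurableSet_hball x s)))

lemma measurable_ell {μ : Measure (HSpace n)} (hη : IsPoissonProcess P η μ) (e : IdealPoint n)
    (y : HSpace n) : Measurable fun ω => ell e (η ω) y :=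
  hη.measurable_nearestDist {y} (measurableSet_directedTargets e y) y

lemma measurable_ellWith {μ : Measure (HSpace n)} (hη : IsPoissonProcess P η μ) (e : IdealPoint n)
    (x y : HSpace n) : Measurable fun ω => ellWith e (η ω) x y :=
  hη.measurable_nearestDist {y, x} (measurableSet_directedTargets e y) y

lemma ae_inter_directedTargets_nonempty
    (hη : IsPoissonProcess P η (ENNReal.ofReal γ • hvol n)) (hγ : 0 < γ) (e : IdealPoint n)
    (y : HSpace n) : ∀ᵐ ω ∂P, (η ω ∩ directedTargets e y).Nonempty := by
  have hintensity : (ENNReal.ofReal γ • hvol n) (directedTargets e y) = ∞ := by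
    rw [Measure.smul_apply, smul_eq_mul, hvol_directedTargets,
      ENNReal.mul_top (ENNReal.ofReal_pos.2 hγ).ne']
  rw [ae_iff]
  simp_rw [Set.not_nonempty_iff_eq_empty, ← Set.disjoint_iff_inter_eq_empty]
  rw [hη.measure_void (measurableSet_directedTargets e y), hintensity, poissonLaw_top_zero]

lemma ae_le_directedLength_iff (hη : IsPoissonProcess P η (ENNReal.ofReal γ • hvol n))
    (hγ : 0 < γ) (e : IdealPoint n) (F : Set (HSpace n)) (y : HSpace n) {s : ℝ} (hs : 0 < s) :
    ∀ᵐ ω ∂P, (s ≤ directedLength e (η ω ∪ F) y ↔ Disjoint (η ω ∪ F) (directedBall e y s)) := by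
  filter_upwards [hη.ae_inter_directedTargets_nonempty hγ e y] with ω hω
  have hne : ((η ω ∪ F) ∩ directedTargets e y).Nonempty :=
    hω.mono (Set.inter_subset_inter_left _ Set.subset_union_left)
  rw [directedLength_eq, le_nearestDist_iff hs, and_iff_right hne, directedBall,
    Set.disjoint_iff_inter_eq_empty, Set.inter_assoc, ← Set.disjoint_iff_inter_eq_empty]

lemma measure_le_ell (hη : IsPoissonProcess P η (ENNReal.ofReal γ • hvol n)) (hγ : 0 < γ)
    (e : IdealPoint n) (y : HSpace n) {s : ℝ} (hs : 0 < s) :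
    P {ω | s ≤ ell e (η ω) y} = voidProb γ ∅ (upperBall (horoLevel e) y s) := by
  have hevent : {ω | s ≤ ell e (η ω) y} =ᵐ[P] {ω | Disjoint (η ω ∪ {y}) (directedBall e y s)} := by
    filter_upwards [hη.ae_le_directedLength_iff hγ e {y} y hs] with ω hω using propext hω
  rw [measure_congr hevent, hη.measure_disjoint_union hγ {y} (measurableSet_directedBall e y s)
    (hvol_directedBall_lt_top e y s), voidProb_directedBall]

lemma measure_le_ellWith_and_le_ellWith
    (hη : IsPoissonProcess P η (ENNReal.ofReal γ • hvol n)) (hγ : 0 < γ) {e : IdealPoint n}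
    {x y : HSpace n} (hxy : horoLevel e x ≠ horoLevel e y) {s t : ℝ} (hs : 0 < s) (ht : 0 < t) :
    P {ω | s ≤ ellWith e (η ω) y x ∧ t ≤ ellWith e (η ω) x y} =
      voidProb γ {x, y} (upperBall (horoLevel e) x s ∪ upperBall (horoLevel e) y t) := by
  have hevent : {ω | s ≤ ellWith e (η ω) y x ∧ t ≤ ellWith e (η ω) x y} =ᵐ[P]
      {ω | Disjoint (η ω ∪ {x, y}) (directedBall e x s ∪ directedBall e y t)} := by
    filter_upwards [hη.ae_le_directedLength_iff hγ e {x, y} x hs,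
      hη.ae_le_directedLength_iff hγ e {y, x} y ht] with ω hx hy
    rw [Set.pair_comm y x] at hy
    exact propext ((and_congr hx (by rw [← hy, Set.pair_comm x y]; rfl)).trans
      Set.disjoint_union_right.symm)
  rw [measure_congr hevent, hη.measure_disjoint_union hγ {x, y}
    ((measurableSet_directedBall e x s).union (measurableSet_directedBall e y t))
    (measure_union_lt_top (hvol_directedBall_lt_top e x s) (hvol_directedBall_lt_top e y t)),
    voidProb_directedBall_union γ hxy]

lemma ae_ellWith_le_ell (hη : IsPoissonProcess P η (ENNReal.ofReal γ • hvol n)) (hγ : 0 < γ)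
    (e : IdealPoint n) (x y : HSpace n) : ∀ᵐ ω ∂P, ellWith e (η ω) x y ≤ ell e (η ω) y := by
  filter_upwards [hη.ae_inter_directedTargets_nonempty hγ e y] with ω hω
  refine nearestDist_anti (S := (η ω ∪ {y}) ∩ directedTargets e y) ?_
    (hω.mono (Set.inter_subset_inter_left _ Set.subset_union_left))
  refine Set.inter_subset_inter_left _ (Set.union_subset_union_right _ ?_)
  exact Set.singleton_subset_iff.2 (Set.mem_insert y {x})

variable [IsProbabilityMeasure P]

lemma lintegral_ell_rpow (hη : IsPoissonProcess P η (ENNReal.ofReal γ • hvol n)) (hγ : 0 < γ)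
    {β : ℝ} (hβ : 0 < β) (e : IdealPoint n) (y : HSpace n) :
    ∫⁻ ω, ENNReal.ofReal (ell e (η ω) y ^ β) ∂P = edgeMoment γ β (horoLevel e) ∅ y := by
  rw [lintegral_rpow_eq_lintegral_tail (hη.measurable_ell e y) (fun ω => ell_nonneg _ _ _) hβ]
  exact lintegral_congr_ae ((ae_powerMeasure_pos β).mono fun s hs => hη.measure_le_ell hγ e y hs)

lemma lintegral_ellWith_mul (hη : IsPoissonProcess P η (ENNReal.ofReal γ • hvol n)) (hγ : 0 < γ)
    {α : ℝ} (hα : 0 < α) {e : IdealPoint n} {x y : HSpace n}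
    (hxy : horoLevel e x ≠ horoLevel e y) :
    ∫⁻ ω, ENNReal.ofReal (ellWith e (η ω) y x ^ α) * ENNReal.ofReal (ellWith e (η ω) x y ^ α) ∂P =
      edgeMixedMoment γ α (horoLevel e) ∅ x y := by
  rw [lintegral_rpow_mul_rpow_eq_lintegral_tail (hη.measurable_ellWith e y x)
    (fun ω => ellWith_nonneg _ _ _ _) (hη.measurable_ellWith e x y)
    (fun ω => ellWith_nonneg _ _ _ _) hα, edgeMixedMoment, Set.empty_union]
  exact lintegral_congr_ae ((ae_powerMeasure_prod_pos α).mono fun p hp =>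
    hη.measure_le_ellWith_and_le_ellWith hγ hxy hp.1 hp.2)

lemma integrable_ell_rpow (hη : IsPoissonProcess P η (ENNReal.ofReal γ • hvol n)) (hγ : 0 < γ)
    {β : ℝ} (hβ : 0 < β) (e : IdealPoint n) (y : HSpace n) :
    Integrable (fun ω => ell e (η ω) y ^ β) P := by
  rw [← lintegral_ofReal_ne_top_iff_integrable
    ((hη.measurable_ell e y).pow_const β).aestronglyMeasurable
    (Eventually.of_forall fun ω => Real.rpow_nonneg (ell_nonneg _ _ _) _),
    hη.lintegral_ell_rpow hγ hβ]
  exact ((hasTailBound_horoLevel e hγ y).edgeMoment_lt_top hγ hβ).ne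

lemma integral_ell_rpow (hη : IsPoissonProcess P η (ENNReal.ofReal γ • hvol n)) (hγ : 0 < γ)
    {β : ℝ} (hβ : 0 < β) (e : IdealPoint n) (y : HSpace n) :
    ∫ ω, ell e (η ω) y ^ β ∂P = (edgeMoment γ β (horoLevel e) ∅ y).toReal := by
  rw [integral_eq_lintegral_of_nonneg_ae
    (Eventually.of_forall fun ω => Real.rpow_nonneg (ell_nonneg _ _ _) _)
    (hη.integrable_ell_rpow hγ hβ e y).aestronglyMeasurable, hη.lintegral_ell_rpow hγ hβ]

lemma integrable_ellWith_mul (hη : IsPoissonProcess P η (ENNReal.ofReal γ • hvol n)) (hγ : 0 < γ)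
    {α : ℝ} (hα : 0 < α) (e : IdealPoint n) (x y : HSpace n) :
    Integrable (fun ω => ellWith e (η ω) y x ^ α * ellWith e (η ω) x y ^ α) P := by
  have h2α : 0 < 2 * α := by positivity
  refine ((hη.integrable_ell_rpow hγ h2α e x).add (hη.integrable_ell_rpow hγ h2α e y)).mono'
    (((hη.measurable_ellWith e y x).pow_const α).mul
      ((hη.measurable_ellWith e x y).pow_const α)).aestronglyMeasurable ?_
  filter_upwards [hη.ae_ellWith_le_ell hγ e y x, hη.ae_ellWith_le_ell hγ e x y] with ω hx hy
  rw [Real.norm_of_nonneg (ellWith_rpow_mul_nonneg e (η ω) x y α)]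
  calc ellWith e (η ω) y x ^ α * ellWith e (η ω) x y ^ α
      ≤ ell e (η ω) x ^ α * ell e (η ω) y ^ α :=
        mul_le_mul (Real.rpow_le_rpow (ellWith_nonneg _ _ _ _) hx hα.le)
          (Real.rpow_le_rpow (ellWith_nonneg _ _ _ _) hy hα.le)
          (Real.rpow_nonneg (ellWith_nonneg _ _ _ _) _) (Real.rpow_nonneg (ell_nonneg _ _ _) _)
    _ ≤ ell e (η ω) x ^ (2 * α) + ell e (η ω) y ^ (2 * α) :=
        rpow_mul_rpow_le_add_rpow_two_mul (ell_nonneg _ _ _) (ell_nonneg _ _ _)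

lemma integral_ellWith_mul (hη : IsPoissonProcess P η (ENNReal.ofReal γ • hvol n)) (hγ : 0 < γ)
    {α : ℝ} (hα : 0 < α) {e : IdealPoint n} {x y : HSpace n}
    (hxy : horoLevel e x ≠ horoLevel e y) :
    ∫ ω, ellWith e (η ω) y x ^ α * ellWith e (η ω) x y ^ α ∂P =
      (edgeMixedMoment γ α (horoLevel e) ∅ x y).toReal := by
  rw [integral_eq_lintegral_of_nonneg_ae
    (Eventually.of_forall fun ω => ellWith_rpow_mul_nonneg e (η ω) x y α)
    (hη.integrable_ellWith_mul hγ hα e x y).aestronglyMeasurable,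
    ← hη.lintegral_ellWith_mul hγ hα hxy]
  congr 1
  exact lintegral_congr fun ω => ENNReal.ofReal_mul (Real.rpow_nonneg (ellWith_nonneg _ _ _ _) _)

lemma covTerm_eq (hη : IsPoissonProcess P η (ENNReal.ofReal γ • hvol n)) (hγ : 0 < γ) {α : ℝ}
    (hα : 0 < α) {e : IdealPoint n} {x y : HSpace n} (hxy : horoLevel e x ≠ horoLevel e y) :
    covTerm P η e α x y = edgeCov γ α (horoLevel e) ∅ x y := by
  rw [covTerm, edgeCov, hη.integral_ellWith_mul hγ hα hxy, hη.integral_ell_rpow hγ hα,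
    hη.integral_ell_rpow hγ hα]

end IsPoissonProcess

/-! ### Averages over large balls -/

lemma toReal_hvol_hball (o : HSpace n) (R : ℝ) : (hvol n (hball o R)).toReal = ballVol n R := by
  rw [hvol_hball, ENNReal.toReal_ofReal (ballVol_nonneg _)]

instance isFiniteMeasure_restrict_hball (o : HSpace n) (R : ℝ) :
    IsFiniteMeasure ((hvol n).restrict (hball o R)) :=
  isFiniteMeasure_restrict.2 (hvol_hball_lt_top o R).ne

section BallAverage

variable {f : HSpace n → ℝ} {C : ℝ}

lemma integrable_restrict_hball (hf : AEStronglyMeasurable f (hvol n))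
    (hC : ∀ᵐ x ∂hvol n, |f x| ≤ C) (o : HSpace n) (R : ℝ) :
    Integrable f ((hvol n).restrict (hball o R)) :=
  Integrable.of_bound hf.restrict C (ae_restrict_of_ae hC)

variable {o : HSpace n}

lemma abs_setIntegral_hball_le {δ r : ℝ} (hC₀ : 0 ≤ C) (hδ₀ : 0 ≤ δ)
    (hC : ∀ᵐ x ∂hvol n, |f x| ≤ C) (hδ : ∀ x, r ≤ hdist o x → |f x| ≤ δ) (R : ℝ) :
    |∫ x in hball o R, f x ∂hvol n| ≤ C * ballVol n r + δ * ballVol n R := by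
  have hind : Integrable ((hball o r).indicator fun _ => C) ((hvol n).restrict (hball o R)) :=
    (integrable_const C).indicator (measurableSet_hball o r)
  have hbound : ∀ᵐ x ∂(hvol n).restrict (hball o R),
      ‖f x‖ ≤ (hball o r).indicator (fun _ => C) x + δ := by
    filter_upwards [ae_restrict_of_ae hC] with x hx
    by_cases hxr : x ∈ hball o r
    · rw [Set.indicator_of_mem hxr]
      exact hx.trans (le_add_of_nonneg_right hδ₀)
    · rw [Set.indicator_of_notMem hxr, zero_add]
      exact hδ x (not_lt.1 hxr)
  have hvol_le : ((hvol n).restrict (hball o R)).real (hball o r) ≤ ballVol n r := by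
    rw [← toReal_hvol_hball o r]
    exact ENNReal.toReal_mono (hvol_hball_lt_top o r).ne (Measure.restrict_apply_le _ _)
  calc |∫ x in hball o R, f x ∂hvol n|
      ≤ ∫ x in hball o R, ((hball o r).indicator (fun _ => C) x + δ) ∂hvol n :=
        norm_integral_le_of_norm_le (hind.add (integrable_const δ)) hbound
    _ = C * ((hvol n).restrict (hball o R)).real (hball o r) + δ * ballVol n R := by
        rw [integral_add hind (integrable_const δ), integral_indicator_const C
          (measurableSet_hball o r), setIntegral_const, measureReal_def (hvol n),
          toReal_hvol_hball, smul_eq_mul, smul_eq_mul, mul_comm, mul_comm δ]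
    _ ≤ C * ballVol n r + δ * ballVol n R := by gcongr

lemma tendsto_ball_average (hf : AEStronglyMeasurable f (hvol n))
    (hC : ∀ᵐ x ∂hvol n, |f x| ≤ C) {L : ℝ} (hlim : Tendsto f (comap (hdist o) atTop) (𝓝 L)) :
    Tendsto (fun R => (∫ x in hball o R, f x ∂hvol n) / ballVol n R) atTop (𝓝 L) := by
  rw [Metric.tendsto_nhds] at hlim ⊢
  intro ε hε
  obtain ⟨r, hr⟩ := eventually_atTop.1 (eventually_comap.1 (hlim (ε / 2) (half_pos hε)))
  have hfar : ∀ x, r ≤ hdist o x → |f x - L| ≤ ε / 2 := fun x hx => (hr _ hx x rfl).le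
  have hbdd : ∀ᵐ x ∂hvol n, |f x - L| ≤ |C| + |L| := by
    filter_upwards [hC] with x hx
    exact (abs_sub _ _).trans (add_le_add_left (hx.trans (le_abs_self C)) _)
  have hV := tendsto_ballVol (n := n)
  filter_upwards [hV.eventually_gt_atTop (2 * ((|C| + |L|) * ballVol n r) / ε),
    hV.eventually_gt_atTop 0] with R hR hpos
  have hdiff : (∫ x in hball o R, f x ∂hvol n) / ballVol n R - L =
      (∫ x in hball o R, (f x - L) ∂hvol n) / ballVol n R := by
    rw [integral_sub (integrable_restrict_hball hf hC o R) (integrable_const L), setIntegral_const,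
      measureReal_def, toReal_hvol_hball, smul_eq_mul, sub_div, mul_div_cancel_left₀ L hpos.ne']
  have hle := abs_setIntegral_hball_le (o := o) (by positivity) (half_pos hε).le hbdd hfar R
  rw [Real.dist_eq, hdiff, abs_div, abs_of_pos hpos, div_lt_iff₀ hpos]
  rw [div_lt_iff₀ hε] at hR
  linarith

end BallAverage

section RadialCovariance

lemma ae_radialLevel_ne (o x : HSpace n) : ∀ᵐ y ∂hvol n, radialLevel o x ≠ radialLevel o y := by
  refine measure_mono_null (fun y hy => ?_) (hvol_hdist_eq_zero o (hdist o x))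
  exact (neg_injective (not_not.1 hy)).symm

lemma integral_covDecay_eq (γ : ℝ) (x x' : HSpace n) :
    ∫ y, covDecay n γ (hdist x y) ∂hvol n = ∫ y, covDecay n γ (hdist x' y) ∂hvol n := by
  obtain ⟨φ, hφ, rfl⟩ := exists_isometry_apply_eq x x'
  rw [← hφ.measurePreserving.integral_comp φ.measurableEmbedding
    (fun y => covDecay n γ (hdist (φ x) y))]
  simp_rw [hφ.hdist_map]

lemma stronglyMeasurable_edgeCovIntegral (γ α : ℝ) {b : HSpace n → ℝ} (hb : Measurable b)
    {F : Set (HSpace n)} (hF : F.Countable) : StronglyMeasurable (edgeCovIntegral γ α b F) := by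
  have hS : MeasurableSet {q : HSpace n × HSpace n | b q.1 < b q.2} :=
    measurableSet_lt (hb.comp measurable_fst) (hb.comp measurable_snd)
  have hkernel := ((measurable_edgeCov γ α hb hF).indicator hS).stronglyMeasurable
  convert hkernel.integral_prod_right' (ν := hvol n) using 2 with x
  rw [edgeCovIntegral, ← integral_indicator (measurableSet_lt measurable_const hb)]
  rfl

variable {γ α : ℝ}

lemma abs_edgeCovIntegral_le (hγ : 0 < γ) (hα : 0 < α) {c x : HSpace n} (hx : x ≠ c) :
    |edgeCovIntegral γ α (radialLevel c) {c} x| ≤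
      (edgeTailMoment n γ α).toReal ^ 2 * ∫ y, covDecay n γ (hdist c y) ∂hvol n := by
  have hint := (integrable_covDecay hγ x).const_mul ((edgeTailMoment n γ α).toReal ^ 2)
  have hbound : ∀ᵐ y ∂hvol n, ‖edgeCov γ α (radialLevel c) {c} x y‖ ≤
      (edgeTailMoment n γ α).toReal ^ 2 * covDecay n γ (hdist x y) := by
    filter_upwards [ae_ne c] with y hy
    exact (hasTailBound_radialLevel hγ hx).abs_edgeCov_le (hasTailBound_radialLevel hγ hy) hγ hα
      (measurable_radialLevel c) (Set.countable_singleton c)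
  rw [integral_covDecay_eq γ c x, ← integral_const_mul]
  refine (norm_integral_le_of_norm_le hint.integrableOn (ae_restrict_of_ae hbound)).trans
    (setIntegral_le_integral hint (Eventually.of_forall fun y => ?_))
  exact mul_nonneg (sq_nonneg _) (covDecay_nonneg _ _)

variable (o : HSpace n) (R : ℝ)

lemma ae_prod_ne :
    ∀ᵐ q ∂((hvol n).restrict (hball o R)).prod ((hvol n).restrict (hball o R)),
      q.1 ≠ o ∧ q.2 ≠ o :=
  have hne := ae_restrict_of_ae (s := hball o R) (ae_ne o)
  (Measure.quasiMeasurePreserving_fst.ae hne).and (Measure.quasiMeasurePreserving_snd.ae hne)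

lemma ae_prod_radialLevel_ne :
    ∀ᵐ q ∂((hvol n).restrict (hball o R)).prod ((hvol n).restrict (hball o R)),
      radialLevel o q.1 ≠ radialLevel o q.2 := by
  have hb := measurable_radialLevel o
  rw [Measure.ae_prod_iff_ae_ae (p := fun q => radialLevel o q.1 ≠ radialLevel o q.2)
    (measurableSet_eq_fun (hb.comp measurable_fst) (hb.comp measurable_snd)).compl]
  exact Eventually.of_forall fun x => ae_restrict_of_ae (ae_radialLevel_ne o x)

lemma integrable_edgeCov_radialLevel (hγ : 0 < γ) (hα : 0 < α) :
    Integrable (fun q : HSpace n × HSpace n => edgeCov γ α (radialLevel o) {o} q.1 q.2)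
      (((hvol n).restrict (hball o R)).prod ((hvol n).restrict (hball o R))) := by
  have hb := measurable_radialLevel o
  have ho := Set.countable_singleton o
  refine Integrable.of_bound (measurable_edgeCov γ α hb ho).aestronglyMeasurable
    ((edgeTailMoment n γ α).toReal ^ 2) ?_
  filter_upwards [ae_prod_ne o R] with q hq
  exact ((hasTailBound_radialLevel hγ hq.1).abs_edgeCov_le (hasTailBound_radialLevel hγ hq.2)
    hγ hα hb ho).trans (mul_le_of_le_one_right (sq_nonneg _) (covDecay_le_one hγ.le _))

lemma setIntegral_edgeCov_radialLevel_compl (γ α : ℝ) :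
    ∫ q in {q | radialLevel o q.1 < radialLevel o q.2}ᶜ, edgeCov γ α (radialLevel o) {o} q.1 q.2
        ∂((hvol n).restrict (hball o R)).prod ((hvol n).restrict (hball o R)) =
      ∫ q in {q | radialLevel o q.1 < radialLevel o q.2}, edgeCov γ α (radialLevel o) {o} q.1 q.2
        ∂((hvol n).restrict (hball o R)).prod ((hvol n).restrict (hball o R)) := by
  set ν := (hvol n).restrict (hball o R)
  set S := {q : HSpace n × HSpace n | radialLevel o q.1 < radialLevel o q.2}
  have hswap : (Sᶜ : Set (HSpace n × HSpace n)) =ᵐ[ν.prod ν] Prod.swap ⁻¹' S := by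
    filter_upwards [ae_prod_radialLevel_ne o R] with q hq
    exact propext (not_lt.trans (lt_iff_le_and_ne.trans (and_iff_left hq.symm)).symm)
  rw [setIntegral_congr_set hswap,
    ← (Measure.measurePreserving_swap (μ := ν) (ν := ν)).setIntegral_preimage_emb
      MeasurableEquiv.prodComm.measurableEmbedding _ S]
  exact integral_congr_ae (Eventually.of_forall fun q =>
    edgeCov_comm γ α (measurable_radialLevel o) (Set.countable_singleton o) q.1 q.2)

lemma setIntegral_edgeCov_radialLevel (hγ : 0 < γ) (hα : 0 < α) :
    ∫ q in {q | radialLevel o q.1 < radialLevel o q.2}, edgeCov γ α (radialLevel o) {o} q.1 q.2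
        ∂((hvol n).restrict (hball o R)).prod ((hvol n).restrict (hball o R)) =
      ∫ x in hball o R, edgeCovIntegral γ α (radialLevel o) {o} x ∂hvol n := by
  have hb := measurable_radialLevel o
  have hS : MeasurableSet {q : HSpace n × HSpace n | radialLevel o q.1 < radialLevel o q.2} :=
    measurableSet_lt (hb.comp measurable_fst) (hb.comp measurable_snd)
  rw [← integral_indicator hS,
    integral_prod _ ((integrable_edgeCov_radialLevel o R hγ hα).indicator hS)]
  refine setIntegral_congr_fun (measurableSet_hball o R) fun x hx => ?_
  have hsub : {y | radialLevel o x < radialLevel o y} ⊆ hball o R :=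
    fun y hy => (radialLevel_lt.1 hy).trans hx
  rw [edgeCovIntegral, ← Measure.restrict_restrict_of_subset hsub,
    ← integral_indicator (measurableSet_lt measurable_const hb)]
  rfl

lemma integral_edgeCov_radialLevel (hγ : 0 < γ) (hα : 0 < α) :
    ∫ q, edgeCov γ α (radialLevel o) {o} q.1 q.2
        ∂((hvol n).restrict (hball o R)).prod ((hvol n).restrict (hball o R)) =
      2 * ∫ x in hball o R, edgeCovIntegral γ α (radialLevel o) {o} x ∂hvol n := by
  have hb := measurable_radialLevel o
  have hS : MeasurableSet {q : HSpace n × HSpace n | radialLevel o q.1 < radialLevel o q.2} :=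
    measurableSet_lt (hb.comp measurable_fst) (hb.comp measurable_snd)
  rw [← integral_add_compl hS (integrable_edgeCov_radialLevel o R hγ hα),
    setIntegral_edgeCov_radialLevel_compl, setIntegral_edgeCov_radialLevel o R hγ hα, two_mul]

end RadialCovariance

/-! ### Variance of the edge-length functional -/

section RadialMoments

variable {γ α β : ℝ}

lemma ae_edgeMoment_radialLevel_le (hγ : 0 < γ) (β : ℝ) (o : HSpace n) :
    ∀ᵐ x ∂hvol n, edgeMoment γ β (radialLevel o) {o} x ≤ edgeTailMoment n γ β := by
  filter_upwards [ae_ne o] with x hx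
  exact (hasTailBound_radialLevel hγ hx).edgeMoment_le hγ β

lemma ae_abs_toReal_edgeMoment_le (hγ : 0 < γ) (hβ : 0 < β) (o : HSpace n) :
    ∀ᵐ x ∂hvol n,
      |(edgeMoment γ β (radialLevel o) {o} x).toReal| ≤ (edgeTailMoment n γ β).toReal := by
  filter_upwards [ae_edgeMoment_radialLevel_le hγ β o] with x hx
  rw [abs_of_nonneg ENNReal.toReal_nonneg]
  exact ENNReal.toReal_mono (edgeTailMoment_lt_top hγ hβ).ne hx

lemma ae_abs_edgeCovIntegral_le (hγ : 0 < γ) (hα : 0 < α) (o : HSpace n) :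
    ∀ᵐ x ∂hvol n, |edgeCovIntegral γ α (radialLevel o) {o} x| ≤
      (edgeTailMoment n γ α).toReal ^ 2 * ∫ y, covDecay n γ (hdist o y) ∂hvol n :=
  (ae_ne o).mono fun _ hx => abs_edgeCovIntegral_le hγ hα hx

section Ball

variable (o : HSpace n) (R : ℝ)

lemma lintegral_edgeMoment_radialLevel_ne_top (hγ : 0 < γ) (hβ : 0 < β) :
    ∫⁻ x in hball o R, edgeMoment γ β (radialLevel o) {o} x ∂hvol n ≠ ∞ := by
  refine ne_top_of_le_ne_top ?_
    (lintegral_mono_ae (ae_restrict_of_ae (ae_edgeMoment_radialLevel_le hγ β o)))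
  rw [lintegral_const]
  exact ENNReal.mul_ne_top (edgeTailMoment_lt_top hγ hβ).ne (measure_ne_top _ _)

lemma lintegral_edgeMixedMoment_radialLevel_ne_top (hγ : 0 < γ) (hα : 0 < α) :
    ∫⁻ q, edgeMixedMoment γ α (radialLevel o) {o} q.1 q.2
      ∂((hvol n).restrict (hball o R)).prod ((hvol n).restrict (hball o R)) ≠ ∞ := by
  set T := edgeTailMoment n γ α
  have hT : T ≠ ∞ := (edgeTailMoment_lt_top hγ hα).ne
  have hle : ∀ᵐ q ∂((hvol n).restrict (hball o R)).prod ((hvol n).restrict (hball o R)),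
      edgeMixedMoment γ α (radialLevel o) {o} q.1 q.2 ≤ T * T + 1 * (T * T) := by
    filter_upwards [ae_prod_ne o R] with q hq
    have hq₁ := hasTailBound_radialLevel hγ hq.1
    have hq₂ := hasTailBound_radialLevel hγ hq.2
    refine (hq₁.edgeMixedMoment_le hq₂ hγ (measurable_radialLevel o)
      (Set.countable_singleton o)).trans ?_
    gcongr
    · exact hq₁.edgeMoment_le hγ α
    · exact hq₂.edgeMoment_le hγ α
    · exact ENNReal.ofReal_le_one.2 (covDecay_le_one hγ.le _)
  refine ne_top_of_le_ne_top ?_ (lintegral_mono_ae hle)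
  rw [lintegral_const, one_mul]
  exact ENNReal.mul_ne_top (ENNReal.add_ne_top.2 ⟨ENNReal.mul_ne_top hT hT,
    ENNReal.mul_ne_top hT hT⟩) (measure_ne_top _ _)

lemma integrable_edgeMoment_radialLevel (hγ : 0 < γ) (hβ : 0 < β) :
    Integrable (fun x => (edgeMoment γ β (radialLevel o) {o} x).toReal)
      ((hvol n).restrict (hball o R)) :=
  integrable_toReal_of_lintegral_ne_top
    (measurable_edgeMoment γ β (measurable_radialLevel o) (Set.countable_singleton o)).aemeasurable
    (lintegral_edgeMoment_radialLevel_ne_top o R hγ hβ)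

lemma integral_edgeMoment_radialLevel (hγ : 0 < γ) (hβ : 0 < β) :
    ∫ x in hball o R, (edgeMoment γ β (radialLevel o) {o} x).toReal ∂hvol n =
      (∫⁻ x in hball o R, edgeMoment γ β (radialLevel o) {o} x ∂hvol n).toReal := by
  have hmeas := measurable_edgeMoment γ β (measurable_radialLevel o) (Set.countable_singleton o)
  exact integral_toReal hmeas.aemeasurable
    (ae_lt_top hmeas (lintegral_edgeMoment_radialLevel_ne_top o R hγ hβ))

lemma integral_edgeMixedMoment_radialLevel (hγ : 0 < γ) (hα : 0 < α) :
    ∫ q, (edgeMixedMoment γ α (radialLevel o) {o} q.1 q.2).toReal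
        ∂((hvol n).restrict (hball o R)).prod ((hvol n).restrict (hball o R)) =
      (∫⁻ q, edgeMixedMoment γ α (radialLevel o) {o} q.1 q.2
        ∂((hvol n).restrict (hball o R)).prod ((hvol n).restrict (hball o R))).toReal := by
  have hmeas :=
    measurable_edgeMixedMoment γ α (measurable_radialLevel o) (Set.countable_singleton o)
  exact integral_toReal hmeas.aemeasurable
    (ae_lt_top hmeas (lintegral_edgeMixedMoment_radialLevel_ne_top o R hγ hα))

lemma integral_edgeMixedMoment_radialLevel_eq (hγ : 0 < γ) (hα : 0 < α) :
    ∫ q, (edgeMixedMoment γ α (radialLevel o) {o} q.1 q.2).toReal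
        ∂((hvol n).restrict (hball o R)).prod ((hvol n).restrict (hball o R)) =
      2 * (∫ x in hball o R, edgeCovIntegral γ α (radialLevel o) {o} x ∂hvol n) +
        (∫ x in hball o R, (edgeMoment γ α (radialLevel o) {o} x).toReal ∂hvol n) ^ 2 := by
  have hmoment := integrable_edgeMoment_radialLevel o R hγ hα
  rw [← integral_edgeCov_radialLevel o R hγ hα, sq, ← integral_prod_mul,
    ← integral_add (integrable_edgeCov_radialLevel o R hγ hα) (hmoment.mul_prod hmoment)]
  simp only [edgeCov, sub_add_cancel]

end Ball

/-- The contribution of a point at `x` to the variance of the edge-length functional of the radial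
tree with centre `c`. -/
def varDensity (γ α : ℝ) (c x : HSpace n) : ℝ :=
  γ * (edgeMoment γ (2 * α) (radialLevel c) {c} x).toReal +
    2 * γ ^ 2 * edgeCovIntegral γ α (radialLevel c) {c} x

lemma measurable_varDensity (γ α : ℝ) (c : HSpace n) : Measurable (varDensity γ α c) :=
  ((measurable_edgeMoment γ (2 * α) (measurable_radialLevel c)
    (Set.countable_singleton c)).ennreal_toReal.const_mul γ).add
    ((stronglyMeasurable_edgeCovIntegral γ α (measurable_radialLevel c)
      (Set.countable_singleton c)).measurable.const_mul _)

lemma exists_ae_abs_varDensity_le (hγ : 0 < γ) (hα : 0 < α) (o : HSpace n) :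
    ∃ C, ∀ᵐ x ∂hvol n, |varDensity γ α o x| ≤ C := by
  refine ⟨|γ| * (edgeTailMoment n γ (2 * α)).toReal +
    |2 * γ ^ 2| * ((edgeTailMoment n γ α).toReal ^ 2 * ∫ y, covDecay n γ (hdist o y) ∂hvol n), ?_⟩
  filter_upwards [ae_abs_toReal_edgeMoment_le hγ (by positivity : 0 < 2 * α) o,
    ae_abs_edgeCovIntegral_le hγ hα o] with x hmoment hcov
  refine (abs_add_le _ _).trans ?_
  rw [abs_mul, abs_mul (2 * γ ^ 2)]
  gcongr

lemma setIntegral_varDensity (hγ : 0 < γ) (hα : 0 < α) (o : HSpace n) (R : ℝ) :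
    ∫ x in hball o R, varDensity γ α o x ∂hvol n =
      γ * (∫ x in hball o R, (edgeMoment γ (2 * α) (radialLevel o) {o} x).toReal ∂hvol n) +
        2 * γ ^ 2 * ∫ x in hball o R, edgeCovIntegral γ α (radialLevel o) {o} x ∂hvol n := by
  have hmoment := integrable_edgeMoment_radialLevel o R hγ (by positivity : 0 < 2 * α)
  have hcov := integrable_restrict_hball (stronglyMeasurable_edgeCovIntegral γ α
    (measurable_radialLevel o) (Set.countable_singleton o)).aestronglyMeasurable
    (ae_abs_edgeCovIntegral_le hγ hα o) o R
  unfold varDensity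
  rw [integral_add (hmoment.const_mul γ) (hcov.const_mul _), integral_const_mul,
    integral_const_mul]

lemma tendsto_varDensity (e : IdealPoint n) (hγ : 0 < γ) (hα : 0 < α) (o : HSpace n) :
    Tendsto (varDensity γ α o) (comap (hdist o) atTop)
      (𝓝 (γ * (edgeMoment γ (2 * α) (horoLevel e) ∅ o).toReal +
        2 * γ ^ 2 * edgeCovIntegral γ α (horoLevel e) ∅ o)) := by
  have h2α : 0 < 2 * α := by positivity
  have hfin := ((hasTailBound_horoLevel e hγ o).edgeMoment_lt_top hγ h2α).ne
  refine tendsto_of_isometry_invariant (fun φ hφ c x => ?_) o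
    ((((ENNReal.tendsto_toReal hfin).comp (tendsto_edgeMoment e hγ h2α o)).const_mul γ).add
      ((tendsto_edgeCovIntegral e hγ hα o).const_mul (2 * γ ^ 2)))
  rw [varDensity, hφ.edgeMoment_radialLevel, hφ.edgeCovIntegral_radialLevel, varDensity]

end RadialMoments

lemma measurable_radialLength_rpow (o : HSpace n) (α : ℝ) :
    Measurable fun p : HSpace n × Config n => ENNReal.ofReal (radialLength o p.2 p.1 ^ α) :=
  ((measurable_radialLength o).pow_const α).ennreal_ofReal

lemma measurable_radialLength_rpow_mul (o : HSpace n) (α : ℝ) :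
    Measurable fun p : HSpace n × HSpace n × Config n =>
      ENNReal.ofReal (radialLength o p.2.2 p.1 ^ α) *
        ENNReal.ofReal (radialLength o p.2.2 p.2.1 ^ α) :=
  ((measurable_radialLength_rpow o α).comp
    (measurable_fst.prodMk (measurable_snd.comp measurable_snd))).mul
    ((measurable_radialLength_rpow o α).comp measurable_snd)

lemma intensity_hball_ne_top (γ : ℝ) (o : HSpace n) (R : ℝ) :
    (ENNReal.ofReal γ • hvol n) (hball o R) ≠ ∞ :=
  ENNReal.mul_ne_top ENNReal.ofReal_ne_top (hvol_hball_lt_top o R).ne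

lemma ofReal_rpow_mul_self {a : ℝ} (ha : 0 ≤ a) (α : ℝ) :
    ENNReal.ofReal (a ^ α) * ENNReal.ofReal (a ^ α) = ENNReal.ofReal (a ^ (2 * α)) := by
  rw [← ENNReal.ofReal_mul (Real.rpow_nonneg ha _), mul_comm 2 α, Real.rpow_mul ha, Real.rpow_two,
    sq]

namespace IsPoissonProcess

variable {Ω : Type*} [MeasurableSpace Ω] {P : Measure Ω} {η : Ω → Set (HSpace n)}

section Functional

variable {μ : Measure (HSpace n)} (hη : IsPoissonProcess P η μ) (o : HSpace n) (α R : ℝ)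

include hη

lemma edgeLengthFunctional_eq_sum (ω : Ω) :
    edgeLengthFunctional o α R (η ω) = ∑ x ∈ hη.pointsIn o R ω, radialLength o (η ω) x ^ α :=
  finsum_mem_eq_finite_toFinset_sum _ (hη.locallyFinite ω o R)

lemma edgeLengthFunctional_nonneg (ω : Ω) : 0 ≤ edgeLengthFunctional o α R (η ω) := by
  rw [hη.edgeLengthFunctional_eq_sum]
  exact Finset.sum_nonneg fun x _ => Real.rpow_nonneg (radialLength_nonneg _ _ _) _

lemma ofReal_edgeLengthFunctional (ω : Ω) :
    ENNReal.ofReal (edgeLengthFunctional o α R (η ω)) =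
      ∑ x ∈ hη.pointsIn o R ω, ENNReal.ofReal (radialLength o (η ω) x ^ α) := by
  rw [hη.edgeLengthFunctional_eq_sum, ENNReal.ofReal_sum_of_nonneg]
  exact fun x _ => Real.rpow_nonneg (radialLength_nonneg _ _ _) _

lemma ofReal_edgeLengthFunctional_sq (ω : Ω) :
    ENNReal.ofReal (edgeLengthFunctional o α R (η ω) ^ 2) =
      ∑ x ∈ hη.pointsIn o R ω, ∑ y ∈ hη.pointsIn o R ω,
        ENNReal.ofReal (radialLength o (η ω) x ^ α) *
          ENNReal.ofReal (radialLength o (η ω) y ^ α) := by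
  rw [ENNReal.ofReal_pow (hη.edgeLengthFunctional_nonneg o α R ω),
    hη.ofReal_edgeLengthFunctional, sq, Finset.sum_mul_sum]

lemma measurable_edgeLengthFunctional :
    Measurable fun ω => edgeLengthFunctional o α R (η ω) := by
  have hlength := measurable_radialLength_rpow o α
  have hsum : Measurable fun ω => (∫⁻ p, ENNReal.ofReal (radialLength o p.2 p.1 ^ α)
      ∂hη.empiricalMeasure o R ω).toReal :=
    ((Measure.measurable_lintegral hlength).comp hη.measurable_empiricalMeasure).ennreal_toReal
  convert hsum using 2 with ω
  refine (ENNReal.toReal_ofReal (hη.edgeLengthFunctional_nonneg o α R ω)).symm.trans ?_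
  rw [hη.lintegral_empiricalMeasure hlength, hη.ofReal_edgeLengthFunctional]
  rfl

end Functional

variable [IsProbabilityMeasure P] {γ α : ℝ}
  (hη : IsPoissonProcess P η (ENNReal.ofReal γ • hvol n)) (hγ : 0 < γ) (hα : 0 < α)

include hη hγ hα

lemma lintegral_edgeLengthFunctional (o : HSpace n) (R : ℝ) :
    ∫⁻ ω, ENNReal.ofReal (edgeLengthFunctional o α R (η ω)) ∂P =
      ENNReal.ofReal γ * ∫⁻ x in hball o R, edgeMoment γ α (radialLevel o) {o} x ∂hvol n := by
  refine (lintegral_congr fun ω => hη.ofReal_edgeLengthFunctional o α R ω).trans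
    ((hη.mecke (intensity_hball_ne_top γ o R) (measurable_radialLength_rpow o α)).trans ?_)
  rw [Measure.restrict_smul, lintegral_smul_measure, smul_eq_mul]
  congr 1
  refine lintegral_congr_ae ?_
  filter_upwards [ae_restrict_of_ae (ae_ne o)] with x hx
  exact hη.lintegral_radialLength_rpow hγ hα hx

lemma lintegral_edgeLengthFunctional_sq (o : HSpace n) (R : ℝ) :
    ∫⁻ ω, ENNReal.ofReal (edgeLengthFunctional o α R (η ω) ^ 2) ∂P =
      ENNReal.ofReal γ ^ 2 * (∫⁻ q, edgeMixedMoment γ α (radialLevel o) {o} q.1 q.2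
        ∂((hvol n).restrict (hball o R)).prod ((hvol n).restrict (hball o R))) +
      ENNReal.ofReal γ * ∫⁻ x in hball o R, edgeMoment γ (2 * α) (radialLevel o) {o} x ∂hvol n := by
  refine (lintegral_congr fun ω => hη.ofReal_edgeLengthFunctional_sq o α R ω).trans
    ((hη.mecke_pair (intensity_hball_ne_top γ o R)
      (measurable_radialLength_rpow_mul o α)).trans ?_)
  simp_rw [Measure.restrict_smul, lintegral_smul_measure, smul_eq_mul]
  have hne := ae_restrict_of_ae (s := hball o R) (ae_ne o)
  congr 1
  · rw [lintegral_prod _ (measurable_edgeMixedMoment γ α (measurable_radialLevel o)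
      (Set.countable_singleton o)).aemeasurable, lintegral_const_mul' _ _ ENNReal.ofReal_ne_top,
      sq, mul_assoc]
    congr 2
    refine lintegral_congr_ae (hne.mono fun x hx => lintegral_congr_ae (hne.mono fun y hy => ?_))
    exact hη.lintegral_radialLength_mul hγ hα hx hy
  · congr 1
    refine lintegral_congr_ae (hne.mono fun x hx => Eq.trans ?_
      (hη.lintegral_radialLength_rpow hγ (by positivity) hx))
    exact lintegral_congr fun ω => ofReal_rpow_mul_self (radialLength_nonneg _ _ _) α

lemma memLp_edgeLengthFunctional (o : HSpace n) (R : ℝ) :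
    MemLp (fun ω => edgeLengthFunctional o α R (η ω)) 2 P := by
  have hmeas := hη.measurable_edgeLengthFunctional o α R
  rw [memLp_two_iff_integrable_sq hmeas.aestronglyMeasurable,
    ← lintegral_ofReal_ne_top_iff_integrable (hmeas.pow_const 2).aestronglyMeasurable
      (Eventually.of_forall fun ω => sq_nonneg _),
    hη.lintegral_edgeLengthFunctional_sq hγ hα]
  exact ENNReal.add_ne_top.2
    ⟨ENNReal.mul_ne_top (ENNReal.pow_ne_top ENNReal.ofReal_ne_top)
      (lintegral_edgeMixedMoment_radialLevel_ne_top o R hγ hα),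
    ENNReal.mul_ne_top ENNReal.ofReal_ne_top
      (lintegral_edgeMoment_radialLevel_ne_top o R hγ (by positivity))⟩

lemma integral_edgeLengthFunctional (o : HSpace n) (R : ℝ) :
    ∫ ω, edgeLengthFunctional o α R (η ω) ∂P =
      γ * ∫ x in hball o R, (edgeMoment γ α (radialLevel o) {o} x).toReal ∂hvol n := by
  rw [integral_eq_lintegral_of_nonneg_ae
    (Eventually.of_forall fun ω => hη.edgeLengthFunctional_nonneg o α R ω)
    (hη.measurable_edgeLengthFunctional o α R).aestronglyMeasurable,
    hη.lintegral_edgeLengthFunctional hγ hα, ENNReal.toReal_mul, ENNReal.toReal_ofReal hγ.le,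
    integral_edgeMoment_radialLevel o R hγ hα]

lemma integral_edgeLengthFunctional_sq (o : HSpace n) (R : ℝ) :
    ∫ ω, edgeLengthFunctional o α R (η ω) ^ 2 ∂P =
      γ ^ 2 * (∫ q, (edgeMixedMoment γ α (radialLevel o) {o} q.1 q.2).toReal
        ∂((hvol n).restrict (hball o R)).prod ((hvol n).restrict (hball o R))) +
      γ * ∫ x in hball o R, (edgeMoment γ (2 * α) (radialLevel o) {o} x).toReal ∂hvol n := by
  have h2α : 0 < 2 * α := by positivity
  rw [integral_eq_lintegral_of_nonneg_ae (Eventually.of_forall fun ω => sq_nonneg _)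
    ((hη.measurable_edgeLengthFunctional o α R).pow_const 2).aestronglyMeasurable,
    hη.lintegral_edgeLengthFunctional_sq hγ hα, ENNReal.toReal_add
      (ENNReal.mul_ne_top (ENNReal.pow_ne_top ENNReal.ofReal_ne_top)
        (lintegral_edgeMixedMoment_radialLevel_ne_top o R hγ hα))
      (ENNReal.mul_ne_top ENNReal.ofReal_ne_top
        (lintegral_edgeMoment_radialLevel_ne_top o R hγ h2α)),
    ENNReal.toReal_mul, ENNReal.toReal_mul, ENNReal.toReal_pow, ENNReal.toReal_ofReal hγ.le,
    integral_edgeMoment_radialLevel o R hγ h2α, integral_edgeMixedMoment_radialLevel o R hγ hα]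

theorem variance_edgeLengthFunctional (o : HSpace n) (R : ℝ) :
    variance (fun ω => edgeLengthFunctional o α R (η ω)) P =
      ∫ x in hball o R, varDensity γ α o x ∂hvol n := by
  rw [variance_eq_sub (hη.memLp_edgeLengthFunctional hγ hα o R)]
  simp only [Pi.pow_apply]
  rw [hη.integral_edgeLengthFunctional hγ hα, hη.integral_edgeLengthFunctional_sq hγ hα,
    integral_edgeMixedMoment_radialLevel_eq o R hγ hα, setIntegral_varDensity hγ hα]
  ring

end IsPoissonProcess

lemma horoball_ae_eq (e : IdealPoint n) (x : HSpace n) :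
    (horoball e x : Set (HSpace n)) =ᵐ[hvol n] {y | horoLevel e x < horoLevel e y} := by
  rw [horoball_eq]
  filter_upwards [ae_horoLevel_ne e x] with z hz
  exact propext (lt_iff_le_and_ne.trans (and_iff_left hz)).symm

namespace IsPoissonProcess

variable {Ω : Type*} [MeasurableSpace Ω] {P : Measure Ω} [IsProbabilityMeasure P]
  {η : Ω → Set (HSpace n)} {γ α : ℝ} (hη : IsPoissonProcess P η (ENNReal.ofReal γ • hvol n))
  (hγ : 0 < γ) (hα : 0 < α) (e : IdealPoint n) (x : HSpace n)

include hη hγ hα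

lemma covTerm_ae_eq :
    covTerm P η e α x =ᵐ[hvol n] edgeCov γ α (horoLevel e) ∅ x :=
  (ae_horoLevel_ne e x).mono fun _ hy => hη.covTerm_eq hγ hα hy

lemma integrable_covTerm : Integrable (covTerm P η e α x) (hvol n) := by
  have hb := measurable_horoLevel e
  refine Integrable.congr ?_ (hη.covTerm_ae_eq hγ hα e x).symm
  refine ((integrable_covDecay hγ x).const_mul ((edgeTailMoment n γ α).toReal ^ 2)).mono'
    ((measurable_edgeCov γ α hb Set.countable_empty).comp
      measurable_prodMk_left).aestronglyMeasurable (Eventually.of_forall fun y => ?_)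
  exact (hasTailBound_horoLevel e hγ x).abs_edgeCov_le (hasTailBound_horoLevel e hγ y) hγ hα hb
    Set.countable_empty

lemma setIntegral_covTerm :
    ∫ y in horoball e x, covTerm P η e α x y ∂hvol n = edgeCovIntegral γ α (horoLevel e) ∅ x := by
  rw [edgeCovIntegral, setIntegral_congr_set (horoball_ae_eq e x)]
  exact integral_congr_ae (ae_restrict_of_ae (hη.covTerm_ae_eq hγ hα e x))

end IsPoissonProcess

end HypRST

end

open HypRST in
theorem proposition7p1 {n : ℕ} {Ω : Type*} [MeasurableSpace Ω] (P : Measure Ω)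
    [IsProbabilityMeasure P] (γ : ℝ) (hγ : 0 < γ) (α : ℝ) (hα : 0 < α)
    (η : Ω → Set (HSpace n)) (hη : IsPoissonProcess P η (ENNReal.ofReal γ • hvol n))
    (o : HSpace n) (e : IdealPoint n) :
    -- all moments and integrals that occur are well defined and finite
    (∀ R : ℝ, MemLp (fun ω => edgeLengthFunctional o α R (η ω)) 2 P) ∧
    (∀ R : ℝ, hvol n (hball o R) < ∞) ∧
    Integrable (fun ω => ell e (η ω) o ^ (2 * α)) P ∧
    (∀ y : HSpace n, Integrable (fun ω => ell e (η ω) y ^ α) P ∧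
      Integrable (fun ω => ellWith e (η ω) y o ^ α * ellWith e (η ω) o y ^ α) P) ∧
    IntegrableOn (fun y => covTerm P η e α o y) (horoball e o) (hvol n) ∧
    -- the limit exists and has the stated value
    Tendsto
      (fun R : ℝ =>
        variance (fun ω => edgeLengthFunctional o α R (η ω)) P / (hvol n (hball o R)).toReal)
      atTop
      (𝓝 (γ * (∫ ω, ell e (η ω) o ^ (2 * α) ∂P)
        + 2 * γ ^ 2 * ∫ y in horoball e o, covTerm P η e α o y ∂(hvol n))) := by
  have h2α : 0 < 2 * α := by positivity
  refine ⟨hη.memLp_edgeLengthFunctional hγ hα o, hvol_hball_lt_top o,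
    hη.integrable_ell_rpow hγ h2α e o,
    fun y => ⟨hη.integrable_ell_rpow hγ hα e y, hη.integrable_ellWith_mul hγ hα e o y⟩,
    (hη.integrable_covTerm hγ hα e o).integrableOn, ?_⟩
  obtain ⟨C, hC⟩ := exists_ae_abs_varDensity_le hγ hα o
  have hlim := tendsto_ball_average (measurable_varDensity γ α o).aestronglyMeasurable hC
    (tendsto_varDensity e hγ hα o)
  simpa only [hη.integral_ell_rpow hγ h2α, hη.setIntegral_covTerm hγ hα,
    hη.variance_edgeLengthFunctional hγ hα, toReal_hvol_hball] using hlim
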